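/- **Setting.** Let $d\in\{2,3\}$ and let $\Omega\subset\mathbb R^d$ be a bounded connected open polygonal/polyhedral domain lying locally on one side of its boundary, in the sense that $\Omega=\operatorname{int}\overline\Omega$ (every Lipschitz domain does), with a conforming mesh of $\overline\Omega$ by $N$ nondegenerate closed $d$-simplices $K$ of volume $|K|$. A discrete velocity $\mathbf u$ consists of a constant vector $\mathbf u^\circ_K\in\mathbb R^d$ for each element $K$ and a constant vector $\mathbf u^\partial_e\in\mathbb R^d$ for each facet $e\not\subset\partial\Omega$, and is $0$ on the facets in $\partial\Omega$; a discrete pressure is a vector $\mathbf p=(p_K)\in\mathbb R^N$. On each $K$ with outward unit normal $\mathbf n$, the weak gradient $\nabla_w u$ of a component of $\mathbf u$ is the element of $RT_0(K)=P_0(K)^d+\mathbf x P_0(K)$ with $(\nabla_w u,\mathbf q)_K=(u^\partial,\mathbf q\cdot\mathbf n)_{\partial K}-(u^\circ,\nabla\cdot\mathbf q)_K$ for all $\mathbf q\in RT_0(K)$, and the weak divergence is $\nabla_w\cdot\mathbf u|_K=|K|^{-1}\int_{\partial K}\mathbf u^\partial\cdot\mathbf n\,dS$. In the nodal basis let $$\mathbf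 v^TA\mathbf u=\sum_K(\nabla_w\mathbf u,\nabla_w\mathbf v)_K,\qquad \mathbf q^TB\mathbf u=\sum_K(\nabla_w\cdot\mathbf u,q)_K,\qquad M_p=\operatorname{diag}(|K_1|,\dots,|K_N|).$$ Let $0<\beta<1$ be an inf-sup constant of the discretization: for all $\mathbf p$ with $\sum_K|K|p_K=0$, $$\sup_{\mathbf v^TA\mathbf v\ne0}\frac{\mathbf v^TB^T\mathbf p}{(\mathbf v^TA\mathbf v)^{1/2}}\ge\beta\,(\mathbf p^TM_p\mathbf p)^{1/2}.$$ Let $\mathbf w\in\mathbb R^N$ with $\mathbf w^T\mathbf w=1$ and $\gamma=N^{-1/2}\sum_K w_K\ne0$. For $\rho>0$ put $$\mathcal A=\begin{bmatrix}A&-B^T\\-B&-\rho\,\mathbf w\mathbf w^T\end{bmatrix},\qquad \mathcal P_t=\begin{bmatrix}A&0\\-B&-M_p\end{bmatrix}.$$ For any right-hand side $\mathbf b$ and initial guess $\mathbf x_0$ let $\mathbf x_k$ ($k\ge0$) be the GMRES iterates for $\mathcal P_t^{-1}\mathcal A\mathbf x=\mathcal P_t^{-1}\mathbf b$ (which minimize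 the Euclidean norm of the residual over $\mathbf x_0$ plus the $k$-th Krylov space), and let $\mathbf r_k=\mathcal P_t^{-1}(\mathbf b-\mathcal A\mathbf x_k)$. Write $\lambda_{\min},\lambda_{\max}$ for the extreme eigenvalues and $$t=\frac{\rho}{\lambda_{\min}(M_p)},\quad c=\frac{\gamma^2N}{|\Omega|},\quad \theta=\Big(\frac{d\,\lambda_{\max}(M_p)}{\lambda_{\min}(A)}\Big)^{1/2},\quad \kappa=\frac{\lambda_{\max}(M_p)}{\lambda_{\min}(M_p)},\quad q_\rho=\frac{\sqrt{d+t}-\sqrt{\beta^2-t}}{\sqrt{d+t}+\sqrt{\beta^2-t}}.$$ **Proposition 5.2.** Let $0<\rho<\beta^2\lambda_{\min}(M_p)$. Then, for all $k\ge0$, $\mathbf b$ and $\mathbf x_0$: 1. $$\|\mathbf r_k\|\le 2\,(1+\theta+d)\;\frac{d+t+c\rho+\mathcal O(\rho^2)}{c\rho+\mathcal O(\rho^2)}\;q_\rho^{\,k-2}\;\|\mathbf r_0\|.$$ Here the denominator is positive, the two remainders are functions of $\rho$ only (they depend neither on $k$ nor on $\mathbf b,\mathbf x_0$), and they are bounded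 by $C\rho^2$ with a constant $C$ that does not depend on $\rho$ (it may depend on the mesh, $\mathbf w$ and $\beta$). 2. With an explicit remainder: there is $\eta=\eta(\rho)$, independent of $k,\mathbf b,\mathbf x_0$, with $|\eta|\le \dfrac{c\rho^2}{\beta^2\lambda_{\min}(M_p)+\rho}$ (so $c\rho+\eta>\tfrac12c\rho$) and $$\|\mathbf r_k\|\le 2\,(\theta+d\sqrt\kappa)\;\frac{d+t+c\rho+\eta}{c\rho+\eta}\;q_\rho^{\,k-2}\;\|\mathbf r_0\|.$$ 3. The number of iterations depends on $\gamma^2N\rho$ only logarithmically: for every $\varepsilon>0$ one has $\|\mathbf r_k\|\le\varepsilon\|\mathbf r_0\|$ as soon as $$k\ \ge\ 2+\frac{\log\!\big(4(d+2)(\theta+d\sqrt\kappa)\,|\Omega|\,/\,(\gamma^2N\rho\,\varepsilon)\big)}{\log(1/q_\rho)}.$$ -/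

import Mathlib

open MeasureTheory Matrix
open scoped RealInnerProductSpace

noncomputable section

namespace StokesWG

/-! ### GMRES -/

section Gmres

variable {n : Type*} [Fintype n] [DecidableEq n]

/-- The Euclidean norm of a coordinate vector. -/
def euclNorm (v : n → ℝ) : ℝ := ‖WithLp.toLp 2 v‖

/-- The Krylov space spanned by `r, T r, …, T ^ (k - 1) r`. -/
def krylov (T : Matrix n n ℝ) (r : n → ℝ) (k : ℕ) : Submodule ℝ (n → ℝ) :=
  Submodule.span ℝ (Set.range fun j : Fin k => (T ^ (j : ℕ)) *ᵥ r)

/-- `x` is a `k`-th (full, unrestarted) GMRES iterate for `T x = c` with initial guess `x₀`: it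
minimizes the Euclidean norm of the residual over `x₀ + krylov T (c - T x₀) k`. -/
structure IsGMRESIterate (T : Matrix n n ℝ) (c x₀ : n → ℝ) (k : ℕ) (x : n → ℝ) : Prop where
  mem : x - x₀ ∈ krylov T (c - T *ᵥ x₀) k
  minimal : ∀ y, y - x₀ ∈ krylov T (c - T *ᵥ x₀) k →
    euclNorm (c - T *ᵥ x) ≤ euclNorm (c - T *ᵥ y)

/-- Smallest eigenvalue of a real symmetric matrix. -/
def lamMin (A : Matrix n n ℝ) : ℝ := sInf (spectrum ℝ A)

/-- Largest eigenvalue of a real symmetric matrix. -/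
def lamMax (A : Matrix n n ℝ) : ℝ := sSup (spectrum ℝ A)

end Gmres

/-! ### Simplicial meshes -/

/-- The ambient Euclidean space. -/
abbrev Pt (d : ℕ) : Type := EuclideanSpace ℝ (Fin d)

/-- The closed simplex (element or facet) with the given vertices. -/
def hull {d : ℕ} (s : Finset (Pt d)) : Set (Pt d) := convexHull ℝ (s : Set (Pt d))

/-- Bounded connected open sets lying locally on one side of their boundary (as every Lipschitz
domain does). Together with the existence of a simplicial mesh this makes `Ω` a polygonal or
polyhedral domain. -/
structure IsStokesDomain {d : ℕ} (Ω : Set (Pt d)) : Prop where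
  isOpen : IsOpen Ω
  isConnected : IsConnected Ω
  isBounded : Bornology.IsBounded Ω
  interior_closure : interior (closure Ω) = Ω

/-- A conforming mesh of `Ω` by nondegenerate `d`-simplices; an element is given by the set of its
`d + 1` vertices. -/
structure SimplicialMesh {d : ℕ} (Ω : Set (Pt d)) where
  elems : Finset (Finset (Pt d))
  card_elem : ∀ K ∈ elems, K.card = d + 1
  affineIndependent : ∀ K ∈ elems, AffineIndependent ℝ ((↑) : K → Pt d)
  /-- Two elements meet in the common face spanned by their common vertices. -/
  conforming : ∀ K ∈ elems, ∀ L ∈ elems, hull K ∩ hull L ⊆ convexHull ℝ ((K : Set (Pt d)) ∩ L)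
  cover : (⋃ K ∈ elems, hull K) = closure Ω

/-- The `d`-dimensional volume `|K|` of an element. -/
def vol {d : ℕ} (K : Finset (Pt d)) : ℝ := (volume (hull K)).toReal

/-- The surface measure: `(d - 1)`-dimensional Hausdorff measure, normalized so as to agree with
Lebesgue measure on hyperplanes. -/
def surf (d : ℕ) : Measure (Pt d) := Measure.euclideanHausdorffMeasure (d - 1)

/-- The facets of an element. -/
def facetsOf {d : ℕ} (K : Finset (Pt d)) : Finset (Finset (Pt d)) := K.powersetCard d

/-- The arithmetic mean of the vertices. -/
def barycenter {d : ℕ} (s : Finset (Pt d)) : Pt d := (s.card : ℝ)⁻¹ • ∑ x ∈ s, x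

/-- The unit normal to the facet `e` of `K` that points out of `K`. -/
def outwardNormal {d : ℕ} (K e : Finset (Pt d)) : Pt d :=
  let z : Pt d :=
    (vectorSpan ℝ (e : Set (Pt d)))ᗮ.starProjection (barycenter e - barycenter K)
  ‖z‖⁻¹ • z

/-! ### Discrete weak gradient -/

/-- The lowest-order Raviart-Thomas space `P₀ ^ d + x P₀`. -/
def RT0 (d : ℕ) : Set (Pt d → Pt d) := {q | ∃ (a : Pt d) (b : ℝ), q = fun x => a + b • x}

/-- The divergence of a vector field. -/
def divergence {d : ℕ} (q : Pt d → Pt d) (x : Pt d) : ℝ :=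
  ∑ i : Fin d, (fderiv ℝ q x (EuclideanSpace.single i 1)) i

/-- `g` is the discrete weak gradient on `K` of the scalar weak function with value `u₀` in the
interior of `K` and value `ub e` on the facet `e`. -/
def IsWeakGrad {d : ℕ} (K : Finset (Pt d)) (u₀ : ℝ) (ub : Finset (Pt d) → ℝ)
    (g : Pt d → Pt d) : Prop :=
  g ∈ RT0 d ∧ ∀ q ∈ RT0 d,
    ∫ x in hull K, ⟪g x, q x⟫ =
      (∑ e ∈ facetsOf K, ∫ x in hull e, ub e * ⟪q x, outwardNormal K e⟫ ∂(surf d))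
        - ∫ x in hull K, u₀ * divergence q x

/-- The discrete weak gradient (it exists and is unique on a nondegenerate simplex). -/
def weakGrad {d : ℕ} (K : Finset (Pt d)) (u₀ : ℝ) (ub : Finset (Pt d) → ℝ) : Pt d → Pt d :=
  Classical.epsilon (IsWeakGrad K u₀ ub)

namespace SimplicialMesh

variable {d : ℕ} {Ω : Set (Pt d)} (M : SimplicialMesh Ω)

/-- The index type of the mesh elements. -/
abbrev Elem : Type := {K : Finset (Pt d) // K ∈ M.elems}

open Classical in
/-- The facets of the mesh that are not contained in the boundary of `Ω`. -/
def interiorFacets : Finset (Finset (Pt d)) :=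
  (M.elems.biUnion facetsOf).filter fun e => ¬ hull e ⊆ frontier Ω

/-- The index type of the interior facets. -/
abbrev IntFacet : Type := {e : Finset (Pt d) // e ∈ M.interiorFacets}

/-- The velocity degrees of freedom: `d` components for each element and for each interior facet.
A vector `M.Dof → ℝ` is a discrete weak velocity that vanishes on the boundary. -/
abbrev Dof : Type := (M.Elem ⊕ M.IntFacet) × Fin d

instance : DecidableEq M.Elem := Classical.decEq _

instance : DecidableEq M.IntFacet := Classical.decEq _

/-- The number of elements. -/
def numElem : ℕ := Fintype.card M.Elem

open Classical in
/-- The `i`-th component of the value of the velocity `u` on the facet `e` (zero on the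
boundary). -/
def facetVal (u : M.Dof → ℝ) (i : Fin d) (e : Finset (Pt d)) : ℝ :=
  if h : e ∈ M.interiorFacets then u (Sum.inr ⟨e, h⟩, i) else 0

/-- The discrete weak gradient on `K` of the `i`-th component of the velocity `u`. -/
def velGrad (u : M.Dof → ℝ) (K : M.Elem) (i : Fin d) : Pt d → Pt d :=
  weakGrad K.1 (u (Sum.inl K, i)) (M.facetVal u i)

/-- The (constant) discrete weak divergence of the velocity `u` on `K`, obtained by testing with
constants. -/
def weakDiv (u : M.Dof → ℝ) (K : M.Elem) : ℝ :=
  (vol K.1)⁻¹ * ∑ e ∈ facetsOf K.1,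
    ∫ _x in hull e, ⟪WithLp.toLp 2 (fun i => M.facetVal u i e), outwardNormal K.1 e⟫ ∂(surf d)

/-- The bilinear form `∑ K, (∇_w u, ∇_w v)_K`. -/
def gradForm (u v : M.Dof → ℝ) : ℝ :=
  ∑ K : M.Elem, ∑ i : Fin d, ∫ x in hull K.1, ⟪M.velGrad u K i x, M.velGrad v K i x⟫

/-- The bilinear form `∑ K, (∇_w · u, q)_K`. -/
def divForm (u : M.Dof → ℝ) (q : M.Elem → ℝ) : ℝ :=
  ∑ K : M.Elem, ∫ _x in hull K.1, M.weakDiv u K * q K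

/-- The stiffness matrix `A`: `vᵀ A u = gradForm u v`. -/
def stiff : Matrix M.Dof M.Dof ℝ :=
  Matrix.of fun p q => M.gradForm (Pi.single q 1) (Pi.single p 1)

/-- The divergence matrix `B`: `qᵀ B u = divForm u q`. -/
def divMat : Matrix M.Elem M.Dof ℝ :=
  Matrix.of fun K p => M.divForm (Pi.single p 1) (Pi.single K 1)

/-- The pressure mass matrix `diag(|K₁|, …, |K_N|)`. -/
def mass : Matrix M.Elem M.Elem ℝ := Matrix.diagonal fun K => vol K.1

/-- The unit vector `N^{-1/2} (1, …, 1)`. -/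
def oneVec : M.Elem → ℝ := fun _ => 1 / Real.sqrt M.numElem

/-- The number `γ = wᵀ 1`. -/
def gam (w : M.Elem → ℝ) : ℝ := w ⬝ᵥ M.oneVec

/-- The matrix of the regularized (rescaled) saddle point system. -/
def sys (w : M.Elem → ℝ) (ρ : ℝ) : Matrix (M.Dof ⊕ M.Elem) (M.Dof ⊕ M.Elem) ℝ :=
  Matrix.fromBlocks M.stiff (-M.divMatᵀ) (-M.divMat) (-(ρ • Matrix.vecMulVec w w))

/-- The block lower triangular preconditioner with approximate Schur complement `M_p`. -/
def precond : Matrix (M.Dof ⊕ M.Elem) (M.Dof ⊕ M.Elem) ℝ :=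
  Matrix.fromBlocks M.stiff 0 (-M.divMat) (-M.mass)

/-- The preconditioned matrix `P_t⁻¹ 𝒜`. -/
def precSys (w : M.Elem → ℝ) (ρ : ℝ) : Matrix (M.Dof ⊕ M.Elem) (M.Dof ⊕ M.Elem) ℝ :=
  M.precond⁻¹ * M.sys w ρ

/-- `β` is an inf-sup constant of the discretization: for every discrete pressure `p` of mean
zero, `sup_v (vᵀ Bᵀ p) / (vᵀ A v)^{1/2} ≥ β ‖p‖_{L²}`. -/
def IsInfSupConst (β : ℝ) : Prop :=
  ∀ p : M.Elem → ℝ, (∑ K : M.Elem, vol K.1 * p K) = 0 →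
    β * Real.sqrt (p ⬝ᵥ (M.mass *ᵥ p)) ≤
      ⨆ v : {v : M.Dof → ℝ // v ⬝ᵥ (M.stiff *ᵥ v) ≠ 0},
        (v.1 ⬝ᵥ (M.divMatᵀ *ᵥ p)) / Real.sqrt (v.1 ⬝ᵥ (M.stiff *ᵥ v.1))

/-- `γ² N / |Ω|`. -/
def outlierSlope (w : M.Elem → ℝ) : ℝ := M.gam w ^ 2 * M.numElem / (volume Ω).toReal

/-- `ρ / λ_min(M_p)`. -/
def relRho (ρ : ℝ) : ℝ := ρ / lamMin M.mass

/-- The convergence factor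
`(√(d + ρ/λ_min) - √(β² - ρ/λ_min)) / (√(d + ρ/λ_min) + √(β² - ρ/λ_min))`. -/
def convFactor (β ρ : ℝ) : ℝ :=
  (Real.sqrt (d + M.relRho ρ) - Real.sqrt (β ^ 2 - M.relRho ρ)) /
    (Real.sqrt (d + M.relRho ρ) + Real.sqrt (β ^ 2 - M.relRho ρ))

/-- `(d λ_max(M_p) / λ_min(A))^{1/2}`. -/
def couplingConst : ℝ := Real.sqrt (d * lamMax M.mass / lamMin M.stiff)

/-- `(λ_max(M_p) / λ_min(M_p))^{1/2}`. -/
def massRatio : ℝ := Real.sqrt (lamMax M.mass / lamMin M.mass)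

/-- The Euclidean norm of the residual at `x` of the preconditioned system with right-hand side
`P_t⁻¹ b`. -/
def resNorm (w : M.Elem → ℝ) (ρ : ℝ) (b x : M.Dof ⊕ M.Elem → ℝ) : ℝ :=
  euclNorm (M.precond⁻¹ *ᵥ b - M.precSys w ρ *ᵥ x)

/-- `x` is a `k`-th GMRES iterate for the preconditioned system `P_t⁻¹ 𝒜 x = P_t⁻¹ b`. -/
def IsIterate (w : M.Elem → ℝ) (ρ : ℝ) (b x₀ : M.Dof ⊕ M.Elem → ℝ) (k : ℕ)
    (x : M.Dof ⊕ M.Elem → ℝ) : Prop :=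
  IsGMRESIterate (M.precSys w ρ) (M.precond⁻¹ *ᵥ b) x₀ k x

end SimplicialMesh

end StokesWG

end

noncomputable section

set_option linter.unusedSectionVars false

namespace StokesWG

/-! ### GMRES residual polynomials, symmetric spectra and Chebyshev bounds -/

section LinearAlgebra

open Polynomial

variable {n m : Type*} [Fintype n] [Fintype m]

/-! The preconditioned matrix `T` is block upper triangular, with an identity velocity block and
pressure block `M_p⁻¹ (S + ρ w wᵀ)`, where `S = B A⁻¹ Bᵀ`. Since `1 - T` does not see the velocity
component, a residual polynomial `(1 - X) p` reduces GMRES to the pressure block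
(`aeval_precBlock_mulVec`). That block is similar, through `M_p^{1/2}`, to the symmetric matrix
`scaledSchur`, so `p` only has to be small on real eigenvalues.

These eigenvalues are at most `d + t`. The inf-sup condition on mean-zero pressures leaves at most
one of them below `β²`, and that outlier is at least `l = c ρ β² / (β² + t)`
(`outlierBound_mul_le`). One linear factor of `p` annihilates the outlier at the price `(d + t + l)
/ l`, and a Chebyshev polynomial handles the rest. With the factor `1 - X` this spends two degrees,
whence the exponent `k - 2`. The identity `c ρ - l = c ρ² / (β² λ_min(M_p) + ρ)` is the explicit
remainder, and taking logarithms gives the iteration count.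

The version with `1 + θ + d` in place of `θ + d √κ` rests on the freedom in the remainders. GMRES
terminates after `N + 1` steps, and for `k ≤ N` the factor `1 / (c ρ)` makes the right-hand side
exceed the initial residual once `ρ ≤ ρ₀`. For `ρ > ρ₀` a bounded quantity is `O(ρ²)`, so the
remainder in the numerator absorbs the change of constant.

What remains is to verify the abstract hypotheses `IsSaddle` for the discretization. Constants lie
in the kernel of `Bᵀ` because outward normals cancel across interior facets. The bound `S ≤ d M_p`
is Cauchy-Schwarz for the trace of the weak gradient. Definiteness of `A` holds because a vanishing
weak gradient ties the value on an element to the values on its facets, and every set of elements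
closed under taking neighbours reaches the boundary. -/

theorem euclNorm_sq (v : n → ℝ) : euclNorm v ^ 2 = v ⬝ᵥ v := by
  rw [euclNorm, EuclideanSpace.real_norm_sq_eq]
  simp [dotProduct, sq]

theorem euclNorm_nonneg (v : n → ℝ) : 0 ≤ euclNorm v := norm_nonneg _

theorem euclNorm_le_of_sq {v : n → ℝ} {c : ℝ} (hc : 0 ≤ c) (h : v ⬝ᵥ v ≤ c ^ 2) :
    euclNorm v ≤ c := by
  rw [← euclNorm_sq] at h
  exact abs_le_of_sq_le_sq' h hc |>.2

theorem euclNorm_sumElim_le (x : n → ℝ) (y : m → ℝ) :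
    euclNorm (Sum.elim x y) ≤ euclNorm x + euclNorm y := by
  refine euclNorm_le_of_sq (add_nonneg (euclNorm_nonneg _) (euclNorm_nonneg _)) ?_
  have h1 := euclNorm_sq x
  have h2 := euclNorm_sq y
  have h3 := mul_nonneg (euclNorm_nonneg x) (euclNorm_nonneg y)
  rw [sumElim_dotProduct_sumElim]
  nlinarith

theorem euclNorm_comp_inr_le (x : n ⊕ m → ℝ) : euclNorm (x ∘ Sum.inr) ≤ euclNorm x := by
  refine euclNorm_le_of_sq (euclNorm_nonneg _) ?_
  rw [euclNorm_sq]
  simp only [dotProduct, Fintype.sum_sum_type, Function.comp_apply]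
  exact le_add_of_nonneg_left (Finset.sum_nonneg fun i _ => mul_self_nonneg _)


variable [DecidableEq n] [DecidableEq m]

/-- The GMRES residual is at most the norm of `p(T) r₀` for each admissible residual
polynomial `p`. -/
theorem IsGMRESIterate.euclNorm_le {T : Matrix n n ℝ} {c x₀ x : n → ℝ} {k : ℕ}
    (h : IsGMRESIterate T c x₀ k x) {p : ℝ[X]} (hp : p.natDegree ≤ k) (hp0 : p.eval 0 = 1) :
    euclNorm (c - T *ᵥ x) ≤ euclNorm (aeval T p *ᵥ (c - T *ᵥ x₀)) := by
  set r := c - T *ᵥ x₀ with hr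
  -- Since `p = 1 + X * p.divX`, the point `x₀ - p.divX(T) r` has residual `p(T) r`. The case `k =
  -- 0` is separate because `p.divX = 0` still has `natDegree` zero, which is not below `k`.
  have hmem : aeval T p.divX *ᵥ r ∈ krylov T r k := by
    rcases Nat.eq_zero_or_pos k with rfl | hk
    · have h0 : p.divX = 0 := by
        rw [divX_eq_zero_iff]
        exact eq_C_of_natDegree_le_zero hp
      simp [h0]
    · have hd : p.divX.natDegree < k := by
        rw [natDegree_divX_eq_natDegree_tsub_one]; omega
      rw [aeval_eq_sum_range' hd, sum_mulVec]
      refine Submodule.sum_mem _ fun i hi => ?_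
      rw [smul_mulVec]
      refine Submodule.smul_mem _ _ (Submodule.subset_span ⟨⟨i, Finset.mem_range.1 hi⟩, rfl⟩)
  have hc := h.minimal (x₀ - aeval T p.divX *ᵥ r) (by
    rw [sub_sub_cancel_left]; exact Submodule.neg_mem _ hmem)
  have hpe : aeval T p = T * aeval T p.divX + 1 := by
    conv_lhs => rw [← divX_mul_X_add p]
    rw [mul_comm, map_add, map_mul, aeval_X, aeval_C, coeff_zero_eq_eval_zero, hp0, map_one]
  convert hc using 2
  rw [hpe, add_mulVec, one_mulVec, ← mulVec_mulVec, mulVec_sub T x₀, ← sub_add, ← hr, add_comm]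

theorem IsGMRESIterate.euclNorm_le_initial {T : Matrix n n ℝ} {c x₀ x : n → ℝ} {k : ℕ}
    (h : IsGMRESIterate T c x₀ k x) : euclNorm (c - T *ᵥ x) ≤ euclNorm (c - T *ᵥ x₀) := by
  simpa using h.euclNorm_le (p := 1) (by simp) (by simp)

/-- Polynomials preserve intertwining relations. -/
theorem mul_aeval_of_mul_eq {C : Matrix m n ℝ} {T : Matrix n n ℝ} {S : Matrix m m ℝ}
    (h : C * T = S * C) (p : ℝ[X]) : C * aeval T p = aeval S p * C := by
  induction p using Polynomial.induction_on' with
  | add p q hp hq => simp [Matrix.mul_add, Matrix.add_mul, hp, hq]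
  | monomial k a =>
    have hk : C * T ^ k = S ^ k * C := by
      induction k with
      | zero => simp
      | succ k ih => rw [pow_succ, ← Matrix.mul_assoc, ih, Matrix.mul_assoc, h, pow_succ,
          Matrix.mul_assoc]
    simp [aeval_monomial, ← Algebra.smul_def, hk]

/-! ### Spectral calculus of real symmetric matrices -/

section Symmetric

variable {H : Matrix n n ℝ} (hH : H.IsHermitian)

/-- The coordinates of a vector in an orthonormal eigenbasis. -/
def eigCoord (i : n) (x : n → ℝ) : ℝ := (hH.eigenvectorBasis i).ofLp ⬝ᵥ x

theorem dotProduct_eq_sum_eigCoord (x y : n → ℝ) :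
    x ⬝ᵥ y = ∑ i, eigCoord hH i x * eigCoord hH i y := by
  have h := hH.eigenvectorBasis.sum_inner_mul_inner (WithLp.toLp 2 x) (WithLp.toLp 2 y)
  simp only [EuclideanSpace.inner_eq_star_dotProduct, star_trivial] at h
  rw [dotProduct_comm, ← h]
  refine Finset.sum_congr rfl fun i _ => ?_
  simp only [eigCoord]
  rw [dotProduct_comm y]

theorem eigCoord_mulVec (i : n) (x : n → ℝ) :
    eigCoord hH i (H *ᵥ x) = hH.eigenvalues i * eigCoord hH i x := by
  have hs : Hᵀ = H := by simpa using hH.eq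
  rw [eigCoord, dotProduct_mulVec, ← mulVec_transpose, hs, hH.mulVec_eigenvectorBasis,
    smul_dotProduct, smul_eq_mul, eigCoord]

theorem eigCoord_add (i : n) (x y : n → ℝ) :
    eigCoord hH i (x + y) = eigCoord hH i x + eigCoord hH i y := dotProduct_add _ _ _

theorem eigCoord_smul (i : n) (a : ℝ) (x : n → ℝ) :
    eigCoord hH i (a • x) = a * eigCoord hH i x := by simp [eigCoord]

theorem eigCoord_aeval_mulVec (p : ℝ[X]) (i : n) (x : n → ℝ) :
    eigCoord hH i (aeval H p *ᵥ x) = p.eval (hH.eigenvalues i) * eigCoord hH i x := by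
  induction p using Polynomial.induction_on' with
  | add p q hp hq => rw [map_add, add_mulVec, eigCoord_add, hp, hq, eval_add, add_mul]
  | monomial k a =>
    have hk : eigCoord hH i (H ^ k *ᵥ x) = hH.eigenvalues i ^ k * eigCoord hH i x := by
      induction k with
      | zero => simp
      | succ k ih => rw [pow_succ', ← mulVec_mulVec, eigCoord_mulVec, ih]; ring
    rw [aeval_monomial, ← Algebra.smul_def, smul_mulVec, eigCoord_smul, hk, eval_monomial]
    ring

theorem euclNorm_aeval_mulVec_le {p : ℝ[X]} {c : ℝ} (hc : 0 ≤ c)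
    (hp : ∀ i, |p.eval (hH.eigenvalues i)| ≤ c) (x : n → ℝ) :
    euclNorm (aeval H p *ᵥ x) ≤ c * euclNorm x := by
  refine euclNorm_le_of_sq (mul_nonneg hc (euclNorm_nonneg _)) ?_
  rw [mul_pow, euclNorm_sq, dotProduct_eq_sum_eigCoord hH, dotProduct_eq_sum_eigCoord hH x,
    Finset.mul_sum]
  refine Finset.sum_le_sum fun i _ => ?_
  rw [eigCoord_aeval_mulVec]
  have h1 : p.eval (hH.eigenvalues i) ^ 2 ≤ c ^ 2 := by
    rw [← sq_abs]; exact pow_le_pow_left₀ (abs_nonneg _) (hp i) 2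
  calc _ = p.eval (hH.eigenvalues i) ^ 2 * (eigCoord hH i x * eigCoord hH i x) := by ring
    _ ≤ _ := mul_le_mul_of_nonneg_right h1 (mul_self_nonneg _)

theorem dotProduct_mulVec_eq_sum (x : n → ℝ) :
    x ⬝ᵥ (H *ᵥ x) = ∑ i, hH.eigenvalues i * eigCoord hH i x ^ 2 := by
  rw [dotProduct_eq_sum_eigCoord hH]
  refine Finset.sum_congr rfl fun i _ => ?_
  rw [eigCoord_mulVec]; ring

theorem eigenvector_dotProduct (i j : n) :
    (hH.eigenvectorBasis i).ofLp ⬝ᵥ (hH.eigenvectorBasis j).ofLp = if i = j then 1 else 0 := by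
  have h := orthonormal_iff_ite.1 hH.eigenvectorBasis.orthonormal j i
  simp only [EuclideanSpace.inner_eq_star_dotProduct, star_trivial] at h
  rw [h]
  simp [eq_comm]

theorem eigenvalue_eq_dotProduct (i : n) :
    hH.eigenvalues i = (hH.eigenvectorBasis i).ofLp ⬝ᵥ (H *ᵥ (hH.eigenvectorBasis i).ofLp) := by
  rw [hH.mulVec_eigenvectorBasis, dotProduct_smul, eigenvector_dotProduct]
  simp

theorem lamMin_mul_le (hH : H.IsHermitian) (x : n → ℝ) : lamMin H * (x ⬝ᵥ x) ≤ x ⬝ᵥ (H *ᵥ x) := by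
  rw [dotProduct_mulVec_eq_sum hH, dotProduct_eq_sum_eigCoord hH, Finset.mul_sum]
  refine Finset.sum_le_sum fun i _ => ?_
  rw [← sq]
  refine mul_le_mul_of_nonneg_right (csInf_le ?_ (hH.eigenvalues_mem_spectrum_real i)) (sq_nonneg _)
  rw [hH.spectrum_real_eq_range_eigenvalues]
  exact (Set.finite_range _).bddBelow

theorem le_lamMax_mul (hH : H.IsHermitian) (x : n → ℝ) : x ⬝ᵥ (H *ᵥ x) ≤ lamMax H * (x ⬝ᵥ x) := by
  rw [dotProduct_mulVec_eq_sum hH, dotProduct_eq_sum_eigCoord hH, Finset.mul_sum]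
  refine Finset.sum_le_sum fun i _ => ?_
  rw [← sq]
  refine mul_le_mul_of_nonneg_right (le_csSup ?_ (hH.eigenvalues_mem_spectrum_real i)) (sq_nonneg _)
  rw [hH.spectrum_real_eq_range_eigenvalues]
  exact (Set.finite_range _).bddAbove

theorem lamMin_pos (hH : H.IsHermitian) [Nonempty n] (hpos : ∀ x, x ≠ 0 → 0 < x ⬝ᵥ (H *ᵥ x)) : 0 < lamMin H := by
  have hne : (spectrum ℝ H).Nonempty :=
    ⟨_, hH.eigenvalues_mem_spectrum_real (Classical.arbitrary n)⟩
  have hfin : (spectrum ℝ H).Finite := by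
    rw [hH.spectrum_real_eq_range_eigenvalues]; exact Set.finite_range _
  have hmem := hne.csInf_mem hfin
  rw [hH.spectrum_real_eq_range_eigenvalues] at hmem
  obtain ⟨i, hi⟩ := hmem
  rw [lamMin, hH.spectrum_real_eq_range_eigenvalues, ← hi, eigenvalue_eq_dotProduct]
  refine hpos _ fun h0 => ?_
  have := eigenvector_dotProduct hH i i
  rw [h0] at this
  simp at this

/-- If the quadratic form of `H` is at least `c` on a hyperplane, then at most one eigenvalue
lies below `c`. -/
theorem exists_forall_ne_le_eigenvalues [Nonempty n] {c : ℝ} {u : n → ℝ}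
    (hu : ∀ x, u ⬝ᵥ x = 0 → c * (x ⬝ᵥ x) ≤ x ⬝ᵥ (H *ᵥ x)) :
    ∃ i₀, ∀ i, i ≠ i₀ → c ≤ hH.eigenvalues i := by
  by_contra! hcon
  obtain ⟨i, -, hi⟩ := hcon (Classical.arbitrary n)
  obtain ⟨j, hji, hj⟩ := hcon i
  set a := u ⬝ᵥ (hH.eigenvectorBasis i).ofLp
  set b := u ⬝ᵥ (hH.eigenvectorBasis j).ofLp
  -- The plane spanned by two eigenvectors with eigenvalues below `c` meets the hyperplane in a
  -- nonzero vector, where the quadratic form would be too small.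
  have key : ∀ s t : ℝ, s * a + t * b = 0 →
      c * (s ^ 2 + t ^ 2) ≤ s ^ 2 * hH.eigenvalues i + t ^ 2 * hH.eigenvalues j := by
    intro s t hst
    have h := hu (s • (hH.eigenvectorBasis i).ofLp + t • (hH.eigenvectorBasis j).ofLp) (by
      rw [dotProduct_add, dotProduct_smul, dotProduct_smul]; exact hst)
    simp only [mulVec_add, mulVec_smul, hH.mulVec_eigenvectorBasis, dotProduct_add,
      add_dotProduct, smul_dotProduct, dotProduct_smul, eigenvector_dotProduct, hji, hji.symm,
      if_true, if_false, smul_eq_mul] at h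
    nlinarith
  -- The generic intersection vector has coefficients `(b, -a)`, which may both vanish when `a = 0`;
  -- then the first eigenvector itself lies in the hyperplane.
  rcases eq_or_ne a 0 with ha | ha
  · have := key 1 0 (by simp [ha])
    nlinarith
  · have := key b (-a) (by ring)
    have ha2 : 0 < a ^ 2 := by positivity
    nlinarith [sq_nonneg b, mul_pos ha2 (sub_pos.2 hj), mul_nonneg (sq_nonneg b) (sub_pos.2 hi).le]

end Symmetric

/-! ### Chebyshev polynomials -/

/-- The Chebyshev polynomial `T_k`, pulled back from `[-1, 1]` to `[a, b]`, is bounded by one there;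
dividing by its value at the image `σ` of zero normalizes it. -/
theorem exists_polynomial_small_on_Icc {a b : ℝ} (ha : 0 < a) (hab : a < b) (k : ℕ) :
    ∃ p : ℝ[X], p.natDegree ≤ k ∧ p.eval 0 = 1 ∧ ∀ x, a ≤ x → x ≤ b →
      |p.eval x| ≤ 2 * ((√b - √a) / (√b + √a)) ^ k := by
  have hsa : 0 < √a := Real.sqrt_pos.2 ha
  have hsab : √a < √b := Real.sqrt_lt_sqrt ha.le hab
  set q := (√b - √a) / (√b + √a) with hq
  have hq0 : 0 < q := div_pos (by linarith) (by linarith)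
  have ha2 : √a ^ 2 = a := Real.sq_sqrt ha.le
  have hb2 : √b ^ 2 = b := Real.sq_sqrt (ha.trans hab).le
  have hba : 0 < b - a := sub_pos.2 hab
  set σ := (b + a) / (b - a) with hσ
  -- Writing `σ = cosh s` with `exp s = q⁻¹` gives `T_k(σ) = cosh (k s) ≥ q⁻ᵏ / 2`, the source of
  -- the factor `2 qᵏ`.
  have hcosh : σ = Real.cosh (Real.log q⁻¹) := by
    rw [Real.cosh_log (inv_pos.2 hq0), inv_inv, hσ, hq]
    have h1 : √b - √a ≠ 0 := by linarith
    have h2 : √b + √a ≠ 0 := by linarith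
    have h3 : b - a = (√b - √a) * (√b + √a) := by linear_combination ha2 - hb2
    rw [h3]
    field_simp
    linear_combination -2 * ha2 - 2 * hb2
  set τ := (Chebyshev.T ℝ k).eval σ with hτ
  have hτ' : (q ^ k)⁻¹ / 2 ≤ τ := by
    rw [hτ, hcosh, Chebyshev.T_real_cosh, Real.cosh_eq]
    have : Real.exp ((k : ℤ) * Real.log q⁻¹) = (q ^ k)⁻¹ := by
      push_cast
      rw [Real.exp_nat_mul, Real.exp_log (inv_pos.2 hq0), inv_pow]
    rw [this]
    have := Real.exp_pos (-((k : ℤ) * Real.log q⁻¹))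
    linarith
  have hτ0 : 0 < τ := lt_of_lt_of_le (by positivity) hτ'
  refine ⟨C τ⁻¹ * (Chebyshev.T ℝ k).comp (C σ - C (2 / (b - a)) * X), ?_, ?_, ?_⟩
  · refine (natDegree_C_mul_le _ _).trans (natDegree_comp_le.trans ?_)
    rw [Chebyshev.natDegree_T, Int.natAbs_natCast]
    have : (C σ - C (2 / (b - a)) * X : ℝ[X]).natDegree ≤ 1 := by compute_degree
    nlinarith
  · simp only [eval_mul, eval_C, eval_comp, eval_sub, eval_X, mul_zero, sub_zero]
    rw [← hτ, inv_mul_cancel₀ hτ0.ne']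
  · intro x hax hxb
    simp only [eval_mul, eval_C, eval_comp, eval_sub, eval_X]
    have h1 : |(Chebyshev.T ℝ k).eval (σ - 2 / (b - a) * x)| ≤ 1 := by
      have hx : σ - 2 / (b - a) * x = (b + a - 2 * x) / (b - a) := by rw [hσ]; ring
      have hl : -1 ≤ σ - 2 / (b - a) * x := by rw [hx, le_div_iff₀ hba]; linarith
      have hr : σ - 2 / (b - a) * x ≤ 1 := by rw [hx, div_le_iff₀ hba]; linarith
      rw [← Real.cos_arccos hl hr, Chebyshev.T_real_cos]
      exact Real.abs_cos_le_one _
    rw [abs_mul, abs_of_pos (inv_pos.2 hτ0)]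
    calc τ⁻¹ * _ ≤ τ⁻¹ * 1 := by gcongr
      _ ≤ ((q ^ k)⁻¹ / 2)⁻¹ * 1 := by gcongr
      _ = 2 * q ^ k := by field_simp

end LinearAlgebra

/-! ### Block elimination and the Schur complement -/

section SaddlePoint

open Polynomial

variable {n m : Type*} [Fintype n] [DecidableEq n] [Fintype m] [DecidableEq m]

/-- The Schur complement `B A⁻¹ Bᵀ`. -/
def schur (A : Matrix n n ℝ) (B : Matrix m n ℝ) : Matrix m m ℝ := B * A⁻¹ * Bᵀ

/-- The regularized Schur complement `B A⁻¹ Bᵀ + ρ w wᵀ`. -/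
def regSchur (A : Matrix n n ℝ) (B : Matrix m n ℝ) (w : m → ℝ) (ρ : ℝ) : Matrix m m ℝ :=
  schur A B + ρ • vecMulVec w w

/-- The symmetrically scaled regularized Schur complement. -/
def scaledSchur (A : Matrix n n ℝ) (B : Matrix m n ℝ) (μ : m → ℝ) (w : m → ℝ) (ρ : ℝ) :
    Matrix m m ℝ :=
  diagonal (fun K => (√(μ K))⁻¹) * regSchur A B w ρ * diagonal (fun K => (√(μ K))⁻¹)

/-- The block upper triangular form of the preconditioned matrix. -/
def precBlock (A : Matrix n n ℝ) (B : Matrix m n ℝ) (μ : m → ℝ) (w : m → ℝ) (ρ : ℝ) :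
    Matrix (n ⊕ m) (n ⊕ m) ℝ :=
  fromBlocks 1 (-(A⁻¹ * Bᵀ)) 0 ((diagonal μ)⁻¹ * regSchur A B w ρ)

theorem inv_mul_eq_precBlock {A : Matrix n n ℝ} (hA : IsUnit A.det) (B : Matrix m n ℝ)
    {μ : m → ℝ} (hμ : ∀ K, 0 < μ K) (w : m → ℝ) (ρ : ℝ) :
    (fromBlocks A 0 (-B) (-diagonal μ))⁻¹ *
      fromBlocks A (-Bᵀ) (-B) (-(ρ • vecMulVec w w)) = precBlock A B μ w ρ := by
  have hD : IsUnit (diagonal μ).det := by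
    rw [det_diagonal]
    exact (Finset.prod_pos fun K _ => hμ K).ne'.isUnit
  have hP : IsUnit (fromBlocks A 0 (-B) (-diagonal μ)).det := by
    rw [det_fromBlocks_zero₁₂, det_neg]
    exact hA.mul ((IsUnit.pow _ (by simp)).mul hD)
  have hmul : fromBlocks A (-Bᵀ) (-B) (-(ρ • vecMulVec w w)) =
      fromBlocks A 0 (-B) (-diagonal μ) * precBlock A B μ w ρ := by
    rw [precBlock, fromBlocks_multiply]
    congr 1
    · simp
    · simp [← Matrix.mul_assoc, mul_nonsing_inv A hA]
    · simp
    · rw [Matrix.neg_mul, Matrix.neg_mul, Matrix.mul_neg, ← Matrix.mul_assoc (diagonal μ),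
        mul_nonsing_inv _ hD, Matrix.one_mul, regSchur, schur, ← Matrix.mul_assoc]
      abel
  rw [hmul, ← Matrix.mul_assoc, nonsing_inv_mul _ hP, Matrix.one_mul]

/-- By block triangularity the projection onto the pressure component intertwines the full matrix
with its pressure block, and so it intertwines their polynomials. -/
theorem precBlock_mulVec_inr (A : Matrix n n ℝ) (B : Matrix m n ℝ) (μ w : m → ℝ) (ρ : ℝ)
    (p : ℝ[X]) (r : n ⊕ m → ℝ) :
    (aeval (precBlock A B μ w ρ) p *ᵥ r) ∘ Sum.inr =
      aeval ((diagonal μ)⁻¹ * regSchur A B w ρ) p *ᵥ (r ∘ Sum.inr) := by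
  have hC : ∀ x : n ⊕ m → ℝ, fromCols (0 : Matrix m n ℝ) (1 : Matrix m m ℝ) *ᵥ x = x ∘ Sum.inr := by
    intro x
    rw [fromCols_mulVec]
    simp
  have h : fromCols (0 : Matrix m n ℝ) (1 : Matrix m m ℝ) * precBlock A B μ w ρ =
      ((diagonal μ)⁻¹ * regSchur A B w ρ) *
        fromCols (0 : Matrix m n ℝ) (1 : Matrix m m ℝ) := by
    rw [precBlock, fromCols_mul_fromBlocks, mul_fromCols]
    simp
  rw [← hC, ← hC, mulVec_mulVec, mulVec_mulVec, mul_aeval_of_mul_eq h]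

/-- The first block column of `1 - T` is zero, so the factor `1 - X` removes all dependence on the
velocity part of `p(T) r`. This is where one iteration is spent. -/
theorem aeval_precBlock_mulVec (A : Matrix n n ℝ) (B : Matrix m n ℝ) (μ w : m → ℝ) (ρ : ℝ)
    (p : ℝ[X]) (r : n ⊕ m → ℝ) {g : m → ℝ}
    (hg : g = aeval ((diagonal μ)⁻¹ * regSchur A B w ρ) p *ᵥ (r ∘ Sum.inr)) :
    aeval (precBlock A B μ w ρ) ((1 - X) * p) *ᵥ r =
      Sum.elim (A⁻¹ *ᵥ (Bᵀ *ᵥ g)) (g - ((diagonal μ)⁻¹ * regSchur A B w ρ) *ᵥ g) := by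
  have h1 : aeval (precBlock A B μ w ρ) ((1 - X) * p) *ᵥ r =
      (aeval (precBlock A B μ w ρ) p *ᵥ r) -
        precBlock A B μ w ρ *ᵥ (aeval (precBlock A B μ w ρ) p *ᵥ r) := by
    rw [map_mul, map_sub, map_one, aeval_X, ← mulVec_mulVec, sub_mulVec, one_mulVec]
  rw [h1, ← precBlock_mulVec_inr] at *
  rw [hg]
  set y := aeval (precBlock A B μ w ρ) p *ᵥ r
  have hy : y = Sum.elim (y ∘ Sum.inl) (y ∘ Sum.inr) := (Sum.elim_comp_inl_inr y).symm
  rw [precBlock, fromBlocks_mulVec]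
  ext i
  rcases i with i | i
  · simp [neg_mulVec]
  · simp

/-- The hypotheses on the blocks of a regularized saddle point system: `A` is positive definite,
the constants span a subspace of the kernel of `Bᵀ`, and `B A⁻¹ Bᵀ` is spectrally equivalent to the
mass matrix off the constants. -/
structure IsSaddle (A : Matrix n n ℝ) (B : Matrix m n ℝ) (μ w : m → ℝ) (d β : ℝ) : Prop where
  isHermitian : A.IsHermitian
  pos : ∀ x, x ≠ 0 → 0 < x ⬝ᵥ (A *ᵥ x)
  mass_pos : ∀ K, 0 < μ K
  transpose_mulVec_one : Bᵀ *ᵥ (fun _ => 1) = 0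
  le_bound : ∀ p, p ⬝ᵥ (schur A B *ᵥ p) ≤ d * (p ⬝ᵥ (diagonal μ *ᵥ p))
  bound_le : ∀ p, ∑ K, μ K * p K = 0 →
    β ^ 2 * (p ⬝ᵥ (diagonal μ *ᵥ p)) ≤ p ⬝ᵥ (schur A B *ᵥ p)
  norm_eq : w ⬝ᵥ w = 1

theorem isUnit_det_of_pos {A : Matrix n n ℝ} (hpos : ∀ x, x ≠ 0 → 0 < x ⬝ᵥ (A *ᵥ x)) :
    IsUnit A.det := by
  rw [isUnit_iff_ne_zero]
  intro h0
  obtain ⟨v, hv, hv0⟩ := exists_mulVec_eq_zero_iff.2 h0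
  have := hpos v hv
  simp [hv0] at this

theorem dotProduct_vecMulVec_mulVec (w p : m → ℝ) :
    p ⬝ᵥ (vecMulVec w w *ᵥ p) = (w ⬝ᵥ p) ^ 2 := by
  rw [vecMulVec_mulVec]
  simp [dotProduct_comm p w, sq]

theorem dotProduct_regSchur_mulVec (A : Matrix n n ℝ) (B : Matrix m n ℝ) (w : m → ℝ) (ρ : ℝ)
    (p : m → ℝ) : p ⬝ᵥ (regSchur A B w ρ *ᵥ p) =
      p ⬝ᵥ (schur A B *ᵥ p) + ρ * (w ⬝ᵥ p) ^ 2 := by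
  rw [regSchur, add_mulVec, dotProduct_add, smul_mulVec, dotProduct_smul,
    dotProduct_vecMulVec_mulVec, smul_eq_mul]

theorem dotProduct_diagonal_mulVec (μ p : m → ℝ) :
    p ⬝ᵥ (diagonal μ *ᵥ p) = ∑ K, μ K * p K ^ 2 := by
  simp only [dotProduct, mulVec_diagonal]
  exact Finset.sum_congr rfl fun K _ => by ring

theorem mulVec_inv_mulVec {A : Matrix n n ℝ} (hA : IsUnit A.det) (x : n → ℝ) :
    A *ᵥ (A⁻¹ *ᵥ x) = x := by
  rw [mulVec_mulVec, mul_nonsing_inv A hA, one_mulVec]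

section Schur

variable {A : Matrix n n ℝ} {B : Matrix m n ℝ}

theorem dotProduct_schur_mulVec (hA : IsUnit A.det) (p : m → ℝ) :
    p ⬝ᵥ (schur A B *ᵥ p) =
      (A⁻¹ *ᵥ (Bᵀ *ᵥ p)) ⬝ᵥ (A *ᵥ (A⁻¹ *ᵥ (Bᵀ *ᵥ p))) := by
  rw [mulVec_inv_mulVec hA, schur, ← mulVec_mulVec,
    ← mulVec_mulVec, dotProduct_mulVec, ← mulVec_transpose, dotProduct_comm]

/-- For `v = A⁻¹ Bᵀ p` both `pᵀ B v` and `vᵀ A v` equal `s = pᵀ S p`, so the hypothesis reads `s² ≤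
d s (pᵀ M p)`. -/
theorem schur_le_of_le {μ : m → ℝ} {d : ℝ}
    (hpos : ∀ x, x ≠ 0 → 0 < x ⬝ᵥ (A *ᵥ x)) (p : m → ℝ)
    (h : ∀ v, (p ⬝ᵥ (B *ᵥ v)) ^ 2 ≤ d * (v ⬝ᵥ (A *ᵥ v)) * (p ⬝ᵥ (diagonal μ *ᵥ p)))
    (h0 : 0 ≤ d * (p ⬝ᵥ (diagonal μ *ᵥ p))) :
    p ⬝ᵥ (schur A B *ᵥ p) ≤ d * (p ⬝ᵥ (diagonal μ *ᵥ p)) := by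
  have hA := isUnit_det_of_pos hpos
  have h1 := h (A⁻¹ *ᵥ (Bᵀ *ᵥ p))
  rw [← dotProduct_schur_mulVec hA, mulVec_mulVec, mulVec_mulVec, ← schur] at h1
  by_contra! hlt
  have : 0 < p ⬝ᵥ (schur A B *ᵥ p) := h0.trans_lt hlt
  nlinarith

theorem dotProduct_mulVec_sq_le {A : Matrix n n ℝ} (hsymm : A.IsHermitian)
    (hnn : ∀ x, 0 ≤ x ⬝ᵥ (A *ᵥ x)) (x y : n → ℝ) :
    (x ⬝ᵥ (A *ᵥ y)) ^ 2 ≤ (x ⬝ᵥ (A *ᵥ x)) * (y ⬝ᵥ (A *ᵥ y)) := by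
  have hs : y ⬝ᵥ (A *ᵥ x) = x ⬝ᵥ (A *ᵥ y) := by
    have hs : Aᵀ = A := by simpa using hsymm.eq
    rw [dotProduct_mulVec, ← mulVec_transpose, hs, dotProduct_comm]
  have key : ∀ t : ℝ, 0 ≤ (y ⬝ᵥ (A *ᵥ y)) * (t * t) + (2 * (x ⬝ᵥ (A *ᵥ y))) * t +
      (x ⬝ᵥ (A *ᵥ x)) := by
    intro t
    have := hnn (x + t • y)
    simp only [mulVec_add, mulVec_smul, dotProduct_add, add_dotProduct, smul_dotProduct,
      dotProduct_smul, hs, smul_eq_mul] at this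
    linarith
  have := discrim_le_zero key
  rw [discrim] at this
  linarith

/-- Cauchy-Schwarz in the `A`-inner product, applied to `v` and `A⁻¹ Bᵀ p`, bounds every quotient in
the supremum by `(pᵀ S p)^{1/2}`. -/
theorem le_schur_of_infSup {M : Matrix m m ℝ} {β : ℝ} (hsymm : A.IsHermitian)
    (hpos : ∀ x, x ≠ 0 → 0 < x ⬝ᵥ (A *ᵥ x)) (hβ : 0 ≤ β) (p : m → ℝ)
    (hM : 0 ≤ p ⬝ᵥ (M *ᵥ p))
    (h : β * √(p ⬝ᵥ (M *ᵥ p)) ≤ ⨆ v : {v : n → ℝ // v ⬝ᵥ (A *ᵥ v) ≠ 0},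
      (v.1 ⬝ᵥ (Bᵀ *ᵥ p)) / √(v.1 ⬝ᵥ (A *ᵥ v.1))) :
    β ^ 2 * (p ⬝ᵥ (M *ᵥ p)) ≤ p ⬝ᵥ (schur A B *ᵥ p) := by
  have hA := isUnit_det_of_pos hpos
  have hnn : ∀ x, 0 ≤ x ⬝ᵥ (A *ᵥ x) := fun x => by
    rcases eq_or_ne x 0 with rfl | hx
    · simp
    · exact (hpos x hx).le
  have hS : 0 ≤ p ⬝ᵥ (schur A B *ᵥ p) := by
    rw [dotProduct_schur_mulVec hA]; exact hnn _
  have h2 : β * √(p ⬝ᵥ (M *ᵥ p)) ≤ √(p ⬝ᵥ (schur A B *ᵥ p)) := by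
    -- Nonnegativity of the bound covers an empty index set, over which the real supremum is zero by
    -- convention.
    refine h.trans (Real.iSup_le (fun v => ?_) (Real.sqrt_nonneg _))
    have hv : 0 < v.1 ⬝ᵥ (A *ᵥ v.1) := (hnn _).lt_of_ne v.2.symm
    rw [div_le_iff₀ (Real.sqrt_pos.2 hv), ← Real.sqrt_mul hS]
    refine Real.le_sqrt_of_sq_le ?_
    have h3 := dotProduct_mulVec_sq_le hsymm hnn v.1 (A⁻¹ *ᵥ (Bᵀ *ᵥ p))
    rw [← dotProduct_schur_mulVec hA, mulVec_inv_mulVec hA] at h3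
    linarith
  have h4 := mul_self_le_mul_self (by positivity) h2
  rw [Real.mul_self_sqrt hS] at h4
  have h5 := Real.mul_self_sqrt hM
  calc _ = β * √(p ⬝ᵥ (M *ᵥ p)) * (β * √(p ⬝ᵥ (M *ᵥ p))) := by linear_combination (-β ^ 2) * h5
    _ ≤ _ := h4

theorem schur_isHermitian (hsymm : A.IsHermitian) : (schur A B).IsHermitian := by
  have hs : Aᵀ = A := by simpa using hsymm.eq
  rw [IsHermitian, conjTranspose_eq_transpose_of_trivial, schur, transpose_mul, transpose_mul,
    transpose_nonsing_inv, hs, transpose_transpose, Matrix.mul_assoc]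

theorem scaledSchur_isHermitian (hsymm : A.IsHermitian) (μ w : m → ℝ) (ρ : ℝ) :
    (scaledSchur A B μ w ρ).IsHermitian := by
  have hs : (schur A B)ᵀ = schur A B := by simpa using (schur_isHermitian (B := B) hsymm).eq
  rw [IsHermitian, conjTranspose_eq_transpose_of_trivial, scaledSchur, transpose_mul,
    transpose_mul, diagonal_transpose, regSchur, transpose_add, hs, transpose_smul,
    transpose_vecMulVec, Matrix.mul_assoc]

end Schur

end SaddlePoint

/-! ### Eigenvalues of the scaled Schur complement -/

section SaddleSpectrum

open Polynomial

variable {n m : Type*} [Fintype n] [DecidableEq n] [Fintype m] [DecidableEq m]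
variable {A : Matrix n n ℝ} {B : Matrix m n ℝ} {μ w : m → ℝ} {d β ρ : ℝ}

theorem lamMin_diagonal_mul_le (μ p : m → ℝ) :
    lamMin (diagonal μ) * (p ⬝ᵥ p) ≤ ∑ K, μ K * p K ^ 2 := by
  rw [← dotProduct_diagonal_mulVec]
  exact lamMin_mul_le (isHermitian_diagonal μ) p

theorem le_lamMax_diagonal_mul (μ p : m → ℝ) :
    ∑ K, μ K * p K ^ 2 ≤ lamMax (diagonal μ) * (p ⬝ᵥ p) := by
  rw [← dotProduct_diagonal_mulVec]
  exact le_lamMax_mul (isHermitian_diagonal μ) p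

theorem lamMin_diagonal_pos [Nonempty m] (hμ : ∀ K, 0 < μ K) : 0 < lamMin (diagonal μ) := by
  refine lamMin_pos (isHermitian_diagonal μ) fun x hx => ?_
  rw [dotProduct_diagonal_mulVec]
  obtain ⟨K, hK⟩ := Function.ne_iff.1 hx
  refine Finset.sum_pos' (fun K _ => mul_nonneg (hμ K).le (sq_nonneg _)) ⟨K, Finset.mem_univ _, ?_⟩
  exact mul_pos (hμ K) (by have : x K ≠ 0 := hK; positivity)

theorem lamMin_diagonal_le (μ : m → ℝ) (K : m) : lamMin (diagonal μ) ≤ μ K := by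
  have := lamMin_diagonal_mul_le μ (Pi.single K 1)
  simpa [Pi.single_apply, ite_pow] using this

theorem le_lamMax_diagonal (μ : m → ℝ) (K : m) : μ K ≤ lamMax (diagonal μ) := by
  have := le_lamMax_diagonal_mul μ (Pi.single K 1)
  simpa [Pi.single_apply, ite_pow] using this

/-- The vector `D⁻¹ x` with `D = diag(μ)^{1/2}`. -/
def unscale (μ x : m → ℝ) : m → ℝ := diagonal (fun K => (√(μ K))⁻¹) *ᵥ x

theorem unscale_apply (μ x : m → ℝ) (K : m) : unscale μ x K = (√(μ K))⁻¹ * x K := by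
  simp [unscale, mulVec_diagonal]

theorem sum_mul_unscale_sq (hμ : ∀ K, 0 < μ K) (x : m → ℝ) :
    ∑ K, μ K * unscale μ x K ^ 2 = x ⬝ᵥ x := by
  refine Finset.sum_congr rfl fun K _ => ?_
  rw [unscale_apply, mul_pow, inv_pow, Real.sq_sqrt (hμ K).le, mul_inv_cancel_left₀ (hμ K).ne', sq]

theorem dotProduct_scaledSchur_mulVec (A : Matrix n n ℝ) (B : Matrix m n ℝ) (μ w : m → ℝ) (ρ : ℝ)
    (x : m → ℝ) : x ⬝ᵥ (scaledSchur A B μ w ρ *ᵥ x) =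
      unscale μ x ⬝ᵥ (regSchur A B w ρ *ᵥ unscale μ x) := by
  rw [scaledSchur, ← mulVec_mulVec, ← mulVec_mulVec, dotProduct_mulVec, ← mulVec_transpose,
    diagonal_transpose]
  rfl

/-- The lower bound for the outlier eigenvalue of the preconditioned Schur complement. -/
def outlierBound (μ w : m → ℝ) (β ρ : ℝ) : ℝ :=
  ρ * ((∑ K, w K) ^ 2 / ∑ K, μ K) * β ^ 2 / (β ^ 2 + ρ / lamMin (diagonal μ))

namespace IsSaddle

variable (h : IsSaddle A B μ w d β)

include h

theorem dotProduct_sq_le [Nonempty m] (p : m → ℝ) :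
    (w ⬝ᵥ p) ^ 2 ≤ (∑ K, μ K * p K ^ 2) / lamMin (diagonal μ) := by
  have h1 : (w ⬝ᵥ p) ^ 2 ≤ (w ⬝ᵥ w) * (p ⬝ᵥ p) := by
    have := Finset.sum_mul_sq_le_sq_mul_sq Finset.univ w p
    simpa [dotProduct, sq] using this
  rw [le_div_iff₀ (lamMin_diagonal_pos h.mass_pos)]
  rw [h.norm_eq, one_mul] at h1
  nlinarith [lamMin_diagonal_mul_le μ p, lamMin_diagonal_pos h.mass_pos]

theorem eigenvalues_le [Nonempty m] (hρ : 0 ≤ ρ) (i : m) :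
    (scaledSchur_isHermitian (B := B) h.isHermitian μ w ρ).eigenvalues i ≤
      d + ρ / lamMin (diagonal μ) := by
  set hH := scaledSchur_isHermitian (B := B) h.isHermitian μ w ρ
  rw [eigenvalue_eq_dotProduct hH, dotProduct_scaledSchur_mulVec, dotProduct_regSchur_mulVec]
  set p := unscale μ (hH.eigenvectorBasis i).ofLp
  have h1 := h.le_bound p
  have h2 := h.dotProduct_sq_le p
  have h3 : ∑ K, μ K * p K ^ 2 = 1 := by
    rw [sum_mul_unscale_sq h.mass_pos, eigenvector_dotProduct, if_pos rfl]
  rw [dotProduct_diagonal_mulVec, h3] at h1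
  rw [h3] at h2
  calc _ ≤ d * 1 + ρ * (1 / lamMin (diagonal μ)) := by gcongr
    _ = _ := by ring

/-- The hyperplane orthogonal to `(√μ_K)` corresponds, after unscaling, to the mean-zero pressures,
where the inf-sup bound applies; a hyperplane leaves room for one smaller eigenvalue only. -/
theorem exists_eigenvalues_ge [Nonempty m] (hρ : 0 ≤ ρ) :
    ∃ i₀, ∀ i, i ≠ i₀ →
      β ^ 2 ≤ (scaledSchur_isHermitian (B := B) h.isHermitian μ w ρ).eigenvalues i := by
  refine exists_forall_ne_le_eigenvalues _ (u := fun K => √(μ K)) fun x hx => ?_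
  rw [dotProduct_scaledSchur_mulVec, dotProduct_regSchur_mulVec, ← sum_mul_unscale_sq h.mass_pos]
  have h1 := h.bound_le (unscale μ x) (by
    rw [← hx]
    refine Finset.sum_congr rfl fun K _ => ?_
    have : √(μ K) ≠ 0 := (Real.sqrt_pos.2 (h.mass_pos K)).ne'
    have h2 := Real.mul_self_sqrt (h.mass_pos K).le
    rw [unscale_apply]
    field_simp
    rw [sq, h2])
  rw [dotProduct_diagonal_mulVec] at h1
  have : 0 ≤ ρ * (w ⬝ᵥ unscale μ x) ^ 2 := by positivity
  linarith

theorem schur_mulVec_one : schur A B *ᵥ (fun _ => 1) = 0 := by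
  rw [schur, ← mulVec_mulVec, h.transpose_mulVec_one, mulVec_zero]

/-- Split `p = α 1 + y` with `y` of mean zero. The Schur complement sees only `y` and contributes at
least `β² Y`, while the rank-one term contributes `ρ (α σ + τ)²`. The danger is that `τ = w · y`
cancels `α σ`, so `τ` must be controlled by `Y`. -/
theorem outlierBound_mul_le [Nonempty m] (hβ : 0 < β) (hρ : 0 < ρ) (p : m → ℝ) :
    outlierBound μ w β ρ * ∑ K, μ K * p K ^ 2 ≤ p ⬝ᵥ (regSchur A B w ρ *ᵥ p) := by
  have hE := lamMin_diagonal_pos h.mass_pos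
  set E := lamMin (diagonal μ) with hEdef
  set V := ∑ K, μ K with hV
  have hVpos : 0 < V := Finset.sum_pos (fun K _ => h.mass_pos K) Finset.univ_nonempty
  set σ := ∑ K, w K with hσ
  set α := (∑ K, μ K * p K) / V with hα
  set y : m → ℝ := fun K => p K - α with hy
  have hpy : p = α • (fun _ => (1 : ℝ)) + y := by ext K; simp [hy]
  have hymean : ∑ K, μ K * y K = 0 := by
    simp only [hy, mul_sub, Finset.sum_sub_distrib]
    rw [← Finset.sum_mul, ← hV, hα]; field_simp; ring
  set Y := ∑ K, μ K * y K ^ 2 with hY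
  have hY0 : 0 ≤ Y := Finset.sum_nonneg fun K _ => mul_nonneg (h.mass_pos K).le (sq_nonneg _)
  have hpp : ∑ K, μ K * p K ^ 2 = α ^ 2 * V + Y := by
    have : ∀ K, μ K * p K ^ 2 = α ^ 2 * μ K + μ K * y K ^ 2 + 2 * α * (μ K * y K) := by
      intro K; simp only [hy]; ring
    rw [Finset.sum_congr rfl fun K _ => this K, Finset.sum_add_distrib, Finset.sum_add_distrib,
      ← Finset.mul_sum, ← Finset.mul_sum, hymean]
    ring
  have hsymm : (schur A B)ᵀ = schur A B := by simpa using (schur_isHermitian (B := B) h.isHermitian).eq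
  have hpS : p ⬝ᵥ (schur A B *ᵥ p) = y ⬝ᵥ (schur A B *ᵥ y) := by
    have h1 : schur A B *ᵥ p = schur A B *ᵥ y := by
      rw [hpy, mulVec_add, mulVec_smul, h.schur_mulVec_one]; simp
    rw [h1, dotProduct_mulVec, ← mulVec_transpose, hsymm, h1, dotProduct_comm]
  set τ := w ⬝ᵥ y with hτ
  have hwp : w ⬝ᵥ p = α * σ + τ := by
    rw [hpy, dotProduct_add, dotProduct_smul]
    simp only [smul_eq_mul, dotProduct, mul_one, ← hσ]
    rfl
  set c := σ ^ 2 / V with hc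
  set e := 1 / E - c with he
  -- As `y` has mean zero, a multiple of `μ` may be subtracted from `w` before applying
  -- Cauchy-Schwarz. The optimal multiple `σ / V` improves the constant `1 / E` by exactly `c = σ² /
  -- V`.
  have hτe : τ ^ 2 ≤ e * Y := by
    have h1 : τ = ∑ K, ((w K - σ / V * μ K) / √(μ K)) * (√(μ K) * y K) := by
      have : ∀ K, ((w K - σ / V * μ K) / √(μ K)) * (√(μ K) * y K) =
          w K * y K - σ / V * (μ K * y K) := by
        intro K
        have : √(μ K) ≠ 0 := (Real.sqrt_pos.2 (h.mass_pos K)).ne'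
        rw [div_mul_eq_mul_div, mul_left_comm, mul_div_cancel_left₀ _ this]
        ring
      rw [Finset.sum_congr rfl fun K _ => this K, Finset.sum_sub_distrib, ← Finset.mul_sum, hymean]
      simp [hτ, dotProduct]
    have h2 := Finset.sum_mul_sq_le_sq_mul_sq Finset.univ
      (fun K => (w K - σ / V * μ K) / √(μ K)) (fun K => √(μ K) * y K)
    rw [← h1] at h2
    have h3 : ∑ K, (√(μ K) * y K) ^ 2 = Y :=
      Finset.sum_congr rfl fun K _ => by rw [mul_pow, Real.sq_sqrt (h.mass_pos K).le]
    have h4 : ∑ K, ((w K - σ / V * μ K) / √(μ K)) ^ 2 ≤ e := by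
      have : ∀ K, ((w K - σ / V * μ K) / √(μ K)) ^ 2 ≤
          w K * w K / E - 2 * (σ / V) * w K + (σ / V) ^ 2 * μ K := by
        intro K
        rw [div_pow, Real.sq_sqrt (h.mass_pos K).le]
        have h5 : (w K - σ / V * μ K) ^ 2 / μ K =
            w K * w K / μ K - 2 * (σ / V) * w K + (σ / V) ^ 2 * μ K := by
          have := (h.mass_pos K).ne'
          field_simp
          ring
        rw [h5]
        have h6 : w K * w K / μ K ≤ w K * w K / E :=
          div_le_div_of_nonneg_left (mul_self_nonneg _) hE (lamMin_diagonal_le μ K)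
        linarith
      refine (Finset.sum_le_sum fun K _ => this K).trans (le_of_eq ?_)
      rw [Finset.sum_add_distrib, Finset.sum_sub_distrib, ← Finset.sum_div, ← Finset.mul_sum,
        ← Finset.mul_sum, ← hσ, ← hV]
      have := h.norm_eq
      rw [dotProduct] at this
      rw [this, he, hc]
      field_simp
      ring
    rw [h3] at h2
    exact h2.trans (mul_le_mul_of_nonneg_right h4 hY0)
  have hbl := h.bound_le y hymean
  rw [dotProduct_diagonal_mulVec, ← hY] at hbl
  rw [dotProduct_regSchur_mulVec, hpS, hwp, hpp]
  refine le_trans ?_ (add_le_add_left hbl _)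
  have hden : 0 < β ^ 2 + ρ / E := by positivity
  rw [outlierBound, ← hEdef, ← hV, ← hσ, ← hc, div_mul_eq_mul_div, div_le_iff₀ hden]
  have hcV : c * V = σ ^ 2 := by rw [hc]; field_simp
  have hEe : ρ / E = ρ * (e + c) := by rw [he]; ring
  rw [hEe]
  set x := α * σ + τ with hx
  have hασ : α * σ = x - τ := by rw [hx]; ring
  -- The discriminant condition is `τ² ≤ e Y`: multiply by `Y` and complete the square. If `Y = 0`,
  -- then `τ = 0` as well.
  have hquad : 0 ≤ β ^ 4 * Y + 2 * ρ * β ^ 2 * x * τ + ρ ^ 2 * e * x ^ 2 := by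
    have he0 : Y = 0 ∨ 0 < Y := hY0.eq_or_lt.imp_left Eq.symm
    have hc2 : c ≤ 1 / E := by
      have := h.dotProduct_sq_le (fun _ => 1)
      simp only [dotProduct, mul_one, one_pow, ← hσ, ← hV, ← hEdef] at this
      rw [hc, div_le_iff₀ hVpos]
      calc _ ≤ _ := this
        _ = _ := by ring
    have he1 : 0 ≤ e := by rw [he]; linarith
    rcases he0 with h0 | h0
    · have hτ0 : τ = 0 := by
        rw [h0, mul_zero] at hτe
        exact pow_eq_zero_iff (two_ne_zero) |>.1 (le_antisymm hτe (sq_nonneg _))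
      rw [hτ0, h0]
      simp only [mul_zero, zero_add]
      positivity
    · refine nonneg_of_mul_nonneg_right (b := _) (a := Y) ?_ h0
      have h7 : 0 ≤ ρ ^ 2 * x ^ 2 * (e * Y - τ ^ 2) :=
        mul_nonneg (by positivity) (sub_nonneg.2 hτe)
      nlinarith [sq_nonneg (β ^ 2 * Y + ρ * x * τ)]
  have hτe' : 0 ≤ ρ * β ^ 2 * (e * Y - τ ^ 2) := mul_nonneg (by positivity) (sub_nonneg.2 hτe)
  have hcx : 0 ≤ ρ ^ 2 * c * x ^ 2 := by rw [hc]; positivity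
  -- After clearing the denominator `β² + ρ / E = β² + ρ (e + c)`, the difference of the two sides
  -- is a sum of three nonnegative terms.
  have hid : (β ^ 2 * Y + ρ * x ^ 2) * (β ^ 2 + ρ * (e + c)) -
      ρ * c * β ^ 2 * (α ^ 2 * V + Y) =
      (β ^ 4 * Y + 2 * ρ * β ^ 2 * x * τ + ρ ^ 2 * e * x ^ 2) + ρ * β ^ 2 * (e * Y - τ ^ 2)
        + ρ ^ 2 * c * x ^ 2 := by
    linear_combination (-ρ * β ^ 2 * α ^ 2) * hcV - ρ * β ^ 2 * (α * σ + x - τ) * hασ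
  linarith

theorem outlierBound_le_eigenvalues [Nonempty m] (hβ : 0 < β) (hρ : 0 < ρ) (i : m) :
    outlierBound μ w β ρ ≤
      (scaledSchur_isHermitian (B := B) h.isHermitian μ w ρ).eigenvalues i := by
  set hH := scaledSchur_isHermitian (B := B) h.isHermitian μ w ρ
  rw [eigenvalue_eq_dotProduct hH, dotProduct_scaledSchur_mulVec]
  have h1 := h.outlierBound_mul_le hβ hρ (unscale μ (hH.eigenvectorBasis i).ofLp)
  rwa [sum_mul_unscale_sq h.mass_pos, eigenvector_dotProduct, if_pos rfl, mul_one] at h1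

end IsSaddle

end SaddleSpectrum

/-! ### GMRES bounds for abstract saddle point systems -/

section SaddleGmres

open Polynomial

variable {n m : Type*} [Fintype n] [DecidableEq n] [Fintype m] [DecidableEq m]
variable {A : Matrix n n ℝ} {B : Matrix m n ℝ} {μ w : m → ℝ} {d β ρ : ℝ}

/-- Conjugation by `diag(μ)^{1/2}` turns the nonsymmetric pressure block into a symmetrically scaled
one; as an intertwining relation it passes to polynomials. -/
theorem diagonal_sqrt_mul_eq (hμ : ∀ K, 0 < μ K) (W : Matrix m m ℝ) :
    diagonal (fun K => √(μ K)) * ((diagonal μ)⁻¹ * W) =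
      (diagonal (fun K => (√(μ K))⁻¹) * W * diagonal (fun K => (√(μ K))⁻¹)) *
        diagonal (fun K => √(μ K)) := by
  have hs : ∀ K, √(μ K) ≠ 0 := fun K => (Real.sqrt_pos.2 (hμ K)).ne'
  have hinv : (diagonal μ)⁻¹ = diagonal (fun K => (μ K)⁻¹) := by
    refine inv_eq_right_inv ?_
    rw [diagonal_mul_diagonal, ← diagonal_one]
    congr 1
    ext K
    exact mul_inv_cancel₀ (hμ K).ne'
  have h1 : diagonal (fun K => (√(μ K))⁻¹) * diagonal (fun K => √(μ K)) = 1 := by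
    rw [diagonal_mul_diagonal, ← diagonal_one]
    congr 1
    ext K
    exact inv_mul_cancel₀ (hs K)
  rw [Matrix.mul_assoc _ (diagonal fun K => (√(μ K))⁻¹), h1, Matrix.mul_one, hinv,
    ← Matrix.mul_assoc, diagonal_mul_diagonal]
  congr 2
  ext K
  have := Real.mul_self_sqrt (hμ K).le
  have h2 := hs K
  have h3 := (hμ K).ne'
  field_simp
  rw [sq, this]

theorem euclNorm_diagonal_sqrt_sq (hμ : ∀ K, 0 < μ K) (x : m → ℝ) :
    euclNorm (diagonal (fun K => √(μ K)) *ᵥ x) ^ 2 = ∑ K, μ K * x K ^ 2 := by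
  rw [euclNorm_sq]
  refine Finset.sum_congr rfl fun K _ => ?_
  rw [mulVec_diagonal, ← Real.mul_self_sqrt (hμ K).le,
    Real.sqrt_mul_self (Real.sqrt_nonneg _)]
  ring

namespace IsSaddle

variable (h : IsSaddle A B μ w d β)

include h

/-- In the norm weighted by the mass matrix, a polynomial in the preconditioned Schur complement is
bounded by its values on the spectrum. -/
theorem sum_aeval_sq_le {p : ℝ[X]} {c : ℝ} (hc : 0 ≤ c)
    (hp : ∀ i, |p.eval ((scaledSchur_isHermitian (B := B) h.isHermitian μ w ρ).eigenvalues i)| ≤ c)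
    (y : m → ℝ) :
    ∑ K, μ K * (aeval ((diagonal μ)⁻¹ * regSchur A B w ρ) p *ᵥ y) K ^ 2 ≤
      c ^ 2 * (lamMax (diagonal μ) * euclNorm y ^ 2) := by
  have h1 := mul_aeval_of_mul_eq (diagonal_sqrt_mul_eq h.mass_pos (regSchur A B w ρ)) p
  have h2 := euclNorm_aeval_mulVec_le (scaledSchur_isHermitian (B := B) h.isHermitian μ w ρ) hc hp
    (diagonal (fun K => √(μ K)) *ᵥ y)
  rw [scaledSchur, mulVec_mulVec, ← h1, ← mulVec_mulVec] at h2
  have h3 := pow_le_pow_left₀ (euclNorm_nonneg _) h2 2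
  rw [mul_pow, euclNorm_diagonal_sqrt_sq h.mass_pos, euclNorm_diagonal_sqrt_sq h.mass_pos] at h3
  refine h3.trans (mul_le_mul_of_nonneg_left ?_ (sq_nonneg _))
  rw [euclNorm_sq]
  exact le_lamMax_diagonal_mul μ y

/-- With `g` the pressure part of `p(T) r`, the velocity part `A⁻¹ Bᵀ g` has energy `gᵀ S g ≤ d gᵀ M
g`, which yields the first square root. The pressure part carries the extra factor `1 - λ`, and
passing to the mass-weighted norm and back costs the second. -/
theorem euclNorm_aeval_precBlock_le [Nonempty n] [Nonempty m] (hd : 0 ≤ d)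
    (hspec : ∀ i, |1 - (scaledSchur_isHermitian (B := B) h.isHermitian μ w ρ).eigenvalues i| ≤ d)
    {p : ℝ[X]} {c : ℝ} (hc : 0 ≤ c)
    (hp : ∀ i, |p.eval ((scaledSchur_isHermitian (B := B) h.isHermitian μ w ρ).eigenvalues i)| ≤ c)
    (r : n ⊕ m → ℝ) :
    euclNorm (aeval (precBlock A B μ w ρ) ((1 - X) * p) *ᵥ r) ≤
      (√(d * lamMax (diagonal μ) / lamMin A) +
        d * √(lamMax (diagonal μ) / lamMin (diagonal μ))) * c * euclNorm r := by
  set Λ := lamMax (diagonal μ)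
  set E := lamMin (diagonal μ)
  have hE : 0 < E := lamMin_diagonal_pos h.mass_pos
  have hEΛ : 0 ≤ Λ := by
    have K : m := Classical.arbitrary m
    exact (h.mass_pos K).le.trans (le_lamMax_diagonal μ K)
  have hlA : 0 < lamMin A := lamMin_pos h.isHermitian h.pos
  set y := r ∘ Sum.inr with hy
  have hyr : euclNorm y ≤ euclNorm r := euclNorm_comp_inr_le r
  have hr0 := euclNorm_nonneg r
  have hy0 := euclNorm_nonneg y
  set g := aeval ((diagonal μ)⁻¹ * regSchur A B w ρ) p *ᵥ y with hg
  rw [aeval_precBlock_mulVec A B μ w ρ p r hg]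
  refine (euclNorm_sumElim_le _ _).trans ?_
  have hg2 := h.sum_aeval_sq_le hc hp y
  rw [← hg] at hg2
  have hA := isUnit_det_of_pos h.pos
  have h1 : euclNorm (A⁻¹ *ᵥ (Bᵀ *ᵥ g)) ≤ √(d * Λ / lamMin A) * (c * euclNorm r) := by
    refine euclNorm_le_of_sq (by positivity) ?_
    have h2 := lamMin_mul_le h.isHermitian (A⁻¹ *ᵥ (Bᵀ *ᵥ g))
    rw [← dotProduct_schur_mulVec hA] at h2
    have h3 := h.le_bound g
    rw [dotProduct_diagonal_mulVec] at h3
    rw [mul_pow, Real.sq_sqrt (by positivity), div_mul_eq_mul_div, le_div_iff₀ hlA]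
    calc _ = lamMin A * ((A⁻¹ *ᵥ (Bᵀ *ᵥ g)) ⬝ᵥ (A⁻¹ *ᵥ (Bᵀ *ᵥ g))) := mul_comm _ _
      _ ≤ d * (c ^ 2 * (Λ * euclNorm y ^ 2)) :=
        (h2.trans h3).trans (mul_le_mul_of_nonneg_left hg2 hd)
      _ ≤ d * (c ^ 2 * (Λ * euclNorm r ^ 2)) := by gcongr
      _ = _ := by ring
  have h4 : euclNorm (g - ((diagonal μ)⁻¹ * regSchur A B w ρ) *ᵥ g) ≤
      d * √(Λ / E) * (c * euclNorm r) := by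
    have hf : g - ((diagonal μ)⁻¹ * regSchur A B w ρ) *ᵥ g =
        aeval ((diagonal μ)⁻¹ * regSchur A B w ρ) ((1 - X) * p) *ᵥ y := by
      rw [map_mul, map_sub, map_one, aeval_X, ← mulVec_mulVec y, sub_mulVec, one_mulVec]
    have h5 := h.sum_aeval_sq_le (p := (1 - X) * p) (c := d * c) (by positivity) (fun i => by
      rw [eval_mul, abs_mul]
      refine mul_le_mul ?_ (hp i) (abs_nonneg _) hd
      simpa using hspec i) y
    rw [← hf] at h5
    have h6 := (lamMin_diagonal_mul_le μ _).trans h5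
    refine euclNorm_le_of_sq (by positivity) ?_
    rw [mul_pow, mul_pow, Real.sq_sqrt (by positivity), ← mul_div_assoc, div_mul_eq_mul_div,
      le_div_iff₀ hE, mul_comm]
    calc _ ≤ (d * c) ^ 2 * (Λ * euclNorm y ^ 2) := h6
      _ ≤ (d * c) ^ 2 * (Λ * euclNorm r ^ 2) := by gcongr
      _ = _ := by ring
  calc _ ≤ √(d * Λ / lamMin A) * (c * euclNorm r) + d * √(Λ / E) * (c * euclNorm r) :=
        add_le_add h1 h4
    _ = _ := by ring

/-- The eigenvalues lie between `0` and `d + t` with `t < β² < 1 ≤ d`. -/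
theorem abs_one_sub_eigenvalues_le [Nonempty m] (hd : 1 ≤ d) (hβ : 0 < β) (hβ1 : β < 1)
    (hρ : 0 < ρ) (hρβ : ρ / lamMin (diagonal μ) < β ^ 2) (i : m) :
    |1 - (scaledSchur_isHermitian (B := B) h.isHermitian μ w ρ).eigenvalues i| ≤ d := by
  have h1 := h.eigenvalues_le hρ.le i
  have h2 := h.outlierBound_le_eigenvalues hβ hρ i
  have hV : 0 < ∑ K, μ K := Finset.sum_pos (fun K _ => h.mass_pos K) Finset.univ_nonempty
  have hE := lamMin_diagonal_pos h.mass_pos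
  have h3 : 0 ≤ outlierBound μ w β ρ := by
    unfold outlierBound; positivity
  rw [abs_le]
  constructor
  · nlinarith
  · linarith

/-- The GMRES bound for a general residual polynomial on the pressure spectrum. -/
theorem gmres_le_of_polynomial [Nonempty n] [Nonempty m] (hd : 1 ≤ d) (hβ : 0 < β) (hβ1 : β < 1)
    (hρ : 0 < ρ) (hρβ : ρ / lamMin (diagonal μ) < β ^ 2) {b x₀ x : n ⊕ m → ℝ} {k : ℕ}
    (hx : IsGMRESIterate (precBlock A B μ w ρ) b x₀ k x) {p : ℝ[X]} {c : ℝ} (hc : 0 ≤ c)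
    (hpk : p.natDegree + 1 ≤ k) (hp0 : p.eval 0 = 1)
    (hp : ∀ i, |p.eval ((scaledSchur_isHermitian (B := B) h.isHermitian μ w ρ).eigenvalues i)| ≤ c) :
    euclNorm (b - precBlock A B μ w ρ *ᵥ x) ≤
      (√(d * lamMax (diagonal μ) / lamMin A) +
        d * √(lamMax (diagonal μ) / lamMin (diagonal μ))) * c *
        euclNorm (b - precBlock A B μ w ρ *ᵥ x₀) := by
  refine (hx.euclNorm_le (p := (1 - X) * p) ?_ (by simp [hp0])).trans
    (h.euclNorm_aeval_precBlock_le (by linarith)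
      (h.abs_one_sub_eigenvalues_le hd hβ hβ1 hρ hρβ) hc hp _)
  refine natDegree_mul_le.trans ?_
  have : (1 - X : ℝ[X]).natDegree ≤ 1 := by compute_degree
  omega

theorem outlierBound_pos [Nonempty m] (hβ : 0 < β) (hρ : 0 < ρ) (hw : ∑ K, w K ≠ 0) :
    0 < outlierBound μ w β ρ := by
  have hV : 0 < ∑ K, μ K := Finset.sum_pos (fun K _ => h.mass_pos K) Finset.univ_nonempty
  have hE := lamMin_diagonal_pos h.mass_pos
  unfold outlierBound
  positivity

/-- Finite termination of GMRES. -/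
theorem gmres_eq_zero [Nonempty n] [Nonempty m] (hd : 1 ≤ d) (hβ : 0 < β) (hβ1 : β < 1)
    (hρ : 0 < ρ) (hρβ : ρ / lamMin (diagonal μ) < β ^ 2) (hw : ∑ K, w K ≠ 0)
    {b x₀ x : n ⊕ m → ℝ} {k : ℕ}
    (hx : IsGMRESIterate (precBlock A B μ w ρ) b x₀ k x) (hk : Fintype.card m + 1 ≤ k) :
    euclNorm (b - precBlock A B μ w ρ *ᵥ x) = 0 := by
  set e := (scaledSchur_isHermitian (B := B) h.isHermitian μ w ρ).eigenvalues with he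
  have hpos : ∀ i, 0 < e i := fun i =>
    (h.outlierBound_pos hβ hρ hw).trans_le (h.outlierBound_le_eigenvalues hβ hρ i)
  refine le_antisymm ?_ (euclNorm_nonneg _)
  -- The product vanishes at every pressure eigenvalue, so `c = 0` is admissible; its degree is at
  -- most the number of pressures, and `1 - X` adds one.
  have := h.gmres_le_of_polynomial hd hβ hβ1 hρ hρβ hx
    (p := ∏ i, (1 - C (e i)⁻¹ * X)) le_rfl ?_ ?_ ?_
  · simpa using this
  · refine le_trans (Nat.add_le_add_right ((natDegree_prod_le _ _).trans
      (Finset.sum_le_card_nsmul _ _ 1 fun i _ => ?_)) 1) (by simpa using hk)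
    compute_degree
  · simp [eval_prod]
  · intro i
    rw [eval_prod, Finset.prod_eq_zero (Finset.mem_univ i)]
    · simp
    · simp [← he, inv_mul_cancel₀ (hpos i).ne']

/-- One root of the residual polynomial at the outlier and Chebyshev polynomials on the other
eigenvalues. -/
theorem gmres_le_of_two_le [Nonempty n] [Nonempty m] (hd : 1 ≤ d) (hβ : 0 < β) (hβ1 : β < 1)
    (hρ : 0 < ρ) (hρβ : ρ / lamMin (diagonal μ) < β ^ 2) (hw : ∑ K, w K ≠ 0)
    {b x₀ x : n ⊕ m → ℝ} {k : ℕ}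
    (hx : IsGMRESIterate (precBlock A B μ w ρ) b x₀ (k + 2) x) :
    euclNorm (b - precBlock A B μ w ρ *ᵥ x) ≤
      (√(d * lamMax (diagonal μ) / lamMin A) +
        d * √(lamMax (diagonal μ) / lamMin (diagonal μ))) *
      ((d + ρ / lamMin (diagonal μ) + outlierBound μ w β ρ) / outlierBound μ w β ρ *
        (2 * ((√(d + ρ / lamMin (diagonal μ)) - √(β ^ 2 - ρ / lamMin (diagonal μ))) /
          (√(d + ρ / lamMin (diagonal μ)) + √(β ^ 2 - ρ / lamMin (diagonal μ)))) ^ k)) *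
      euclNorm (b - precBlock A B μ w ρ *ᵥ x₀) := by
  set e := (scaledSchur_isHermitian (B := B) h.isHermitian μ w ρ).eigenvalues with he
  have hlo : ∀ i, outlierBound μ w β ρ ≤ e i := fun i => h.outlierBound_le_eigenvalues hβ hρ i
  have hup : ∀ i, e i ≤ d + ρ / lamMin (diagonal μ) := fun i => h.eigenvalues_le hρ.le i
  have hl := h.outlierBound_pos hβ hρ hw
  obtain ⟨i₀, hi₀⟩ := h.exists_eigenvalues_ge (ρ := ρ) hρ.le
  rw [← he] at hi₀
  set t := ρ / lamMin (diagonal μ) with ht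
  set l := outlierBound μ w β ρ with hldef
  have ht0 : 0 < t := div_pos hρ (lamMin_diagonal_pos h.mass_pos)
  have hab : β ^ 2 - t < d + t := by nlinarith
  -- The eigenvalues other than the outlier are even at least `β²`; the left endpoint `β² - t` only
  -- serves to produce the stated convergence factor.
  obtain ⟨P, hPk, hP0, hP⟩ := exists_polynomial_small_on_Icc (sub_pos.2 hρβ) hab k
  set q := (√(d + t) - √(β ^ 2 - t)) / (√(d + t) + √(β ^ 2 - t)) with hq
  have hq0 : 0 ≤ q := div_nonneg (sub_nonneg.2 (Real.sqrt_le_sqrt hab.le))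
    (add_nonneg (Real.sqrt_nonneg _) (Real.sqrt_nonneg _))
  have hpos : ∀ i, 0 < e i := fun i => hl.trans_le (hlo i)
  refine h.gmres_le_of_polynomial hd hβ hβ1 hρ hρβ hx (p := (1 - C (e i₀)⁻¹ * X) * P) ?_ ?_ ?_ ?_
  · have : 0 ≤ d := by linarith
    positivity
  · have h1 : (1 - C (e i₀)⁻¹ * X : ℝ[X]).natDegree ≤ 1 := by compute_degree
    have := natDegree_mul_le (p := (1 - C (e i₀)⁻¹ * X : ℝ[X])) (q := P)
    omega
  · simp [hP0]
  · intro i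
    rw [← he, eval_mul, abs_mul]
    simp only [eval_sub, eval_one, eval_mul, eval_C, eval_X]
    rcases eq_or_ne i i₀ with rfl | hi
    · rw [inv_mul_cancel₀ (hpos i).ne', sub_self, abs_zero, zero_mul]
      have : 0 ≤ d := by linarith
      positivity
    · refine mul_le_mul ?_ (hP _ (by linarith [hi₀ i hi]) (hup i)) (abs_nonneg _)
        (by have : 0 ≤ d := by linarith
            positivity)
      -- At the other eigenvalues the linear factor is at most `1 + (d + t) / l`, the amplification
      -- paid for removing the outlier.
      have h2 : (e i₀)⁻¹ * e i ≤ (d + t) / l := by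
        rw [inv_mul_eq_div]
        exact div_le_div₀ (by linarith) (hup i) hl (hlo i₀)
      have h3 : 0 < (e i₀)⁻¹ * e i := mul_pos (inv_pos.2 (hpos _)) (hpos _)
      rw [add_div, div_self hl.ne', abs_le]
      constructor <;> linarith

end IsSaddle

end SaddleGmres

/-! ### Barycentric coordinates, normals and measures of simplices -/

section Simplices

open Module Filter Topology

variable {d : ℕ}

theorem map_barycenter (f : Pt d →ᵃ[ℝ] ℝ) {s : Finset (Pt d)} (hs : s.card ≠ 0) :
    f (barycenter s) = (s.card : ℝ)⁻¹ * ∑ c ∈ s, f c := by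
  have h : ∀ y, f y = f.linear y + f 0 := fun y => congrFun f.decomp y
  have hc : (s.card : ℝ) ≠ 0 := by exact_mod_cast hs
  rw [Finset.sum_congr rfl fun c _ => h c, Finset.sum_add_distrib, Finset.sum_const,
    nsmul_eq_mul, mul_add, inv_mul_cancel_left₀ hc, h, barycenter, map_smul, map_sum, smul_eq_mul]

/-- The vertex set of a nondegenerate `d`-simplex. -/
structure IsSimplex (K : Finset (Pt d)) : Prop where
  card_eq : K.card = d + 1
  affineIndependent : AffineIndependent ℝ ((↑) : K → Pt d)

theorem isCompact_hull (s : Finset (Pt d)) : IsCompact (hull s) :=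
  s.finite_toSet.isCompact_convexHull ℝ

theorem hull_mono {s t : Finset (Pt d)} (h : s ⊆ t) : hull s ⊆ hull t :=
  convexHull_mono (by exact_mod_cast h)

namespace IsSimplex

variable {K L e : Finset (Pt d)} (hK : IsSimplex K) (hL : IsSimplex L)

/-- The vertices of a simplex as an affine basis. -/
def basis : AffineBasis K ℝ (Pt d) :=
  ⟨(↑), hK.affineIndependent, by
    rw [hK.affineIndependent.affineSpan_eq_top_iff_card_eq_finrank_add_one]
    simp [hK.card_eq]⟩

open Classical in
/-- The barycentric coordinate belonging to a vertex (zero if the point is no vertex). -/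
def coord (a : Pt d) : Pt d →ᵃ[ℝ] ℝ :=
  if h : a ∈ K then hK.basis.coord ⟨a, h⟩ else 0

theorem coord_of_mem {a : Pt d} (h : a ∈ K) : hK.coord a = hK.basis.coord ⟨a, h⟩ := by
  simp [coord, h]

theorem continuous_coord (a : Pt d) : Continuous (hK.coord a) :=
  (hK.coord a).continuous_of_finiteDimensional

theorem coord_self {a : Pt d} (ha : a ∈ K) : hK.coord a a = 1 := by
  rw [hK.coord_of_mem ha]
  exact hK.basis.coord_apply_eq ⟨a, ha⟩

theorem coord_of_ne {a c : Pt d} (ha : a ∈ K) (hc : c ∈ K) (hac : a ≠ c) : hK.coord a c = 0 := by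
  rw [hK.coord_of_mem ha]
  exact hK.basis.coord_apply_ne (i := ⟨a, ha⟩) (j := ⟨c, hc⟩) (by simpa using hac)

theorem sum_coord (x : Pt d) : ∑ a ∈ K, hK.coord a x = 1 := by
  rw [← Finset.sum_coe_sort, ← hK.basis.sum_coord_apply_eq_one x]
  exact Finset.sum_congr rfl fun a _ => by rw [hK.coord_of_mem a.2]

theorem sum_coord_smul (x : Pt d) : ∑ a ∈ K, hK.coord a x • a = x := by
  rw [← Finset.sum_coe_sort K (fun a => hK.coord a x • a)]
  conv_rhs => rw [← hK.basis.linear_combination_coord_eq_self x]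
  exact Finset.sum_congr rfl fun a _ => by rw [hK.coord_of_mem a.2]; rfl

theorem apply_eq_sum (f : Pt d →ᵃ[ℝ] ℝ) (x : Pt d) : f x = ∑ a ∈ K, hK.coord a x * f a := by
  have h : ∀ y, f y = f.linear y + f 0 := fun y => congrFun f.decomp y
  rw [h x, Finset.sum_congr rfl fun a _ => by rw [h a, mul_add], Finset.sum_add_distrib,
    ← Finset.sum_mul, hK.sum_coord, one_mul]
  congr 1
  conv_lhs => rw [← hK.sum_coord_smul x]
  simp

theorem hull_eq : hull K = convexHull ℝ (Set.range hK.basis) := by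
  rw [show Set.range hK.basis = (K : Set (Pt d)) from Subtype.range_coe]
  rfl

theorem mem_hull_iff {x : Pt d} : x ∈ hull K ↔ ∀ a ∈ K, 0 ≤ hK.coord a x := by
  rw [hK.hull_eq, hK.basis.convexHull_eq_nonneg_coord]
  refine ⟨fun h a ha => ?_, fun h a => ?_⟩
  · rw [hK.coord_of_mem ha]; exact h ⟨a, ha⟩
  · have := h a a.2
    rwa [hK.coord_of_mem a.2] at this

theorem mem_interior_hull_iff {x : Pt d} : x ∈ interior (hull K) ↔ ∀ a ∈ K, 0 < hK.coord a x := by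
  rw [hK.hull_eq, hK.basis.interior_convexHull]
  refine ⟨fun h a ha => ?_, fun h a => ?_⟩
  · rw [hK.coord_of_mem ha]; exact h ⟨a, ha⟩
  · have := h a a.2
    rwa [hK.coord_of_mem a.2] at this

theorem coord_eq_zero_of_mem_affineSpan {s : Set (Pt d)} (hs : s ⊆ K) {x : Pt d}
    (hx : x ∈ affineSpan ℝ s) {a : Pt d} (ha : a ∈ K) (has : a ∉ s) : hK.coord a x = 0 := by
  have h : (hK.coord a) x ∈ (affineSpan ℝ s).map (hK.coord a) := ⟨x, hx, rfl⟩
  rw [AffineSubspace.map_span] at h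
  have h2 : (hK.coord a) '' s ⊆ {0} := by
    rintro _ ⟨c, hc, rfl⟩
    exact hK.coord_of_ne ha (hs hc) (fun h => has (h ▸ hc))
  have h3 := affineSpan_mono ℝ h2 h
  simpa [AffineSubspace.mem_affineSpan_singleton] using h3

theorem coord_eq_zero_of_mem_convexHull {s : Set (Pt d)} (hs : s ⊆ K) {x : Pt d}
    (hx : x ∈ convexHull ℝ s) {a : Pt d} (ha : a ∈ K) (has : a ∉ s) : hK.coord a x = 0 :=
  hK.coord_eq_zero_of_mem_affineSpan hs (convexHull_subset_affineSpan s hx) ha has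

theorem mem_convexHull_of_coord {s : Finset (Pt d)} (hs : s ⊆ K) {x : Pt d} (hx : x ∈ hull K)
    (h0 : ∀ a ∈ K, a ∉ s → hK.coord a x = 0) : x ∈ convexHull ℝ (s : Set (Pt d)) := by
  rw [← hK.sum_coord_smul x, ← Finset.sum_subset hs fun a ha has => by rw [h0 a ha has, zero_smul]]
  refine (convex_convexHull ℝ _).sum_mem (fun a ha => hK.mem_hull_iff.1 hx a (hs ha)) ?_
    fun a ha => subset_convexHull ℝ _ (by exact_mod_cast ha)
  rw [Finset.sum_subset hs h0, hK.sum_coord]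

theorem barycenter_mem_interior (hK : IsSimplex K) : barycenter K ∈ interior (hull K) := by
  rw [hK.mem_interior_hull_iff]
  intro a ha
  rw [map_barycenter _ (by rw [hK.card_eq]; omega), Finset.sum_eq_single a
    (fun c hc hca => hK.coord_of_ne ha hc hca.symm) (fun h => absurd ha h), hK.coord_self ha,
    hK.card_eq, mul_one, inv_pos]
  exact Nat.cast_pos.2 d.succ_pos

theorem vol_pos (hK : IsSimplex K) : 0 < vol K := by
  refine ENNReal.toReal_pos ?_ (isCompact_hull K).measure_lt_top.ne
  refine (IsOpen.measure_pos volume isOpen_interior ⟨_, hK.barycenter_mem_interior⟩).trans_le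
    (measure_mono interior_subset) |>.ne'

end IsSimplex

/-- `a` is the vertex of `K` opposite to the facet `e`. -/
structure IsOpposite (K e : Finset (Pt d)) (a : Pt d) : Prop where
  mem : a ∈ K
  notMem : a ∉ e
  subset : e ⊆ K
  card_eq : e.card = d
  eq_or_mem : ∀ c ∈ K, c = a ∨ c ∈ e

theorem IsSimplex.exists_isOpposite {K e : Finset (Pt d)} (hK : IsSimplex K)
    (he : e ∈ facetsOf K) : ∃ a, IsOpposite K e a := by
  classical
  rw [facetsOf, Finset.mem_powersetCard] at he
  have h1 : (K \ e).card = 1 := by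
    rw [Finset.card_sdiff_of_subset he.1, hK.card_eq, he.2]; omega
  obtain ⟨a, ha⟩ := Finset.card_eq_one.1 h1
  have ha' : a ∈ K \ e := by rw [ha]; exact Finset.mem_singleton_self a
  rw [Finset.mem_sdiff] at ha'
  refine ⟨a, ha'.1, ha'.2, he.1, he.2, fun c hc => ?_⟩
  by_cases hce : c ∈ e
  · exact Or.inr hce
  · left
    have : c ∈ K \ e := Finset.mem_sdiff.2 ⟨hc, hce⟩
    rw [ha] at this
    exact Finset.mem_singleton.1 this

namespace IsOpposite

variable {K L e : Finset (Pt d)} {a b : Pt d}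

theorem mem_facetsOf (h : IsOpposite K e a) : e ∈ facetsOf K :=
  Finset.mem_powersetCard.2 ⟨h.subset, h.card_eq⟩

theorem sum_eq (h : IsOpposite K e a) {E : Type*} [AddCommMonoid E] (f : Pt d → E) :
    ∑ c ∈ K, f c = f a + ∑ c ∈ e, f c := by
  classical
  have : K = insert a e := by
    ext c
    rw [Finset.mem_insert]
    exact ⟨h.eq_or_mem c, fun hc => hc.elim (fun hc => hc ▸ h.mem) (fun hc => h.subset hc)⟩
  rw [this, Finset.sum_insert h.notMem]

theorem coord_eq_zero (h : IsOpposite K e a) (hK : IsSimplex K) {c : Pt d} (hc : c ∈ e) :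
    hK.coord a c = 0 :=
  hK.coord_of_ne h.mem (h.subset hc) fun hac => h.notMem (hac ▸ hc)

theorem coord_barycenter_pos (h : IsOpposite K e a) (hK : IsSimplex K) {c : Pt d} (hc : c ∈ e) :
    0 < hK.coord c (barycenter e) := by
  have he : 0 < e.card := Finset.card_pos.2 ⟨c, hc⟩
  rw [map_barycenter _ he.ne', Finset.sum_eq_single c
    (fun c' hc' hne => hK.coord_of_ne (h.subset hc) (h.subset hc') hne.symm)
    (fun h => absurd hc h), hK.coord_self (h.subset hc), mul_one, inv_pos]
  exact Nat.cast_pos.2 he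

theorem coord_barycenter_eq_zero (hd : d ≠ 0) (h : IsOpposite K e a) (hK : IsSimplex K) :
    hK.coord a (barycenter e) = 0 := by
  rw [map_barycenter _ (by rw [h.card_eq]; exact hd), Finset.sum_eq_zero, mul_zero]
  exact fun c hc => h.coord_eq_zero hK hc

theorem coord_eq_zero_of_mem_affineSpan (h : IsOpposite K e a) (hK : IsSimplex K) {x : Pt d}
    (hx : x ∈ affineSpan ℝ (e : Set (Pt d))) : hK.coord a x = 0 :=
  hK.coord_eq_zero_of_mem_affineSpan (by exact_mod_cast h.subset) hx h.mem
    (by exact_mod_cast h.notMem)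

/-- The coordinate of `K` at `a` vanishes on `e`, so in terms of the vertices of `L` only its value
at `b` survives. The sign of `hK.coord a b` therefore decides whether `K` and `L` lie on the same
side of `e`. -/
theorem coord_eq_mul (ha : IsOpposite K e a) (hb : IsOpposite L e b) (hK : IsSimplex K)
    (hL : IsSimplex L) (x : Pt d) : hK.coord a x = hL.coord b x * hK.coord a b := by
  rw [hL.apply_eq_sum (hK.coord a) x, hb.sum_eq, Finset.sum_eq_zero, add_zero]
  intro c hc
  rw [ha.coord_eq_zero hK hc, mul_zero]

theorem coord_ne_zero (ha : IsOpposite K e a) (hb : IsOpposite L e b) (hK : IsSimplex K)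
    (hL : IsSimplex L) : hK.coord a b ≠ 0 := by
  intro h0
  have := ha.coord_eq_mul hb hK hL a
  rw [hK.coord_self ha.mem, h0, mul_zero] at this
  exact one_ne_zero this

/-- On the hyperplane of a shared facet both systems of coordinates reduce to the barycentric
coordinates of the facet. -/
theorem coord_eq_coord (ha : IsOpposite K e a) (hb : IsOpposite L e b) (hK : IsSimplex K)
    (hL : IsSimplex L) {x c : Pt d} (hx : hK.coord a x = 0) (hc : c ∈ e) :
    hL.coord c x = hK.coord c x := by
  rw [hK.apply_eq_sum (hL.coord c) x, ha.sum_eq, hx, zero_mul, zero_add,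
    Finset.sum_eq_single c, hL.coord_self (hb.subset hc), mul_one]
  · intro c' hc' hne
    rw [hL.coord_of_ne (hb.subset hc) (hb.subset hc') hne.symm, mul_zero]
  · exact fun h => absurd hc h

/-- Near a relative interior point of the facet the coordinates belonging to `e` stay positive, and
the sign of the remaining one selects the element. -/
theorem hull_union_mem_nhds (ha : IsOpposite K e a) (hb : IsOpposite L e b) (hK : IsSimplex K)
    (hL : IsSimplex L) (hab : hK.coord a b < 0) {y : Pt d} (hy : hK.coord a y = 0)
    (hy' : ∀ c ∈ e, 0 < hK.coord c y) : hull K ∪ hull L ∈ 𝓝 y := by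
  have h1 : ∀ᶠ x in 𝓝 y, ∀ c ∈ e, 0 < hK.coord c x :=
    (Finset.eventually_all e).2 fun c hc =>
      (hK.continuous_coord c).continuousAt.eventually_const_lt (hy' c hc)
  have h2 : ∀ᶠ x in 𝓝 y, ∀ c ∈ e, 0 < hL.coord c x :=
    (Finset.eventually_all e).2 fun c hc =>
      (hL.continuous_coord c).continuousAt.eventually_const_lt (by
        rw [ha.coord_eq_coord hb hK hL hy hc]; exact hy' c hc)
  filter_upwards [h1, h2] with x hx1 hx2
  rcases le_total 0 (hK.coord a x) with h | h
  · left
    rw [hK.mem_hull_iff]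
    intro c hc
    rcases ha.eq_or_mem c hc with rfl | hce
    · exact h
    · exact (hx1 c hce).le
  · right
    rw [hL.mem_hull_iff]
    intro c hc
    rcases hb.eq_or_mem c hc with rfl | hce
    · rw [ha.coord_eq_mul hb hK hL x] at h
      by_contra! hneg
      nlinarith
    · exact (hx2 c hce).le

/-! ### Normals -/

theorem sub_barycenter_mem (hd : d ≠ 0) (he : e.card = d) {c : Pt d} (hc : c ∈ e) :
    c - barycenter e ∈ vectorSpan ℝ (e : Set (Pt d)) := by
  have h0 : (d : ℝ) ≠ 0 := by exact_mod_cast hd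
  have h : c - barycenter e = (d : ℝ)⁻¹ • ∑ x ∈ e, (c - x) := by
    rw [Finset.sum_sub_distrib, Finset.sum_const, he, barycenter, he, smul_sub,
      ← Nat.cast_smul_eq_nsmul ℝ, inv_smul_smul₀ h0]
  rw [h]
  exact Submodule.smul_mem _ _ (Submodule.sum_mem _ fun x hx =>
    vsub_mem_vectorSpan ℝ (by exact_mod_cast hc) (by exact_mod_cast hx))

theorem barycenter_mem_affineSpan (hd : d ≠ 0) (he : e.card = d) :
    barycenter e ∈ affineSpan ℝ (e : Set (Pt d)) := by
  obtain ⟨c, hc⟩ : e.Nonempty := Finset.card_pos.1 (by omega)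
  have h1 := sub_barycenter_mem hd he hc
  rw [← direction_affineSpan] at h1
  have hc' : c ∈ affineSpan ℝ (e : Set (Pt d)) := subset_affineSpan ℝ _ (by exact_mod_cast hc)
  have := AffineSubspace.vadd_mem_of_mem_direction (Submodule.neg_mem _ h1) hc'
  simpa using this

theorem barycenter_sub_barycenter (hd : d ≠ 0) (h : IsOpposite K e a) (hK : IsSimplex K) :
    barycenter e - barycenter K = ((d : ℝ) + 1)⁻¹ • (barycenter e - a) := by
  have h0 : (d : ℝ) ≠ 0 := by exact_mod_cast hd
  have h1 : ((d : ℝ) + 1) ≠ 0 := by positivity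
  have h2 : ∑ x ∈ e, x = (d : ℝ) • barycenter e := by
    rw [barycenter, h.card_eq, smul_inv_smul₀ h0]
  have h3 : barycenter K = ((d : ℝ) + 1)⁻¹ • (a + (d : ℝ) • barycenter e) := by
    conv_lhs => rw [barycenter, hK.card_eq, h.sum_eq, h2]
    push_cast
    rfl
  calc barycenter e - barycenter K
      = ((d : ℝ) + 1)⁻¹ • (((d : ℝ) + 1) • barycenter e) -
        ((d : ℝ) + 1)⁻¹ • (a + (d : ℝ) • barycenter e) := by rw [inv_smul_smul₀ h1, h3]
    _ = ((d : ℝ) + 1)⁻¹ • (barycenter e - a) := by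
      rw [← smul_sub]
      congr 1
      module

/-- The unnormalized normal. -/
def height (e : Finset (Pt d)) (y : Pt d) : Pt d :=
  (vectorSpan ℝ (e : Set (Pt d)))ᗮ.starProjection y

theorem outwardNormal_eq (hd : d ≠ 0) (h : IsOpposite K e a) (hK : IsSimplex K) :
    outwardNormal K e =
      ‖height e (barycenter e - a)‖⁻¹ • height e (barycenter e - a) := by
  have h1 : (0 : ℝ) < ((d : ℝ) + 1)⁻¹ := by positivity
  simp only [outwardNormal]
  rw [barycenter_sub_barycenter hd h hK, map_smul]
  change ‖((d : ℝ) + 1)⁻¹ • height e (barycenter e - a)‖⁻¹ •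
    ((d : ℝ) + 1)⁻¹ • height e (barycenter e - a) = _
  rw [norm_smul, Real.norm_of_nonneg h1.le, smul_smul]
  congr 1
  field_simp

/-- Expand `b` in the vertices of `K`: those of `e` contribute tangential vectors, which the
projection kills. Opposite sides thus get opposite normals. -/
theorem height_barycenter_sub (hd : d ≠ 0) (ha : IsOpposite K e a) (hK : IsSimplex K) (b : Pt d) :
    height e (barycenter e - b) = hK.coord a b • height e (barycenter e - a) := by
  rw [height, height, ← map_smul, ← sub_eq_zero, ← map_sub,
    Submodule.starProjection_apply_eq_zero_iff, Submodule.orthogonal_orthogonal]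
  have h1 : barycenter e - b = ∑ c ∈ K, hK.coord c b • (barycenter e - c) := by
    simp_rw [smul_sub]
    rw [Finset.sum_sub_distrib, hK.sum_coord_smul, ← Finset.sum_smul, hK.sum_coord, one_smul]
  rw [h1, ha.sum_eq, add_sub_cancel_left]
  refine Submodule.sum_mem _ fun c hc => Submodule.smul_mem _ _ ?_
  rw [← neg_sub]
  exact Submodule.neg_mem _ (sub_barycenter_mem hd ha.card_eq hc)

theorem outwardNormal_eq_neg (hd : d ≠ 0) (ha : IsOpposite K e a) (hb : IsOpposite L e b)
    (hK : IsSimplex K) (hL : IsSimplex L) (hab : hK.coord a b < 0) :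
    outwardNormal L e = -outwardNormal K e := by
  rw [outwardNormal_eq hd hb hL, outwardNormal_eq hd ha hK, height_barycenter_sub hd ha hK b,
    norm_smul, Real.norm_of_nonpos hab.le, smul_smul, ← neg_smul]
  congr 1
  have := hab.ne
  rw [mul_inv, mul_comm, ← mul_assoc, inv_neg, mul_neg, mul_inv_cancel₀ this]
  ring

theorem height_ne_zero (hd : d ≠ 0) (ha : IsOpposite K e a) (hK : IsSimplex K) :
    height e (barycenter e - a) ≠ 0 := by
  rw [height, Ne, Submodule.starProjection_apply_eq_zero_iff, Submodule.orthogonal_orthogonal,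
    ← direction_affineSpan]
  intro hmem
  have hb := barycenter_mem_affineSpan hd ha.card_eq
  have h1 := AffineSubspace.vadd_mem_of_mem_direction (Submodule.neg_mem _ hmem) hb
  have h2 : a ∈ affineSpan ℝ (e : Set (Pt d)) := by simpa using h1
  have h3 := ha.coord_eq_zero_of_mem_affineSpan hK h2
  rw [hK.coord_self ha.mem] at h3
  exact one_ne_zero h3

theorem inner_height (y : Pt d) (v : Pt d) (hv : v ∈ vectorSpan ℝ (e : Set (Pt d))) :
    ⟪v, height e y⟫ = 0 :=
  Submodule.inner_right_of_mem_orthogonal hv (Submodule.starProjection_apply_mem _ _)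

theorem sub_mem_vectorSpan_of_mem_hull {x y : Pt d} (hx : x ∈ hull e) (hy : y ∈ hull e) :
    x - y ∈ vectorSpan ℝ (e : Set (Pt d)) := by
  rw [← direction_affineSpan]
  exact AffineSubspace.vsub_mem_direction (convexHull_subset_affineSpan _ hx)
    (convexHull_subset_affineSpan _ hy)

/-- On a facet containing `c`, the field `x - c` is tangential. -/
theorem inner_sub_outwardNormal_of_mem {x c : Pt d} (hx : x ∈ hull e) (hc : c ∈ e) :
    ⟪x - c, outwardNormal K e⟫ = 0 := by
  simp only [outwardNormal]
  rw [inner_smul_right]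
  exact mul_eq_zero_of_right _ (inner_height _ _
    (sub_mem_vectorSpan_of_mem_hull hx (subset_convexHull ℝ _ (by exact_mod_cast hc))))

/-- On the facet opposite to `a`, the normal component of the field `x - a` is a positive
constant. -/
theorem inner_sub_outwardNormal (hd : d ≠ 0) (ha : IsOpposite K e a) (hK : IsSimplex K)
    {x : Pt d} (hx : x ∈ hull e) :
    ⟪x - a, outwardNormal K e⟫ = ‖height e (barycenter e - a)‖ := by
  have h0 := norm_ne_zero_iff.2 (height_ne_zero hd ha hK)
  rw [outwardNormal_eq hd ha hK, inner_smul_right]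
  have h1 : x - a = (x - barycenter e) + (barycenter e - a) := by abel
  have h2 : x - barycenter e ∈ vectorSpan ℝ (e : Set (Pt d)) := by
    rw [← direction_affineSpan]
    exact AffineSubspace.vsub_mem_direction (convexHull_subset_affineSpan _ hx)
      (barycenter_mem_affineSpan hd ha.card_eq)
  rw [h1, inner_add_left, inner_height _ _ h2, zero_add]
  have h3 : ⟪barycenter e - a, height e (barycenter e - a)⟫ =
      ‖height e (barycenter e - a)‖ ^ 2 := by
    rw [← real_inner_self_eq_norm_sq, height,
      Submodule.inner_starProjection_left_eq_right, Submodule.starProjection_eq_self_iff.2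
        (Submodule.starProjection_apply_mem _ _)]
  rw [h3, sq, inv_mul_cancel_left₀ h0]

end IsOpposite

/-! ### Surface measure of a facet -/

/-- The facet is the isometric image of a nondegenerate simplex in `(d - 1)`-space, where the
normalized Hausdorff measure is Lebesgue measure. -/
theorem surf_hull_pos_lt_top (hd : d ≠ 0) {e : Finset (Pt d)} (he : e.card = d)
    (hind : AffineIndependent ℝ ((↑) : e → Pt d)) : 0 < surf d (hull e) ∧ surf d (hull e) < ⊤ := by
  obtain ⟨p, hp⟩ : e.Nonempty := Finset.card_pos.1 (by omega)
  set V := vectorSpan ℝ (e : Set (Pt d)) with hV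
  have hfin : finrank ℝ V = d - 1 := by
    have h1 := hind.finrank_vectorSpan (n := d - 1) (by simp [he]; omega)
    have h2 : vectorSpan ℝ (Set.range ((↑) : e → Pt d)) = V := by
      rw [hV]
      congr 1
      exact Subtype.range_coe
    rwa [h2] at h1
  let ι : EuclideanSpace ℝ (Fin (d - 1)) ≃ₗᵢ[ℝ] V :=
    ((stdOrthonormalBasis ℝ V).reindex (finCongr hfin)).repr.symm
  let φ : EuclideanSpace ℝ (Fin (d - 1)) →ᵃ[ℝ] Pt d :=
    (V.subtype ∘ₗ ι.toLinearEquiv.toLinearMap).toAffineMap + AffineMap.const ℝ _ p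
  have hφ : ∀ x, φ x = (ι x : Pt d) + p := fun x => rfl
  have hiso : Isometry φ := by
    refine Isometry.of_dist_eq fun x y => ?_
    rw [hφ, hφ, dist_add_right, ← Subtype.dist_eq, ι.dist_map]
  let g : e → EuclideanSpace ℝ (Fin (d - 1)) := fun c =>
    ι.symm ⟨c - p, vsub_mem_vectorSpan ℝ (by exact_mod_cast c.2) (by exact_mod_cast hp)⟩
  have hg : φ ∘ g = ((↑) : e → Pt d) := by
    ext1 c
    simp [hφ, g]
  have hgind : AffineIndependent ℝ g := by
    refine AffineIndependent.of_comp φ ?_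
    rw [hg]; exact hind
  have hspan : affineSpan ℝ (Set.range g) = ⊤ := by
    rw [hgind.affineSpan_eq_top_iff_card_eq_finrank_add_one]
    simp [he]; omega
  have himage : hull e = φ '' convexHull ℝ (Set.range g) := by
    rw [AffineMap.image_convexHull, ← Set.range_comp, hg, Subtype.range_coe]
    rfl
  have hmeas : surf d (hull e) = volume (convexHull ℝ (Set.range g)) := by
    rw [himage, surf, hiso.euclideanHausdorffMeasure_image,
      EuclideanSpace.euclideanHausdorffMeasure_eq_volume]
  rw [hmeas]
  constructor
  · obtain ⟨x, hx⟩ := interior_convexHull_nonempty_iff_affineSpan_eq_top.2 hspan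
    exact (isOpen_interior.measure_pos volume ⟨x, hx⟩).trans_le (measure_mono interior_subset)
  · exact ((Set.finite_range g).isCompact_convexHull ℝ).measure_lt_top

end Simplices

/-! ### Neighbouring elements, boundary facets and volume of the mesh -/

namespace SimplicialMesh

open Module Filter Topology

variable {d : ℕ} {Ω : Set (Pt d)} (M : SimplicialMesh Ω)

theorem isSimplex {K : Finset (Pt d)} (hK : K ∈ M.elems) : IsSimplex K :=
  ⟨M.card_elem K hK, M.affineIndependent K hK⟩

/-- Points on a segment leaving the relative interior of a facet: the coordinates belonging to the
facet stay positive. -/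
theorem _root_.StokesWG.IsSimplex.eventually_coord_pos {K e : Finset (Pt d)} (hK : IsSimplex K)
    {y : Pt d} (v : Pt d) (hy : ∀ c ∈ e, 0 < hK.coord c y) :
    ∀ᶠ s : ℝ in 𝓝[>] 0, ∀ c ∈ e, 0 < hK.coord c (AffineMap.lineMap y v s) := by
  have hcont : Tendsto (fun s : ℝ => AffineMap.lineMap y v s) (𝓝[>] (0 : ℝ)) (𝓝 y) := by
    have : Continuous fun s : ℝ => (AffineMap.lineMap y v s : Pt d) := AffineMap.lineMap_continuous
    have h2 := this.tendsto 0
    rw [AffineMap.lineMap_apply_zero] at h2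
    exact h2.mono_left nhdsWithin_le_nhds
  have h : ∀ᶠ x in 𝓝 y, ∀ c ∈ e, 0 < hK.coord c x := (Finset.eventually_all e).2 fun c hc =>
    (hK.continuous_coord c).continuousAt.eventually_const_lt (hy c hc)
  exact hcont.eventually h

/-- Across a facet that is not contained in the boundary there is another element. -/
theorem exists_neighbour (hd : d ≠ 0) (hΩ : IsStokesDomain Ω) {K e : Finset (Pt d)} {a : Pt d}
    (hK : K ∈ M.elems) (ha : IsOpposite K e a) (he : ¬ hull e ⊆ frontier Ω) :
    ∃ L ∈ M.elems, ∃ b, IsOpposite L e b ∧ (M.isSimplex hK).coord a b < 0 := by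
  have sK := M.isSimplex hK
  obtain ⟨x, hxe, hxf⟩ := Set.not_subset.1 he
  have hxK : x ∈ hull K := hull_mono ha.subset hxe
  have hxc : x ∈ closure Ω := by
    rw [← M.cover]; exact Set.mem_biUnion hK hxK
  have hxΩ : x ∈ Ω := by
    by_contra hx
    exact hxf (by rw [hΩ.isOpen.frontier_eq]; exact ⟨hxc, hx⟩)
  -- a point of `Ω` in the relative interior of the facet
  obtain ⟨y, hyΩ, hya, hye⟩ : ∃ y ∈ Ω, sK.coord a y = 0 ∧ ∀ c ∈ e, 0 < sK.coord c y := by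
    have hcont : Continuous fun s : ℝ => (AffineMap.lineMap x (barycenter e) s : Pt d) :=
      AffineMap.lineMap_continuous
    have h2 := hcont.tendsto 0
    rw [AffineMap.lineMap_apply_zero] at h2
    obtain ⟨s, hsΩ, hs0, hs1⟩ := (((h2.mono_left nhdsWithin_le_nhds).eventually
      (hΩ.isOpen.mem_nhds hxΩ)).and (Ioo_mem_nhdsGT zero_lt_one)).exists
    refine ⟨_, hsΩ, ?_, fun c hc => ?_⟩
    · rw [AffineMap.apply_lineMap, ha.coord_barycenter_eq_zero hd sK,
        ha.coord_eq_zero_of_mem_affineSpan sK (convexHull_subset_affineSpan _ hxe)]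
      simp
    · rw [AffineMap.apply_lineMap, AffineMap.lineMap_apply_module, smul_eq_mul, smul_eq_mul]
      exact add_pos_of_nonneg_of_pos
        (mul_nonneg (by linarith) (sK.mem_hull_iff.1 hxK c (ha.subset hc)))
        (mul_pos hs0 (ha.coord_barycenter_pos sK hc))
  -- points beyond the facet
  have hev : ∀ᶠ s : ℝ in 𝓝[>] 0, (AffineMap.lineMap y a (-s) : Pt d) ∈ ⋃ L ∈ M.elems, hull L := by
    have h1 : Continuous fun s : ℝ => (AffineMap.lineMap y a (-s) : Pt d) :=
      AffineMap.lineMap_continuous.comp continuous_neg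
    have h2 := h1.tendsto 0
    simp only [neg_zero, AffineMap.lineMap_apply_zero] at h2
    filter_upwards [(h2.mono_left nhdsWithin_le_nhds).eventually (hΩ.isOpen.mem_nhds hyΩ)]
      with s hs
    rw [M.cover]
    exact subset_closure hs
  -- There are finitely many elements, so one contains points beyond the facet arbitrarily close to
  -- `y`; being closed, it contains `y` too.
  obtain ⟨L, hL, hfr⟩ : ∃ L ∈ M.elems,
      ∃ᶠ s : ℝ in 𝓝[>] 0, (AffineMap.lineMap y a (-s) : Pt d) ∈ hull L := by
    by_contra! hcon
    have h1 : ∀ᶠ s : ℝ in 𝓝[>] 0, ∀ L ∈ M.elems, (AffineMap.lineMap y a (-s) : Pt d) ∉ hull L :=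
      (Finset.eventually_all _).2 hcon
    obtain ⟨s, hs1, hs2⟩ := (hev.and h1).exists
    obtain ⟨L, hL, hs⟩ := Set.mem_iUnion₂.1 hs1
    exact hs2 L hL hs
  have sL := M.isSimplex hL
  have hyL : y ∈ hull L := by
    refine (isCompact_hull L).isClosed.mem_of_frequently_of_tendsto hfr ?_
    have h1 : Continuous fun s : ℝ => (AffineMap.lineMap y a (-s) : Pt d) :=
      AffineMap.lineMap_continuous.comp continuous_neg
    have h2 := h1.tendsto 0
    simp only [neg_zero, AffineMap.lineMap_apply_zero] at h2
    exact h2.mono_left nhdsWithin_le_nhds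
  have hyK : y ∈ hull K := by
    rw [sK.mem_hull_iff]
    intro c hc
    rcases ha.eq_or_mem c hc with rfl | hce
    · exact hya.ge
    · exact (hye c hce).le
  have hconf := M.conforming K hK L hL ⟨hyK, hyL⟩
  -- Conformity puts `y` in the hull of the common vertices. All coordinates of `y` belonging to `e`
  -- are positive, so every vertex of `e` must be common.
  have heL : e ⊆ L := by
    intro c hc
    by_contra hcL
    have := sK.coord_eq_zero_of_mem_convexHull Set.inter_subset_left hconf (ha.subset hc)
      (fun h => hcL (by exact_mod_cast h.2))
    exact (hye c hc).ne' this
  obtain ⟨b, hb⟩ := sL.exists_isOpposite (e := e)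
    (Finset.mem_powersetCard.2 ⟨heL, ha.card_eq⟩)
  refine ⟨L, hL, b, hb, ?_⟩
  obtain ⟨s, hs, hs0⟩ := (hfr.and_eventually self_mem_nhdsWithin).exists
  have hs0 : 0 < s := hs0
  have h1 : sK.coord a (AffineMap.lineMap y a (-s)) = -s := by
    rw [AffineMap.apply_lineMap, hya, sK.coord_self ha.mem, AffineMap.lineMap_apply]
    simp
  rw [ha.coord_eq_mul hb sK sL] at h1
  have h2 := sL.mem_hull_iff.1 hs b hb.mem
  by_contra! h3
  nlinarith [mul_nonneg h2 h3]

/-- Two elements on the same side of a common facet agree. -/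
theorem eq_of_coord_pos (hd : d ≠ 0) {K L e : Finset (Pt d)} {a b : Pt d}
    (hK : K ∈ M.elems) (hL : L ∈ M.elems) (ha : IsOpposite K e a) (hb : IsOpposite L e b)
    (hab : 0 < (M.isSimplex hK).coord a b) : K = L := by
  have sK := M.isSimplex hK
  have sL := M.isSimplex hL
  have hya := ha.coord_barycenter_eq_zero hd sK
  obtain ⟨s, ⟨hsK, hsL⟩, hs0⟩ := (((sK.eventually_coord_pos a fun c hc =>
    ha.coord_barycenter_pos sK hc).and (sL.eventually_coord_pos a fun c hc =>
    hb.coord_barycenter_pos sL hc)).and self_mem_nhdsWithin).exists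
  have hs0 : 0 < s := hs0
  have h1 : sK.coord a (AffineMap.lineMap (barycenter e) a s) = s := by
    rw [AffineMap.apply_lineMap, hya, sK.coord_self ha.mem, AffineMap.lineMap_apply]
    simp
  have hyK : AffineMap.lineMap (barycenter e) a s ∈ hull K := by
    rw [sK.mem_hull_iff]
    intro c hc
    rcases ha.eq_or_mem c hc with rfl | hce
    · rw [h1]; exact hs0.le
    · exact (hsK c hce).le
  have hyL : AffineMap.lineMap (barycenter e) a s ∈ hull L := by
    rw [sL.mem_hull_iff]
    intro c hc
    rcases hb.eq_or_mem c hc with rfl | hce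
    · rw [ha.coord_eq_mul hb sK sL] at h1
      by_contra! hneg
      nlinarith
    · exact (hsL c hce).le
  have haL : a ∈ L := by
    by_contra haL
    have := sK.coord_eq_zero_of_mem_convexHull Set.inter_subset_left
      (M.conforming K hK L hL ⟨hyK, hyL⟩) ha.mem (fun h => haL (by exact_mod_cast h.2))
    rw [h1] at this
    exact hs0.ne' this
  refine Finset.eq_of_subset_of_card_le (fun c hc => ?_) (by rw [sK.card_eq, sL.card_eq])
  rcases ha.eq_or_mem c hc with rfl | hce
  · exact haL
  · exact hb.subset hce

/-- The outward normals at an interior facet cancel. -/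
theorem sum_outwardNormal_eq_zero (hd : d ≠ 0) (hΩ : IsStokesDomain Ω) {e : Finset (Pt d)}
    (he : e ∈ M.interiorFacets) :
    ∑ K : M.Elem, (open Classical in if e ∈ facetsOf K.1 then outwardNormal K.1 e else 0) = 0 := by
  classical
  rw [interiorFacets, Finset.mem_filter, Finset.mem_biUnion] at he
  obtain ⟨⟨K, hK, heK⟩, hef⟩ := he
  have sK := M.isSimplex hK
  obtain ⟨a, ha⟩ := sK.exists_isOpposite heK
  obtain ⟨L, hL, b, hb, hab⟩ := M.exists_neighbour hd hΩ hK ha hef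
  have sL := M.isSimplex hL
  have hKL : K ≠ L := by
    rintro rfl
    have h1 : b = a := (ha.eq_or_mem b hb.mem).resolve_right hb.notMem
    rw [h1, sK.coord_self ha.mem] at hab
    linarith
  rw [Finset.sum_eq_add (⟨K, hK⟩ : M.Elem) ⟨L, hL⟩ (by simpa using hKL)]
  · simp only [heK, hb.mem_facetsOf, if_true]
    rw [IsOpposite.outwardNormal_eq_neg hd ha hb sK sL hab, add_neg_cancel]
  · rintro ⟨J, hJ⟩ - ⟨hJK, hJL⟩
    rw [if_neg]
    intro heJ
    have sJ := M.isSimplex hJ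
    obtain ⟨c, hc⟩ := sJ.exists_isOpposite heJ
    -- A third element containing `e` would lie on the side of `L` or on that of `K`, where the mesh
    -- has room for one element only.
    rcases lt_or_gt_of_ne (ha.coord_ne_zero hc sK sJ) with h | h
    · refine hJL (Subtype.ext (M.eq_of_coord_pos hd hL hJ hb hc ?_).symm)
      have h2 := ha.coord_eq_mul hb sK sL c
      rw [h2] at h
      by_contra! h3
      nlinarith
    · exact hJK (Subtype.ext (M.eq_of_coord_pos hd hK hJ ha hc h).symm)
  · simp
  · simp

/-- A nonempty set of elements that contains each neighbour of its members has a facet on the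
boundary. -/
theorem exists_facet_subset_frontier (hd : d ≠ 0) (hΩ : IsStokesDomain Ω)
    {S : Finset (Finset (Pt d))} (hS : S ⊆ M.elems) (hne : S.Nonempty)
    (hnb : ∀ K ∈ S, ∀ L ∈ M.elems, ∀ e ∈ facetsOf K, e ∈ facetsOf L → L ∈ S) :
    ∃ K ∈ S, ∃ e ∈ facetsOf K, hull e ⊆ frontier Ω := by
  classical
  by_contra! hcon
  obtain ⟨K₀, hK₀⟩ := hne
  set p := barycenter K₀ with hp
  have hpint := (M.isSimplex (hS hK₀)).barycenter_mem_interior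
  set U : Set (Pt d) := ⋃ K ∈ S, hull K with hU
  have hUc : IsCompact U := S.isCompact_biUnion fun K _ => isCompact_hull K
  have hsub : ∀ K ∈ S, hull K ⊆ U := fun K hK => Set.subset_biUnion_of_mem (u := hull) hK
  -- The span of `p` and a codimension-two face is generated by at most `d` points, hence is proper
  -- and Lebesgue-null.
  let F : Finset (Pt d) → Pt d → Pt d → AffineSubspace ℝ (Pt d) := fun K a a' =>
    affineSpan ℝ (insert p ((K.erase a).erase a') : Finset (Pt d))
  have hF : ∀ K ∈ S, ∀ a ∈ K, ∀ a' ∈ K, a ≠ a' → F K a a' ≠ ⊤ := by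
    intro K hK a ha a' ha' hne htop
    have hcard : ((K.erase a).erase a').card + 2 = d + 1 := by
      rw [Finset.card_erase_of_mem (Finset.mem_erase.2 ⟨hne.symm, ha'⟩),
        Finset.card_erase_of_mem ha, (M.isSimplex (hS hK)).card_eq]
      omega
    have hcard2 := Finset.card_insert_le p ((K.erase a).erase a')
    have h1 : finrank ℝ (vectorSpan ℝ
        ((insert p ((K.erase a).erase a') : Finset (Pt d)) : Set (Pt d))) = d := by
      rw [← direction_affineSpan]
      change finrank ℝ (F K a a').direction = d
      rw [htop, AffineSubspace.direction_top]
      simp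
    have hpos := Finset.card_pos.2 (Finset.insert_nonempty p ((K.erase a).erase a'))
    have h2 := finrank_vectorSpan_image_finset_le ℝ (id : Pt d → Pt d)
      (insert p ((K.erase a).erase a')) (n := (insert p ((K.erase a).erase a')).card - 1)
      (by omega)
    rw [Finset.image_id, h1] at h2
    omega
  -- a point outside `U` that sees no codimension two face from `p`
  obtain ⟨z, hzU, hzF⟩ : ∃ z, z ∉ U ∧ ∀ K ∈ S, ∀ a ∈ K, ∀ a' ∈ K, a ≠ a' → z ∉ F K a a' := by
    by_contra! hcon2
    have hcover : (Set.univ : Set (Pt d)) ⊆ U ∪ ⋃ K ∈ S, ⋃ a ∈ K, ⋃ a' ∈ K.filter (a ≠ ·),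
        (F K a a' : Set (Pt d)) := by
      intro z _
      by_cases hz : z ∈ U
      · exact Or.inl hz
      · obtain ⟨K, hK, a, ha, a', ha', hne, hmem⟩ := hcon2 z hz
        right
        simp only [Set.mem_iUnion, Finset.mem_filter]
        exact ⟨K, hK, a, ha, a', ⟨ha', hne⟩, hmem⟩
    have hnull : volume (⋃ K ∈ S, ⋃ a ∈ K, ⋃ a' ∈ K.filter (a ≠ ·),
        (F K a a' : Set (Pt d))) = 0 := by
      refine (measure_biUnion_null_iff S.countable_toSet).2 fun K hK => ?_
      refine (measure_biUnion_null_iff K.countable_toSet).2 fun a ha => ?_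
      refine (measure_biUnion_null_iff (K.filter (a ≠ ·)).countable_toSet).2 fun a' ha' => ?_
      rw [Finset.mem_coe, Finset.mem_filter] at ha'
      exact Measure.addHaar_affineSubspace _ _ (hF K hK a ha a' ha'.1 ha'.2)
    -- Otherwise the whole space would be covered by a compact set and a null set, against its
    -- infinite volume.
    have h1 := (measure_mono hcover).trans (measure_union_le (μ := volume) _ _)
    rw [hnull, add_zero] at h1
    have h2 := h1.trans_lt hUc.measure_lt_top
    have : Nontrivial (Pt d) := by
      have : Nonempty (Fin d) := ⟨⟨0, Nat.pos_of_ne_zero hd⟩⟩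
      infer_instance
    have := NormedSpace.noncompactSpace ℝ (Pt d)
    rw [measure_univ_of_isAddLeftInvariant] at h2
    exact lt_irrefl _ h2
  -- the last point of the segment from `p` to `z` in `U`
  set γ : ℝ → Pt d := fun t => AffineMap.lineMap p z t with hγ
  have hγc : Continuous γ := AffineMap.lineMap_continuous
  have hTc : IsCompact (Set.Icc (0 : ℝ) 1 ∩ γ ⁻¹' U) :=
    isCompact_Icc.inter_right (hUc.isClosed.preimage hγc)
  have hpU : p ∈ U := hsub K₀ hK₀ (interior_subset hpint)
  obtain ⟨t, ⟨ht01, htU⟩, htmax⟩ := hTc.exists_isGreatest ⟨0, by simp, by simpa [hγ] using hpU⟩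
  have ht1 : t < 1 := by
    refine lt_of_le_of_ne ht01.2 fun h => hzU ?_
    have : γ t ∈ U := htU
    simpa [h, hγ] using this
  -- The last point of the segment in `U` cannot be interior to `U`. By the choice of `z` it has at
  -- most one vanishing coordinate, so it is interior to an element or to a facet shared with a
  -- neighbour in `S`; both are impossible.
  have hnot : U ∉ 𝓝 (γ t) := by
    intro hmem
    have h1 : ∀ᶠ s in 𝓝[>] t, γ s ∈ U :=
      (hγc.continuousAt.mono_left nhdsWithin_le_nhds).eventually hmem
    obtain ⟨s, hsU, hst, hs1⟩ := (h1.and (Ioo_mem_nhdsGT ht1)).exists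
    exact (htmax ⟨⟨ht01.1.trans hst.le, hs1.le⟩, hsU⟩).not_gt hst
  obtain ⟨K, hK, hyK⟩ := Set.mem_iUnion₂.1 htU
  have hKS : K ∈ S := hK
  have sK := M.isSimplex (hS hKS)
  have hnn := sK.mem_hull_iff.1 hyK
  by_cases hz : ∃ a ∈ K, sK.coord a (γ t) = 0
  · obtain ⟨a, haK, ha0⟩ := hz
    by_cases hz2 : ∃ a' ∈ K, a ≠ a' ∧ sK.coord a' (γ t) = 0
    · obtain ⟨a', ha'K, hne, ha'0⟩ := hz2
      have hyF : γ t ∈ F K a a' := by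
        refine affineSpan_mono ℝ (s₁ := (((K.erase a).erase a' : Finset (Pt d)) : Set (Pt d)))
          (by rw [Finset.coe_insert]; exact Set.subset_insert _ _) ?_
        refine convexHull_subset_affineSpan _ (sK.mem_convexHull_of_coord
          ((Finset.erase_subset _ _).trans (Finset.erase_subset _ _)) hyK fun c hc hcn => ?_)
        simp only [Finset.mem_erase, not_and] at hcn
        by_cases hca' : c = a'
        · rw [hca', ha'0]
        · by_cases hca : c = a
          · rw [hca, ha0]
          · exact absurd hc (hcn hca' hca)
      rcases ht01.1.eq_or_lt with h0 | h0
      · refine hnot ?_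
        have : γ t = p := by simp [hγ, ← h0]
        rw [this]
        exact mem_of_superset (mem_interior_iff_mem_nhds.1 hpint) (hsub K₀ hK₀)
      · refine hzF K hKS a haK a' ha'K hne ?_
        have hpF : p ∈ F K a a' := subset_affineSpan ℝ _ (by simp)
        have h1 : AffineMap.lineMap p (γ t) t⁻¹ = z := by
          simp only [hγ, AffineMap.lineMap_lineMap_right, inv_mul_cancel₀ h0.ne',
            AffineMap.lineMap_apply_one]
        rw [← h1]
        exact AffineMap.lineMap_mem _ hpF hyF
    · push Not at hz2
      have hopp : IsOpposite K (K.erase a) a :=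
        ⟨haK, Finset.notMem_erase a K, Finset.erase_subset a K, by
          rw [Finset.card_erase_of_mem haK, sK.card_eq]; rfl, fun c hc => by
          by_cases hca : c = a
          · exact Or.inl hca
          · exact Or.inr (Finset.mem_erase.2 ⟨hca, hc⟩)⟩
      obtain ⟨L, hL, b, hb, hab⟩ := M.exists_neighbour hd hΩ (hS hKS) hopp
        (hcon K hKS _ hopp.mem_facetsOf)
      have hLS := hnb K hKS L hL _ hopp.mem_facetsOf hb.mem_facetsOf
      refine hnot (mem_of_superset (hopp.hull_union_mem_nhds hb sK (M.isSimplex hL) hab ha0 ?_)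
        (Set.union_subset (hsub K hKS) (hsub L hLS)))
      intro c hc
      rw [Finset.mem_erase] at hc
      exact (hnn c hc.2).lt_of_ne (hz2 c hc.2 hc.1.symm).symm
  · push Not at hz
    refine hnot (mem_of_superset (mem_interior_iff_mem_nhds.1 ?_) (hsub K hKS))
    rw [sK.mem_interior_hull_iff]
    exact fun a ha => (hnn a ha).lt_of_ne (hz a ha).symm

/-- The elements fill the domain up to a null set. -/
theorem sum_vol (hΩ : IsStokesDomain Ω) : ∑ K : M.Elem, vol K.1 = (volume Ω).toReal := by
  have hdisj : (M.elems : Set (Finset (Pt d))).Pairwise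
      (Function.onFun (AEDisjoint volume) fun K => hull K) := by
    intro K hK L hL hne
    obtain ⟨a, haK, haL⟩ : ∃ a ∈ K, a ∉ L := by
      by_contra! hcon
      exact hne (Finset.eq_of_subset_of_card_le hcon
        (by rw [M.card_elem K hK, M.card_elem L hL]))
    refine measure_mono_null ((M.conforming K hK L hL).trans (convexHull_subset_affineSpan _))
      (Measure.addHaar_affineSubspace _ _ fun htop => ?_)
    have sK := M.isSimplex hK
    have h1 := sK.coord_eq_zero_of_mem_affineSpan (s := (K : Set (Pt d)) ∩ L) (x := a)
      Set.inter_subset_left (by rw [htop]; trivial) haK (fun h => haL (by exact_mod_cast h.2))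
    rw [sK.coord_self haK] at h1
    exact one_ne_zero h1
  have h1 : volume (closure Ω) = ∑ K ∈ M.elems, volume (hull K) := by
    rw [← M.cover]
    exact measure_biUnion_finset₀ hdisj
      fun K _ => (isCompact_hull K).isClosed.measurableSet.nullMeasurableSet
  have h2 : volume (closure Ω) = volume Ω := by
    refine le_antisymm ?_ (measure_mono subset_closure)
    -- Interiors of elements lie in `interior (closure Ω) = Ω`, so the excess of the closure sits in
    -- frontiers of convex sets, which are null.
    have hsub : closure Ω ⊆ Ω ∪ ⋃ K ∈ M.elems, frontier (hull K) := by
      intro x hx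
      rw [← M.cover] at hx
      obtain ⟨K, hK, hxK⟩ := Set.mem_iUnion₂.1 hx
      by_cases hint : x ∈ interior (hull K)
      · left
        rw [← hΩ.interior_closure, ← M.cover]
        exact interior_mono (Set.subset_biUnion_of_mem (u := hull) hK) hint
      · exact Or.inr (Set.mem_biUnion hK ⟨subset_closure hxK, hint⟩)
    refine (measure_mono hsub).trans ((measure_union_le _ _).trans ?_)
    have hnull : volume (⋃ K ∈ M.elems, frontier (hull K)) = 0 :=
      (measure_biUnion_null_iff M.elems.countable_toSet).2 fun K _ =>
        (convex_convexHull ℝ _).addHaar_frontier volume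
    rw [hnull, add_zero]
  rw [← h2, h1, ENNReal.toReal_sum fun K _ => (isCompact_hull K).measure_lt_top.ne,
    ← Finset.sum_coe_sort M.elems]
  rfl

end SimplicialMesh

/-! ### The weak gradient on a single element -/

section WeakGradient

open Module Filter Topology

variable {d : ℕ}

theorem integrableOn_of_continuous {f : Pt d → ℝ} (hf : Continuous f) {s : Set (Pt d)}
    (hs : IsCompact s) {μ : Measure (Pt d)} (hμ : μ s < ⊤) : IntegrableOn f s μ := by
  obtain ⟨C, hC⟩ := hs.exists_bound_of_continuousOn hf.continuousOn
  refine Measure.integrableOn_of_bounded (M := C) hμ.ne hf.aestronglyMeasurable ?_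
  exact (ae_restrict_iff' hs.isClosed.measurableSet).2 (Eventually.of_forall hC)

/-- The Raviart-Thomas field `x ↦ a + b x`. -/
def rtField (v : Pt d × ℝ) (x : Pt d) : Pt d := v.1 + v.2 • x

theorem mem_RT0_iff {q : Pt d → Pt d} : q ∈ RT0 d ↔ ∃ v, q = rtField v :=
  ⟨fun ⟨a, b, h⟩ => ⟨(a, b), h⟩, fun ⟨v, h⟩ => ⟨v.1, v.2, h⟩⟩

theorem rtField_mem (v : Pt d × ℝ) : rtField v ∈ RT0 d := mem_RT0_iff.2 ⟨v, rfl⟩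

theorem continuous_rtField (v : Pt d × ℝ) : Continuous (rtField v) := by
  unfold rtField; fun_prop

theorem rtField_add (v v' : Pt d × ℝ) (x : Pt d) :
    rtField (v + v') x = rtField v x + rtField v' x := by
  simp only [rtField, Prod.fst_add, Prod.snd_add]; module

theorem rtField_smul (c : ℝ) (v : Pt d × ℝ) (x : Pt d) :
    rtField (c • v) x = c • rtField v x := by
  simp only [rtField, Prod.smul_fst, Prod.smul_snd, smul_eq_mul]; module

theorem divergence_rtField (v : Pt d × ℝ) (x : Pt d) : divergence (rtField v) x = d * v.2 := by
  have h : fderiv ℝ (rtField v) x = v.2 • ContinuousLinearMap.id ℝ (Pt d) := by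
    have h1 : HasFDerivAt (rtField v) (v.2 • ContinuousLinearMap.id ℝ (Pt d)) x :=
      ((hasFDerivAt_id x).const_smul v.2).const_add v.1
    exact h1.fderiv
  simp [divergence, h]

/-- The moments of a field over `K`. -/
def fieldInner (K : Finset (Pt d)) (v v' : Pt d × ℝ) : ℝ :=
  ∫ x in hull K, ⟪rtField v x, rtField v' x⟫

/-- The flux of a field through the facet `e` of `K`. -/
def flux (K e : Finset (Pt d)) (q : Pt d → Pt d) : ℝ :=
  ∫ x in hull e, ⟪q x, outwardNormal K e⟫ ∂(surf d)

theorem integrableOn_inner (K : Finset (Pt d)) (v v' : Pt d × ℝ) :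
    IntegrableOn (fun x => ⟪rtField v x, rtField v' x⟫) (hull K) :=
  integrableOn_of_continuous ((continuous_rtField v).inner (continuous_rtField v'))
    (isCompact_hull K) (isCompact_hull K).measure_lt_top

theorem fieldInner_comm (K : Finset (Pt d)) (v v' : Pt d × ℝ) :
    fieldInner K v v' = fieldInner K v' v := by
  simp only [fieldInner, real_inner_comm]

theorem fieldInner_add_right (K : Finset (Pt d)) (v v₁ v₂ : Pt d × ℝ) :
    fieldInner K v (v₁ + v₂) = fieldInner K v v₁ + fieldInner K v v₂ := by
  simp only [fieldInner, rtField_add, inner_add_right]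
  exact integral_add (integrableOn_inner K v v₁) (integrableOn_inner K v v₂)

theorem fieldInner_smul_right (K : Finset (Pt d)) (c : ℝ) (v v' : Pt d × ℝ) :
    fieldInner K v (c • v') = c * fieldInner K v v' := by
  simp only [fieldInner, rtField_smul, inner_smul_right]
  exact integral_const_mul c _

theorem fieldInner_self_nonneg (K : Finset (Pt d)) (v : Pt d × ℝ) : 0 ≤ fieldInner K v v :=
  integral_nonneg fun _ => real_inner_self_nonneg

/-- A field `a + b x` vanishing on an open set vanishes at two distinct points, which forces `b = 0`
and then `a = 0`. -/
theorem eq_zero_of_fieldInner_self (hd : d ≠ 0) {K : Finset (Pt d)} (hK : IsSimplex K)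
    {v : Pt d × ℝ} (h : fieldInner K v v = 0) : v = 0 := by
  rw [fieldInner, integral_eq_zero_iff_of_nonneg (fun _ => real_inner_self_nonneg)
    (integrableOn_inner K v v)] at h
  have h1 : (fun x => ⟪rtField v x, rtField v x⟫) =ᵐ[volume.restrict (interior (hull K))]
      (fun _ => (0 : ℝ)) := ae_restrict_of_ae_restrict_of_subset interior_subset h
  have h2 := Measure.eqOn_open_of_ae_eq h1 isOpen_interior
    ((continuous_rtField v).inner (continuous_rtField v)).continuousOn continuousOn_const
  have h3 : ∀ x ∈ interior (hull K), v.1 + v.2 • x = 0 := fun x hx => by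
    have := h2 hx
    exact inner_self_eq_zero.1 this
  have hb := hK.barycenter_mem_interior
  have : Nontrivial (Pt d) := by
    have : Nonempty (Fin d) := ⟨⟨0, Nat.pos_of_ne_zero hd⟩⟩
    infer_instance
  obtain ⟨y, hy, hne⟩ : ∃ y ∈ interior (hull K), y ≠ barycenter K := by
    have h4 : (𝓝[≠] (barycenter K)).NeBot := inferInstance
    have h5 : ∀ᶠ y in 𝓝[≠] (barycenter K), y ∈ interior (hull K) :=
      nhdsWithin_le_nhds (isOpen_interior.mem_nhds hb)
    obtain ⟨y, hy1, hy2⟩ := (h5.and self_mem_nhdsWithin).exists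
    exact ⟨y, hy1, hy2⟩
  have h5 : v.2 • (y - barycenter K) = 0 := by
    rw [smul_sub, ← add_sub_add_left_eq_sub _ _ v.1, h3 y hy, h3 _ hb, sub_zero]
  have h6 : v.2 = 0 := (smul_eq_zero.1 h5).resolve_right (sub_ne_zero.2 hne)
  have h7 := h3 _ hb
  rw [h6, zero_smul, add_zero] at h7
  exact Prod.ext h7 h6

/-- The right-hand side of the definition of the weak gradient. -/
def gradLoad (K : Finset (Pt d)) (u₀ : ℝ) (ub : Finset (Pt d) → ℝ) (q : Pt d → Pt d) : ℝ :=
  (∑ e ∈ facetsOf K, ∫ x in hull e, ub e * ⟪q x, outwardNormal K e⟫ ∂(surf d))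
    - ∫ x in hull K, u₀ * divergence q x

theorem gradLoad_eq (K : Finset (Pt d)) (u₀ : ℝ) (ub : Finset (Pt d) → ℝ) (q : Pt d → Pt d) :
    gradLoad K u₀ ub q =
      (∑ e ∈ facetsOf K, ub e * flux K e q) - u₀ * ∫ x in hull K, divergence q x := by
  simp only [gradLoad, flux, integral_const_mul]

theorem gradLoad_rtField (K : Finset (Pt d)) (u₀ : ℝ) (ub : Finset (Pt d) → ℝ) (v : Pt d × ℝ) :
    gradLoad K u₀ ub (rtField v) =
      (∑ e ∈ facetsOf K, ub e * flux K e (rtField v)) - u₀ * (vol K * (d * v.2)) := by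
  simp only [gradLoad_eq, divergence_rtField, setIntegral_const, smul_eq_mul]
  rfl

theorem IsSimplex.surf_facet {K e : Finset (Pt d)} (hK : IsSimplex K) (hd : d ≠ 0)
    (he : e ∈ facetsOf K) : 0 < surf d (hull e) ∧ surf d (hull e) < ⊤ := by
  rw [facetsOf, Finset.mem_powersetCard] at he
  exact surf_hull_pos_lt_top hd he.2 (hK.affineIndependent.mono (by exact_mod_cast he.1))

theorem integrableOn_flux {K e : Finset (Pt d)} (hK : IsSimplex K) (hd : d ≠ 0)
    (he : e ∈ facetsOf K) (v : Pt d × ℝ) :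
    IntegrableOn (fun x => ⟪rtField v x, outwardNormal K e⟫) (hull e) (surf d) :=
  integrableOn_of_continuous ((continuous_rtField v).inner continuous_const) (isCompact_hull e)
    (hK.surf_facet hd he).2

theorem flux_add {K e : Finset (Pt d)} (hK : IsSimplex K) (hd : d ≠ 0) (he : e ∈ facetsOf K)
    (v v' : Pt d × ℝ) :
    flux K e (rtField (v + v')) = flux K e (rtField v) + flux K e (rtField v') := by
  simp only [flux, rtField_add, inner_add_left]
  exact integral_add (integrableOn_flux hK hd he v) (integrableOn_flux hK hd he v')

theorem flux_smul {K e : Finset (Pt d)} (c : ℝ) (v : Pt d × ℝ) :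
    flux K e (rtField (c • v)) = c * flux K e (rtField v) := by
  simp only [flux, rtField_smul, real_inner_smul_left]
  exact integral_const_mul c _

/-- The `L²` pairing on the parameters `(a, b)` is definite, so the map to the dual is injective
and, by finite dimension, surjective. -/
theorem exists_isWeakGrad (hd : d ≠ 0) {K : Finset (Pt d)} (hK : IsSimplex K) (u₀ : ℝ)
    (ub : Finset (Pt d) → ℝ) : ∃ g, IsWeakGrad K u₀ ub g := by
  let G : (Pt d × ℝ) →ₗ[ℝ] Module.Dual ℝ (Pt d × ℝ) := LinearMap.mk₂ ℝ (fieldInner K)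
    (fun v v' w => by
      rw [fieldInner_comm, fieldInner_add_right, fieldInner_comm K w, fieldInner_comm K w])
    (fun c v w => by rw [fieldInner_comm, fieldInner_smul_right, fieldInner_comm K w, smul_eq_mul])
    (fieldInner_add_right K) (fieldInner_smul_right K)
  let ℓ : Module.Dual ℝ (Pt d × ℝ) :=
    { toFun := fun v => gradLoad K u₀ ub (rtField v)
      map_add' := fun v v' => by
        simp only [gradLoad_rtField]
        rw [Finset.sum_congr rfl fun e he => by rw [flux_add hK hd he v v', mul_add],
          Finset.sum_add_distrib, Prod.snd_add]
        ring
      map_smul' := fun c v => by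
        simp only [gradLoad_rtField, flux_smul, Prod.smul_snd, smul_eq_mul, RingHom.id_apply,
          mul_sub, Finset.mul_sum]
        congr 1
        · exact Finset.sum_congr rfl fun e _ => by ring
        · ring }
  have hinj : Function.Injective G := by
    rw [injective_iff_map_eq_zero]
    intro v hv
    exact eq_zero_of_fieldInner_self hd hK (show fieldInner K v v = 0 from LinearMap.congr_fun hv v)
  have hsurj : Function.Surjective G :=
    (LinearMap.injective_iff_surjective_of_finrank_eq_finrank Subspace.dual_finrank_eq.symm).1 hinj
  obtain ⟨v, hv⟩ := hsurj ℓ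
  refine ⟨rtField v, rtField_mem v, fun q hq => ?_⟩
  obtain ⟨v', rfl⟩ := mem_RT0_iff.1 hq
  exact LinearMap.congr_fun hv v'

theorem weakGrad_spec (hd : d ≠ 0) {K : Finset (Pt d)} (hK : IsSimplex K) (u₀ : ℝ)
    (ub : Finset (Pt d) → ℝ) : ∃ v, weakGrad K u₀ ub = rtField v ∧
      ∀ v', fieldInner K v v' = gradLoad K u₀ ub (rtField v') := by
  have h : IsWeakGrad K u₀ ub (weakGrad K u₀ ub) :=
    Classical.epsilon_spec (exists_isWeakGrad hd hK u₀ ub)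
  obtain ⟨v, hv⟩ := mem_RT0_iff.1 h.1
  refine ⟨v, hv, fun v' => ?_⟩
  have h2 := h.2 _ (rtField_mem v')
  rw [hv] at h2
  exact h2

/-- Cauchy-Schwarz against the constant unit field, whose squared norm is `vol K`, obtained by
minimizing `‖v + t ε‖²` over `t`. -/
theorem fieldInner_const_sq_le {K : Finset (Pt d)} (hK : IsSimplex K)
    (v : Pt d × ℝ) (i : Fin d) :
    fieldInner K v (EuclideanSpace.single i 1, 0) ^ 2 / vol K ≤ fieldInner K v v := by
  have hv := hK.vol_pos
  set ε : Pt d × ℝ := (EuclideanSpace.single i 1, 0) with hε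
  have hεε : fieldInner K ε ε = vol K := by
    have : ∀ x, ⟪rtField ε x, rtField ε x⟫ = 1 := fun x => by simp [hε, rtField]
    simp only [fieldInner, this, setIntegral_const, smul_eq_mul, mul_one]
    rfl
  set t := -(fieldInner K v ε / vol K) with ht
  have h := fieldInner_self_nonneg K (v + t • ε)
  rw [fieldInner_add_right, fieldInner_comm K _ v, fieldInner_add_right, fieldInner_smul_right,
    fieldInner_smul_right, fieldInner_comm K (v + t • ε) ε, fieldInner_add_right, fieldInner_smul_right, hεε,
    fieldInner_comm K ε v, ht] at h
  have h2 : fieldInner K v v - fieldInner K v ε ^ 2 / vol K = fieldInner K v v +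
      -(fieldInner K v ε / vol K) * fieldInner K v ε + -(fieldInner K v ε / vol K) *
      (fieldInner K v ε + -(fieldInner K v ε / vol K) * vol K) := by
    field_simp
    ring
  linarith

/-- Testing with the field `x - a`, where `a` is the vertex opposite to the facet `e`. -/
theorem exists_pos_gradLoad_eq (hd : d ≠ 0) {K e : Finset (Pt d)} (hK : IsSimplex K)
    (he : e ∈ facetsOf K) : ∃ v : Pt d × ℝ, ∃ c > 0, ∀ u₀ ub,
      gradLoad K u₀ ub (rtField v) = ub e * c - u₀ * (vol K * d) := by
  obtain ⟨a, ha⟩ := hK.exists_isOpposite he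
  have hv : ∀ x, rtField (-a, (1 : ℝ)) x = x - a := fun x => by simp [rtField]; abel
  have hs := hK.surf_facet hd he
  refine ⟨(-a, 1), (surf d).real (hull e) * ‖IsOpposite.height e (barycenter e - a)‖,
    mul_pos (ENNReal.toReal_pos hs.1.ne' hs.2.ne)
      (norm_pos_iff.2 (IsOpposite.height_ne_zero hd ha hK)), fun u₀ ub => ?_⟩
  rw [gradLoad_rtField, Finset.sum_eq_single e, mul_one]
  · congr 2
    rw [flux, setIntegral_congr_fun (g := fun _ => ‖IsOpposite.height e (barycenter e - a)‖)
      (isCompact_hull e).isClosed.measurableSet, setIntegral_const, smul_eq_mul]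
    intro x hx
    simp only [hv]
    exact IsOpposite.inner_sub_outwardNormal hd ha hK hx
  · intro e' he' hne
    rw [facetsOf, Finset.mem_powersetCard] at he'
    have hae : a ∈ e' := by
      by_contra hae
      refine hne (Finset.eq_of_subset_of_card_le (fun c hc => ?_) (by rw [ha.card_eq, he'.2]))
      exact (ha.eq_or_mem c (he'.1 hc)).resolve_left fun h => hae (h ▸ hc)
    rw [flux, setIntegral_congr_fun (g := fun _ => (0 : ℝ))
      (isCompact_hull e').isClosed.measurableSet]
    · simp
    · intro x hx
      simp only [hv]
      exact IsOpposite.inner_sub_outwardNormal_of_mem hx hae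
  · exact fun h => absurd he h

end WeakGradient

/-! ### The stiffness and divergence matrices of the mesh -/

namespace SimplicialMesh

variable {d : ℕ} {Ω : Set (Pt d)} (M : SimplicialMesh Ω)

theorem mem_interiorFacets {e : Finset (Pt d)} : e ∈ M.interiorFacets ↔
    (∃ K ∈ M.elems, e ∈ facetsOf K) ∧ ¬ hull e ⊆ frontier Ω := by
  classical
  rw [interiorFacets, Finset.mem_filter, Finset.mem_biUnion]

theorem facetVal_add (u v : M.Dof → ℝ) (i : Fin d) (e : Finset (Pt d)) :
    M.facetVal (u + v) i e = M.facetVal u i e + M.facetVal v i e := by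
  unfold facetVal; split_ifs <;> simp

theorem facetVal_smul (c : ℝ) (u : M.Dof → ℝ) (i : Fin d) (e : Finset (Pt d)) :
    M.facetVal (c • u) i e = c * M.facetVal u i e := by
  unfold facetVal; split_ifs <;> simp

/-- The load of the `i`-th velocity component on `K`, tested with `q`. -/
def velLoad (u : M.Dof → ℝ) (K : M.Elem) (i : Fin d) (q : Pt d → Pt d) : ℝ :=
  gradLoad K.1 (u (Sum.inl K, i)) (M.facetVal u i) q

theorem velLoad_add (u v : M.Dof → ℝ) (K : M.Elem) (i : Fin d) (q : Pt d → Pt d) :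
    M.velLoad (u + v) K i q = M.velLoad u K i q + M.velLoad v K i q := by
  simp only [velLoad, gradLoad_eq, facetVal_add, Pi.add_apply, add_mul, Finset.sum_add_distrib]
  ring

theorem velLoad_smul (c : ℝ) (u : M.Dof → ℝ) (K : M.Elem) (i : Fin d) (q : Pt d → Pt d) :
    M.velLoad (c • u) K i q = c * M.velLoad u K i q := by
  simp only [velLoad, gradLoad_eq, facetVal_smul, Pi.smul_apply, smul_eq_mul, mul_assoc,
    ← Finset.mul_sum, mul_sub]

theorem velGrad_spec (hd : d ≠ 0) (u : M.Dof → ℝ) (K : M.Elem) (i : Fin d) :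
    ∃ g, M.velGrad u K i = rtField g ∧
      ∀ v, fieldInner K.1 g v = M.velLoad u K i (rtField v) :=
  weakGrad_spec hd (M.isSimplex K.2) _ _

theorem gradForm_eq (hd : d ≠ 0) (u v : M.Dof → ℝ) :
    M.gradForm u v = ∑ K : M.Elem, ∑ i : Fin d, M.velLoad u K i (M.velGrad v K i) := by
  refine Finset.sum_congr rfl fun K _ => Finset.sum_congr rfl fun i _ => ?_
  obtain ⟨g, hg, hg'⟩ := M.velGrad_spec hd u K i
  obtain ⟨g', hv, -⟩ := M.velGrad_spec hd v K i
  rw [hg, hv]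
  exact hg' g'

theorem gradForm_comm (u v : M.Dof → ℝ) : M.gradForm u v = M.gradForm v u := by
  simp only [gradForm, real_inner_comm]

/-- The form `gradForm` as a linear map of its first argument. -/
def gradFormLeft (hd : d ≠ 0) (v : M.Dof → ℝ) : (M.Dof → ℝ) →ₗ[ℝ] ℝ where
  toFun u := M.gradForm u v
  map_add' u u' := by
    simp only [M.gradForm_eq hd, velLoad_add, Finset.sum_add_distrib]
  map_smul' c u := by
    simp only [M.gradForm_eq hd, velLoad_smul, ← Finset.mul_sum, RingHom.id_apply, smul_eq_mul]

theorem eq_sum_single (f : (M.Dof → ℝ) →ₗ[ℝ] ℝ) (u : M.Dof → ℝ) :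
    f u = ∑ p, f (Pi.single p 1) * u p := by
  conv_lhs => rw [← Finset.univ_sum_single u]
  rw [map_sum]
  refine Finset.sum_congr rfl fun p _ => ?_
  have h : (Pi.single p (u p) : M.Dof → ℝ) = u p • Pi.single p 1 := by
    rw [← Pi.single_smul', smul_eq_mul, mul_one]
  rw [h, map_smul, smul_eq_mul, mul_comm]

theorem stiff_mulVec (hd : d ≠ 0) (u : M.Dof → ℝ) (p : M.Dof) :
    (M.stiff *ᵥ u) p = M.gradForm u (Pi.single p 1) :=
  (M.eq_sum_single (M.gradFormLeft hd (Pi.single p 1)) u).symm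

theorem dotProduct_stiff_mulVec (hd : d ≠ 0) (u v : M.Dof → ℝ) :
    v ⬝ᵥ (M.stiff *ᵥ u) = M.gradForm u v := by
  rw [gradForm_comm]
  refine Eq.trans ?_ (M.eq_sum_single (M.gradFormLeft hd u) v).symm
  refine Finset.sum_congr rfl fun p _ => ?_
  rw [M.stiff_mulVec hd, gradForm_comm, mul_comm]
  rfl

theorem stiff_isHermitian : M.stiff.IsHermitian := by
  rw [IsHermitian, conjTranspose_eq_transpose_of_trivial]
  ext p q
  exact M.gradForm_comm _ _

/-! ### The weak divergence -/

theorem vol_mul_weakDiv (u : M.Dof → ℝ) (K : M.Elem) :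
    vol K.1 * M.weakDiv u K = ∑ e ∈ facetsOf K.1, (surf d).real (hull e) *
      ∑ i : Fin d, M.facetVal u i e * outwardNormal K.1 e i := by
  rw [weakDiv, mul_inv_cancel_left₀ (M.isSimplex K.2).vol_pos.ne']
  refine Finset.sum_congr rfl fun e _ => ?_
  rw [setIntegral_const, smul_eq_mul]
  congr 1
  simp [PiLp.inner_apply, mul_comm]

/-- The form `divForm` tested with the indicator of `K`, as a linear map. -/
def divLeft (K : M.Elem) : (M.Dof → ℝ) →ₗ[ℝ] ℝ where
  toFun u := vol K.1 * M.weakDiv u K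
  map_add' u v := by
    simp only [vol_mul_weakDiv, facetVal_add, add_mul, Finset.sum_add_distrib, mul_add]
  map_smul' c u := by
    simp only [vol_mul_weakDiv, facetVal_smul, mul_assoc, ← Finset.mul_sum, RingHom.id_apply,
      smul_eq_mul, mul_left_comm _ c]

theorem divForm_single (u : M.Dof → ℝ) (K : M.Elem) :
    M.divForm u (Pi.single K 1) = vol K.1 * M.weakDiv u K := by
  rw [divForm, Finset.sum_eq_single K]
  · simp only [Pi.single_eq_same, mul_one, setIntegral_const, smul_eq_mul]
    rfl
  · intro L _ hL
    simp [Pi.single_eq_of_ne hL]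
  · simp

theorem divMat_mulVec (u : M.Dof → ℝ) (K : M.Elem) :
    (M.divMat *ᵥ u) K = vol K.1 * M.weakDiv u K := by
  refine Eq.trans ?_ (M.eq_sum_single (M.divLeft K) u).symm
  refine Finset.sum_congr rfl fun p _ => ?_
  change M.divForm (Pi.single p 1) (Pi.single K 1) * u p = _
  rw [divForm_single]
  rfl

/-- Summing by facets instead of elements, each facet value multiplies the sum of the outward
normals there, which is zero; boundary facets carry the value zero. -/
theorem sum_vol_mul_weakDiv (hd : d ≠ 0) (hΩ : IsStokesDomain Ω) (u : M.Dof → ℝ) :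
    ∑ K : M.Elem, vol K.1 * M.weakDiv u K = 0 := by
  classical
  have h1 : ∀ K : M.Elem, vol K.1 * M.weakDiv u K = ∑ e ∈ M.interiorFacets,
      (surf d).real (hull e) * ∑ i : Fin d, M.facetVal u i e *
        (if e ∈ facetsOf K.1 then outwardNormal K.1 e else 0) i := by
    intro K
    rw [vol_mul_weakDiv]
    have h2 : ∀ e, (surf d).real (hull e) * ∑ i : Fin d, M.facetVal u i e *
        (if e ∈ facetsOf K.1 then outwardNormal K.1 e else 0) i =
        if e ∈ facetsOf K.1 then (surf d).real (hull e) * ∑ i : Fin d, M.facetVal u i e *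
          outwardNormal K.1 e i else 0 := by
      intro e; split_ifs <;> simp
    rw [Finset.sum_congr rfl fun e _ => h2 e, Finset.sum_ite_mem]
    refine (Finset.sum_subset Finset.inter_subset_right fun e he hne => ?_).symm
    have h3 : e ∉ M.interiorFacets := fun h => hne (Finset.mem_inter.2 ⟨h, he⟩)
    simp [facetVal, h3]
  rw [Finset.sum_congr rfl fun K _ => h1 K, Finset.sum_comm]
  refine Finset.sum_eq_zero fun e he => ?_
  rw [← Finset.mul_sum, Finset.sum_comm]
  refine mul_eq_zero_of_right _ (Finset.sum_eq_zero fun i _ => ?_)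
  rw [← Finset.mul_sum]
  have h4 := congrArg (fun v : Pt d => v i) (M.sum_outwardNormal_eq_zero hd hΩ he)
  simp only [PiLp.zero_apply, WithLp.ofLp_sum, Finset.sum_apply] at h4
  refine mul_eq_zero_of_right _ (Eq.trans ?_ h4)
  exact Finset.sum_congr rfl fun K _ => by congr

theorem divMat_transpose_mulVec_one (hd : d ≠ 0) (hΩ : IsStokesDomain Ω) :
    M.divMatᵀ *ᵥ (fun _ => 1) = 0 := by
  ext p
  rw [Pi.zero_apply, ← M.sum_vol_mul_weakDiv hd hΩ (Pi.single p 1)]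
  refine Finset.sum_congr rfl fun K _ => ?_
  rw [mul_one]
  exact M.divForm_single _ K

/-- The weak divergence is the mean trace of the weak gradient: test the `i`-th component with the
constant field `e_i`, which has no divergence. -/
theorem vol_mul_weakDiv_eq_sum (u : M.Dof → ℝ) (K : M.Elem) :
    vol K.1 * M.weakDiv u K =
      ∑ i : Fin d, M.velLoad u K i (rtField (EuclideanSpace.single i 1, 0)) := by
  simp only [vol_mul_weakDiv, velLoad, gradLoad_rtField, mul_zero, sub_zero]
  rw [Finset.sum_comm]
  refine Finset.sum_congr rfl fun e _ => ?_
  rw [Finset.mul_sum]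
  refine Finset.sum_congr rfl fun i _ => ?_
  have : flux K.1 e (rtField (EuclideanSpace.single i 1, 0)) =
      (surf d).real (hull e) * outwardNormal K.1 e i := by
    simp [flux, rtField, EuclideanSpace.inner_single_left]
  rw [this]
  ring

theorem gradForm_self_eq (hd : d ≠ 0) (u : M.Dof → ℝ) :
    ∃ g : M.Elem → Fin d → Pt d × ℝ,
      (∀ K i v, fieldInner K.1 (g K i) v = M.velLoad u K i (rtField v)) ∧
      M.gradForm u u = ∑ K : M.Elem, ∑ i : Fin d, fieldInner K.1 (g K i) (g K i) := by
  choose g hg hg' using fun K i => M.velGrad_spec hd u K i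
  refine ⟨g, hg', ?_⟩
  rw [gradForm]
  simp only [hg]
  rfl

/-- Cauchy-Schwarz over pairs of an element and a component. Each pressure is counted once per
component, which is the origin of the factor `d`. -/
theorem dotProduct_divMat_mulVec_sq_le (hd : d ≠ 0) (u : M.Dof → ℝ) (p : M.Elem → ℝ) :
    (p ⬝ᵥ (M.divMat *ᵥ u)) ^ 2 ≤
      d * (u ⬝ᵥ (M.stiff *ᵥ u)) * (p ⬝ᵥ (M.mass *ᵥ p)) := by
  obtain ⟨g, hg, hsum⟩ := M.gradForm_self_eq hd u
  rw [M.dotProduct_stiff_mulVec hd, hsum, mass, dotProduct_diagonal_mulVec]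
  have h1 : p ⬝ᵥ (M.divMat *ᵥ u) = ∑ x : M.Elem × Fin d, (p x.1 * √(vol x.1.1)) *
      (fieldInner x.1.1 (g x.1 x.2) (EuclideanSpace.single x.2 1, 0) / √(vol x.1.1)) := by
    rw [Fintype.sum_prod_type]
    refine Finset.sum_congr rfl fun K _ => ?_
    rw [divMat_mulVec, vol_mul_weakDiv_eq_sum, Finset.mul_sum]
    refine Finset.sum_congr rfl fun i _ => ?_
    have := (Real.sqrt_pos.2 (M.isSimplex K.2).vol_pos).ne'
    rw [hg, mul_assoc, mul_div_cancel₀ _ this]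
  have h2 := Finset.sum_mul_sq_le_sq_mul_sq (Finset.univ : Finset (M.Elem × Fin d))
    (fun x => p x.1 * √(vol x.1.1))
    (fun x => fieldInner x.1.1 (g x.1 x.2) (EuclideanSpace.single x.2 1, 0) / √(vol x.1.1))
  rw [← h1] at h2
  have h3 : ∑ x : M.Elem × Fin d, (p x.1 * √(vol x.1.1)) ^ 2 =
      d * ∑ K : M.Elem, vol K.1 * p K ^ 2 := by
    rw [Fintype.sum_prod_type, Finset.mul_sum]
    refine Finset.sum_congr rfl fun K _ => ?_
    dsimp only
    rw [Finset.sum_const, Finset.card_univ, Fintype.card_fin, nsmul_eq_mul, mul_pow,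
      Real.sq_sqrt (M.isSimplex K.2).vol_pos.le, mul_comm (p K ^ 2)]
  have h4 : ∑ x : M.Elem × Fin d, (fieldInner x.1.1 (g x.1 x.2)
      (EuclideanSpace.single x.2 1, 0) / √(vol x.1.1)) ^ 2 ≤
      ∑ K : M.Elem, ∑ i : Fin d, fieldInner K.1 (g K i) (g K i) := by
    rw [Fintype.sum_prod_type]
    refine Finset.sum_le_sum fun K _ => Finset.sum_le_sum fun i _ => ?_
    rw [div_pow, Real.sq_sqrt (M.isSimplex K.2).vol_pos.le]
    exact fieldInner_const_sq_le (M.isSimplex K.2) _ _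
  rw [h3] at h2
  have h5 : 0 ≤ d * ∑ K : M.Elem, vol K.1 * p K ^ 2 :=
    mul_nonneg d.cast_nonneg (Finset.sum_nonneg fun K _ =>
      mul_nonneg (M.isSimplex K.2).vol_pos.le (sq_nonneg _))
  calc _ ≤ _ := h2
    _ ≤ _ := mul_le_mul_of_nonneg_left h4 h5
    _ = _ := by ring

theorem gradForm_self_nonneg (hd : d ≠ 0) (u : M.Dof → ℝ) : 0 ≤ M.gradForm u u := by
  obtain ⟨g, -, hsum⟩ := M.gradForm_self_eq hd u
  rw [hsum]
  exact Finset.sum_nonneg fun K _ => Finset.sum_nonneg fun i _ => fieldInner_self_nonneg _ _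

/-- A discrete velocity with vanishing weak gradient vanishes. -/
theorem eq_zero_of_gradForm_self (hd : d ≠ 0) (hΩ : IsStokesDomain Ω) {u : M.Dof → ℝ}
    (hu : M.gradForm u u = 0) : u = 0 := by
  classical
  obtain ⟨g, hg, hsum⟩ := M.gradForm_self_eq hd u
  rw [hu] at hsum
  have hd0 : (0 : ℝ) < d := by exact_mod_cast Nat.pos_of_ne_zero hd
  have hload : ∀ K i v, M.velLoad u K i (rtField v) = 0 := by
    intro K i v
    have h1 := (Finset.sum_eq_zero_iff_of_nonneg fun K _ => Finset.sum_nonneg fun i _ =>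
      fieldInner_self_nonneg K.1 (g K i)).1 hsum.symm K (Finset.mem_univ _)
    have h2 := (Finset.sum_eq_zero_iff_of_nonneg fun i _ =>
      fieldInner_self_nonneg K.1 (g K i)).1 h1 i (Finset.mem_univ _)
    have h3 := eq_zero_of_fieldInner_self hd (M.isSimplex K.2) h2
    rw [← hg, h3, fieldInner_comm]
    have := fieldInner_smul_right K.1 0 v 0
    simpa using this
  -- Testing with `x - a` isolates one facet: its value times a positive flux equals the element
  -- value times `d |K|`, so the two vanish together.
  have hrel : ∀ (K : M.Elem) (i : Fin d), ∀ e ∈ facetsOf K.1,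
      (M.facetVal u i e = 0 ↔ u (Sum.inl K, i) = 0) := by
    intro K i e he
    obtain ⟨v, c, hc, hv⟩ := exists_pos_gradLoad_eq hd (M.isSimplex K.2) he
    have h1 := hload K i v
    rw [velLoad, hv, sub_eq_zero] at h1
    have hpos := mul_pos (M.isSimplex K.2).vol_pos hd0
    constructor
    · intro h0
      rw [h0, zero_mul] at h1
      exact (mul_eq_zero.1 h1.symm).resolve_right hpos.ne'
    · intro h0
      rw [h0, zero_mul] at h1
      exact (mul_eq_zero.1 h1).resolve_right hc.ne'
  have helem : ∀ (K : M.Elem) (i : Fin d), u (Sum.inl K, i) = 0 := by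
    intro K₀ i
    by_contra hK₀
    -- Nonvanishing spreads through shared facets, so `S` contains the neighbours of its members and
    -- has a facet on the boundary, where the value is zero.
    set S := M.elems.filter fun K => ∃ h : K ∈ M.elems, u (Sum.inl ⟨K, h⟩, i) ≠ 0 with hS
    have hmem : ∀ {K}, K ∈ S ↔ ∃ h : K ∈ M.elems, u (Sum.inl ⟨K, h⟩, i) ≠ 0 := by
      intro K
      rw [hS, Finset.mem_filter]
      exact ⟨fun h => h.2, fun h => ⟨h.1, h⟩⟩
    obtain ⟨K, hK, e, he, hef⟩ := M.exists_facet_subset_frontier hd hΩ (S := S)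
      (Finset.filter_subset _ _) ⟨K₀.1, hmem.2 ⟨K₀.2, hK₀⟩⟩ (by
        intro K hK L hL e heK heL
        obtain ⟨hK, hKu⟩ := hmem.1 hK
        exact hmem.2 ⟨hL, fun h => hKu ((hrel ⟨K, hK⟩ i e heK).1 ((hrel ⟨L, hL⟩ i e heL).2 h))⟩)
    obtain ⟨hK, hKu⟩ := hmem.1 hK
    refine hKu ((hrel ⟨K, hK⟩ i e he).1 ?_)
    have : e ∉ M.interiorFacets := fun h => (M.mem_interiorFacets.1 h).2 hef
    simp [facetVal, this]
  ext ⟨x | e, i⟩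
  · exact helem x i
  · obtain ⟨⟨K, hK, heK⟩, -⟩ := M.mem_interiorFacets.1 e.2
    have h1 := (hrel ⟨K, hK⟩ i e heK).2 (helem _ i)
    simpa [facetVal, e.2] using h1

theorem isSaddle (hd : d ≠ 0) (hΩ : IsStokesDomain Ω) {w : M.Elem → ℝ} (hw : w ⬝ᵥ w = 1)
    {β : ℝ} (hβ : 0 < β) (hinf : M.IsInfSupConst β) :
    IsSaddle M.stiff M.divMat (fun K => vol K.1) w d β := by
  have hpos : ∀ x, x ≠ 0 → 0 < x ⬝ᵥ (M.stiff *ᵥ x) := fun x hx => by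
    rw [M.dotProduct_stiff_mulVec hd]
    exact (M.gradForm_self_nonneg hd x).lt_of_ne
      fun h => hx (M.eq_zero_of_gradForm_self hd hΩ h.symm)
  have hvol : ∀ K : M.Elem, 0 < vol K.1 := fun K => (M.isSimplex K.2).vol_pos
  have hmass : ∀ p : M.Elem → ℝ, 0 ≤ p ⬝ᵥ (M.mass *ᵥ p) := fun p => by
    rw [mass, dotProduct_diagonal_mulVec]
    exact Finset.sum_nonneg fun K _ => mul_nonneg (hvol K).le (sq_nonneg _)
  exact
    { isHermitian := M.stiff_isHermitian
      pos := hpos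
      mass_pos := hvol
      transpose_mulVec_one := M.divMat_transpose_mulVec_one hd hΩ
      le_bound := fun p => schur_le_of_le hpos p
        (fun v => M.dotProduct_divMat_mulVec_sq_le hd v p)
        (mul_nonneg d.cast_nonneg (hmass p))
      bound_le := fun p hp => le_schur_of_infSup M.stiff_isHermitian hpos hβ.le p (hmass p)
        (hinf p hp)
      norm_eq := hw }

end SimplicialMesh

/-! ### Constants and residual bounds for the discretization -/

namespace SimplicialMesh

variable {d : ℕ} {Ω : Set (Pt d)} (M : SimplicialMesh Ω)

theorem nonempty_elem (hΩ : IsStokesDomain Ω) : Nonempty M.Elem := by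
  obtain ⟨x, hx⟩ := hΩ.isConnected.nonempty
  have h := subset_closure hx
  rw [← M.cover] at h
  obtain ⟨K, hK, -⟩ := Set.mem_iUnion₂.1 h
  exact ⟨⟨K, hK⟩⟩

theorem nonempty_dof (hd : d ≠ 0) (hΩ : IsStokesDomain Ω) : Nonempty M.Dof := by
  obtain ⟨K⟩ := M.nonempty_elem hΩ
  exact ⟨(Sum.inl K, ⟨0, Nat.pos_of_ne_zero hd⟩)⟩

theorem gam_eq (w : M.Elem → ℝ) : M.gam w = (∑ K, w K) / √M.numElem := by
  simp only [gam, oneVec, dotProduct, ← Finset.sum_mul]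
  ring

theorem outlierSlope_eq (hΩ : IsStokesDomain Ω) (w : M.Elem → ℝ) :
    M.outlierSlope w = (∑ K, w K) ^ 2 / ∑ K : M.Elem, vol K.1 := by
  have := M.nonempty_elem hΩ
  have hN : (0 : ℝ) < M.numElem := Nat.cast_pos.2 Fintype.card_pos
  rw [outlierSlope, gam_eq, div_pow, Real.sq_sqrt hN.le, div_mul_cancel₀ _ hN.ne', sum_vol M hΩ]

theorem sum_ne_zero_of_gam {w : M.Elem → ℝ} (hγ : M.gam w ≠ 0) : ∑ K, w K ≠ 0 := by
  intro h
  rw [gam_eq, h, zero_div] at hγ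
  exact hγ rfl

theorem sum_vol_pos (hΩ : IsStokesDomain Ω) : 0 < ∑ K : M.Elem, vol K.1 := by
  have := M.nonempty_elem hΩ
  exact Finset.sum_pos (fun K _ => (M.isSimplex K.2).vol_pos) Finset.univ_nonempty

theorem outlierSlope_pos (hΩ : IsStokesDomain Ω) {w : M.Elem → ℝ} (hγ : M.gam w ≠ 0) :
    0 < M.outlierSlope w := by
  rw [M.outlierSlope_eq hΩ]
  have h1 := M.sum_ne_zero_of_gam hγ
  have h2 := M.sum_vol_pos hΩ
  positivity

theorem lamMin_mass_pos (hΩ : IsStokesDomain Ω) : 0 < lamMin M.mass := by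
  have := M.nonempty_elem hΩ
  exact lamMin_diagonal_pos fun K => (M.isSimplex K.2).vol_pos

theorem lamMin_mass_le_lamMax (hΩ : IsStokesDomain Ω) : lamMin M.mass ≤ lamMax M.mass := by
  obtain ⟨K⟩ := M.nonempty_elem hΩ
  exact (lamMin_diagonal_le (fun K : M.Elem => vol K.1) K).trans
    (le_lamMax_diagonal (fun K : M.Elem => vol K.1) K)

theorem one_le_massRatio (hΩ : IsStokesDomain Ω) : 1 ≤ M.massRatio := by
  rw [massRatio, Real.one_le_sqrt, one_le_div (M.lamMin_mass_pos hΩ)]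
  exact M.lamMin_mass_le_lamMax hΩ

theorem relRho_pos (hΩ : IsStokesDomain Ω) {ρ : ℝ} (hρ : 0 < ρ) : 0 < M.relRho ρ :=
  div_pos hρ (M.lamMin_mass_pos hΩ)

theorem relRho_lt (hΩ : IsStokesDomain Ω) {β ρ : ℝ} (hρ : ρ < β ^ 2 * lamMin M.mass) :
    M.relRho ρ < β ^ 2 := by
  rwa [relRho, div_lt_iff₀ (M.lamMin_mass_pos hΩ)]

theorem outlierSlope_mul_le {A : Matrix M.Dof M.Dof ℝ} {B : Matrix M.Elem M.Dof ℝ}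
    (hΩ : IsStokesDomain Ω) {w : M.Elem → ℝ} {β : ℝ}
    (h : IsSaddle A B (fun K : M.Elem => vol K.1) w d β) {ρ : ℝ} (hρ : 0 < ρ) :
    M.outlierSlope w * ρ ≤ M.relRho ρ := by
  have := M.nonempty_elem hΩ
  have hV := M.sum_vol_pos hΩ
  have h1 := h.dotProduct_sq_le (fun _ => 1)
  simp only [dotProduct, mul_one, one_pow] at h1
  have h2 : M.outlierSlope w ≤ 1 / lamMin M.mass := by
    rw [M.outlierSlope_eq hΩ, div_le_iff₀ hV]
    calc _ ≤ _ := h1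
      _ = _ := by rw [mass]; ring
  calc _ ≤ 1 / lamMin M.mass * ρ := by gcongr
    _ = _ := by rw [relRho]; ring

/-- The lower bound `c ρ β² / (β² + t)` for the outlier. -/
def outlierLower (w : M.Elem → ℝ) (β ρ : ℝ) : ℝ :=
  M.outlierSlope w * ρ * β ^ 2 / (β ^ 2 + M.relRho ρ)

theorem outlierBound_eq (hΩ : IsStokesDomain Ω) (w : M.Elem → ℝ) (β ρ : ℝ) :
    outlierBound (fun K : M.Elem => vol K.1) w β ρ = M.outlierLower w β ρ := by
  rw [outlierBound, outlierLower, M.outlierSlope_eq hΩ, mul_comm ρ]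
  rfl

theorem outlierLower_pos (hΩ : IsStokesDomain Ω) {w : M.Elem → ℝ} (hγ : M.gam w ≠ 0) {β ρ : ℝ}
    (hβ : 0 < β) (hρ : 0 < ρ) : 0 < M.outlierLower w β ρ := by
  have h1 := M.outlierSlope_pos hΩ hγ
  have h2 := M.relRho_pos hΩ hρ
  unfold outlierLower
  positivity

theorem outlierSlope_mul_sub (hΩ : IsStokesDomain Ω) (w : M.Elem → ℝ) {β ρ : ℝ} (hβ : 0 < β)
    (hρ : 0 < ρ) : M.outlierSlope w * ρ - M.outlierLower w β ρ =
      M.outlierSlope w * ρ ^ 2 / (β ^ 2 * lamMin M.mass + ρ) := by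
  have hE := M.lamMin_mass_pos hΩ
  rw [outlierLower, relRho]
  field_simp
  ring

theorem outlierLower_le (hΩ : IsStokesDomain Ω) {w : M.Elem → ℝ} (hγ : M.gam w ≠ 0) {β ρ : ℝ}
    (hβ : 0 < β) (hρ : 0 < ρ) : M.outlierLower w β ρ ≤ M.outlierSlope w * ρ := by
  rw [← sub_nonneg, M.outlierSlope_mul_sub hΩ w hβ hρ]
  have h1 := M.outlierSlope_pos hΩ hγ
  have hE := M.lamMin_mass_pos hΩ
  positivity

/-! ### The convergence factor -/

theorem convFactor_pos (hd : 1 ≤ d) {β ρ : ℝ} (hβ0 : 0 < β) (hβ1 : β < 1) (ht : 0 ≤ M.relRho ρ) :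
    0 < M.convFactor β ρ := by
  have hd' : (1 : ℝ) ≤ d := by exact_mod_cast hd
  have h1 : β ^ 2 - M.relRho ρ < d + M.relRho ρ := by nlinarith
  have h0 : 0 < d + M.relRho ρ := by linarith
  have h2 : √(β ^ 2 - M.relRho ρ) < √(d + M.relRho ρ) := Real.sqrt_lt_sqrt_iff_of_pos h0 |>.2 h1
  exact div_pos (sub_pos.2 h2) (add_pos_of_pos_of_nonneg (Real.sqrt_pos.2 h0) (Real.sqrt_nonneg _))

theorem convFactor_lt_one (hd : 1 ≤ d) {β ρ : ℝ} (ht : 0 ≤ M.relRho ρ)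
    (htβ : M.relRho ρ < β ^ 2) : M.convFactor β ρ < 1 := by
  have hd' : (1 : ℝ) ≤ d := by exact_mod_cast hd
  have h0 : 0 < √(d + M.relRho ρ) := Real.sqrt_pos.2 (by linarith)
  have h1 : 0 < √(β ^ 2 - M.relRho ρ) := Real.sqrt_pos.2 (by linarith)
  rw [convFactor, div_lt_one (by linarith)]
  linarith

/-- This supplies a positive lower bound for the convergence factor that does not depend on `ρ`. -/
theorem convFactor_zero_le (hd : 1 ≤ d) {β ρ : ℝ} (ht : 0 ≤ M.relRho ρ) :
    M.convFactor β 0 ≤ M.convFactor β ρ := by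
  have hd' : (1 : ℝ) ≤ d := by exact_mod_cast hd
  have h0 : M.relRho 0 = 0 := zero_div _
  have h1 : √(d : ℝ) ≤ √(d + M.relRho ρ) := Real.sqrt_le_sqrt (by linarith)
  have h2 : √(β ^ 2 - M.relRho ρ) ≤ √(β ^ 2) := Real.sqrt_le_sqrt (by linarith)
  have h3 : 0 < √(d : ℝ) := Real.sqrt_pos.2 (by linarith)
  have h4 := Real.sqrt_nonneg (β ^ 2 - M.relRho ρ)
  rw [convFactor, convFactor, h0, add_zero, sub_zero, div_le_div_iff₀ (by linarith) (by linarith)]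
  nlinarith [mul_le_mul h1 h2 h4 (by linarith)]

/-! ### Residual bounds -/

theorem precSys_eq {w : M.Elem → ℝ} {β : ℝ}
    (h : IsSaddle M.stiff M.divMat (fun K : M.Elem => vol K.1) w d β) (ρ : ℝ) :
    M.precSys w ρ = precBlock M.stiff M.divMat (fun K : M.Elem => vol K.1) w ρ :=
  inv_mul_eq_precBlock (isUnit_det_of_pos h.pos) _ h.mass_pos w ρ

theorem couplingConst_add_pos (hΩ : IsStokesDomain Ω) (hd : 1 ≤ d) :
    1 ≤ M.couplingConst + d * M.massRatio := by
  have h1 : 0 ≤ M.couplingConst := Real.sqrt_nonneg _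
  have h2 := M.one_le_massRatio hΩ
  have hd' : (1 : ℝ) ≤ d := by exact_mod_cast hd
  nlinarith

section Bounds

variable {w : M.Elem → ℝ} {β ρ : ℝ}

theorem resNorm_le_initial {b x₀ x : M.Dof ⊕ M.Elem → ℝ} {k : ℕ} (hx : M.IsIterate w ρ b x₀ k x) :
    M.resNorm w ρ b x ≤ M.resNorm w ρ b x₀ :=
  hx.euclNorm_le_initial

theorem resNorm_nonneg (b x : M.Dof ⊕ M.Elem → ℝ) : 0 ≤ M.resNorm w ρ b x := euclNorm_nonneg _

theorem resNorm_eq_zero (hd : 1 ≤ d) (hΩ : IsStokesDomain Ω)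
    (h : IsSaddle M.stiff M.divMat (fun K : M.Elem => vol K.1) w d β) (hγ : M.gam w ≠ 0)
    (hβ0 : 0 < β) (hβ1 : β < 1) (hρ0 : 0 < ρ) (hρ : ρ < β ^ 2 * lamMin M.mass)
    {b x₀ x : M.Dof ⊕ M.Elem → ℝ} {k : ℕ} (hx : M.IsIterate w ρ b x₀ k x)
    (hk : M.numElem + 1 ≤ k) : M.resNorm w ρ b x = 0 := by
  have := M.nonempty_elem hΩ
  have := M.nonempty_dof (by omega) hΩ
  rw [IsIterate, M.precSys_eq h] at hx
  rw [resNorm, M.precSys_eq h]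
  exact h.gmres_eq_zero (by exact_mod_cast hd) hβ0 hβ1 hρ0 (M.relRho_lt hΩ hρ)
    (M.sum_ne_zero_of_gam hγ) hx hk

theorem resNorm_le (hd : 1 ≤ d) (hΩ : IsStokesDomain Ω)
    (h : IsSaddle M.stiff M.divMat (fun K : M.Elem => vol K.1) w d β) (hγ : M.gam w ≠ 0)
    (hβ0 : 0 < β) (hβ1 : β < 1) (hρ0 : 0 < ρ) (hρ : ρ < β ^ 2 * lamMin M.mass)
    {b x₀ x : M.Dof ⊕ M.Elem → ℝ} {k : ℕ} (hx : M.IsIterate w ρ b x₀ k x) :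
    M.resNorm w ρ b x ≤ 2 * (M.couplingConst + d * M.massRatio) *
      ((d + M.relRho ρ + M.outlierLower w β ρ) / M.outlierLower w β ρ) *
      M.convFactor β ρ ^ ((k : ℤ) - 2) * M.resNorm w ρ b x₀ := by
  have hne := M.nonempty_elem hΩ
  have hne' := M.nonempty_dof (by omega) hΩ
  have ht := M.relRho_pos hΩ hρ0
  have hq0 := M.convFactor_pos hd hβ0 hβ1 ht.le
  have hq1 := M.convFactor_lt_one hd ht.le (M.relRho_lt hΩ hρ)
  have hl := M.outlierLower_pos hΩ hγ hβ0 hρ0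
  have hG := M.couplingConst_add_pos hΩ hd
  -- For `k < 2` the exponent is negative, every factor on the right is at least one, and it
  -- suffices that the residual does not grow.
  rcases lt_or_ge k 2 with hk | hk
  · have h1 : 1 ≤ (d + M.relRho ρ + M.outlierLower w β ρ) / M.outlierLower w β ρ := by
      rw [one_le_div hl]
      have : (0 : ℝ) ≤ d := d.cast_nonneg
      linarith
    have h2 : 1 ≤ M.convFactor β ρ ^ ((k : ℤ) - 2) := by
      have h3 : (k : ℤ) - 2 ≤ 0 := by omega
      exact one_le_zpow_of_nonpos₀ hq0 hq1.le h3
    have h4 : 1 ≤ 2 * (M.couplingConst + d * M.massRatio) := by linarith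
    have h5 := one_le_mul_of_one_le_of_one_le (one_le_mul_of_one_le_of_one_le h4 h1) h2
    exact (M.resNorm_le_initial hx).trans (le_mul_of_one_le_left (M.resNorm_nonneg _ _) h5)
  · obtain ⟨j, rfl⟩ := Nat.exists_eq_add_of_le' hk
    rw [IsIterate, M.precSys_eq h] at hx
    have h1 := h.gmres_le_of_two_le (by exact_mod_cast hd) hβ0 hβ1 hρ0 (M.relRho_lt hΩ hρ)
      (M.sum_ne_zero_of_gam hγ) hx
    rw [M.outlierBound_eq hΩ] at h1
    rw [resNorm, resNorm, M.precSys_eq h]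
    refine h1.trans (le_of_eq ?_)
    have h2 : ((j + 2 : ℕ) : ℤ) - 2 = (j : ℤ) := by push_cast; ring
    rw [h2, zpow_natCast, couplingConst, massRatio, convFactor, relRho, mass]
    ring

/-- The amplification factor of the outlier. -/
theorem div_outlierLower_le (hΩ : IsStokesDomain Ω)
    (h : IsSaddle M.stiff M.divMat (fun K : M.Elem => vol K.1) w d β) (hγ : M.gam w ≠ 0)
    (hβ0 : 0 < β) (hβ1 : β < 1) (hρ0 : 0 < ρ) (hρ : ρ < β ^ 2 * lamMin M.mass) :
    (d + M.relRho ρ + M.outlierLower w β ρ) / M.outlierLower w β ρ ≤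
      2 * (d + 2) / (M.outlierSlope w * ρ) := by
  have ht := M.relRho_pos hΩ hρ0
  have htβ := M.relRho_lt hΩ hρ
  have hl := M.outlierLower_pos hΩ hγ hβ0 hρ0
  have hc := mul_pos (M.outlierSlope_pos hΩ hγ) hρ0
  have hct := M.outlierSlope_mul_le hΩ h hρ0
  have hβ2 : β ^ 2 < 1 := by nlinarith
  have hlc := M.outlierLower_le hΩ hγ hβ0 hρ0
  -- Since `t < β²`, the denominator `β² + t` in `outlierLower` is below `2 β²`.
  have hl2 : M.outlierSlope w * ρ ≤ 2 * M.outlierLower w β ρ := by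
    rw [outlierLower, ← mul_div_assoc, le_div_iff₀ (by positivity)]
    nlinarith
  have hd0 : (0 : ℝ) ≤ d := d.cast_nonneg
  rw [div_le_div_iff₀ hl hc]
  have h1 : d + M.relRho ρ + M.outlierLower w β ρ ≤ d + 2 := by linarith
  calc _ ≤ (d + 2) * (2 * M.outlierLower w β ρ) := by gcongr
    _ = _ := by ring

end Bounds

end SimplicialMesh

end StokesWG

end

/-! ### Assembly of the three claims -/

theorem proposition5p2 {d : ℕ} (hd : d = 2 ∨ d = 3) {Ω : Set (StokesWG.Pt d)}
    (hΩ : StokesWG.IsStokesDomain Ω) (M : StokesWG.SimplicialMesh Ω)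
    (w : M.Elem → ℝ) (hw : w ⬝ᵥ w = 1) (hγ : M.gam w ≠ 0)
    (β : ℝ) (hβ_pos : 0 < β) (hβ_lt : β < 1) (hβ : M.IsInfSupConst β) :
    -- the residual bound, with remainders `O(ρ²)` that do not depend on `k`, `b`, `x₀`
    (∃ C : ℝ, ∀ ρ : ℝ, 0 < ρ → ρ < β ^ 2 * StokesWG.lamMin M.mass →
      ∃ η₁ η₂ : ℝ, |η₁| ≤ C * ρ ^ 2 ∧ |η₂| ≤ C * ρ ^ 2 ∧ 0 < M.outlierSlope w * ρ + η₂ ∧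
        ∀ (b x₀ : M.Dof ⊕ M.Elem → ℝ) (k : ℕ) (x : M.Dof ⊕ M.Elem → ℝ),
          M.IsIterate w ρ b x₀ k x →
          M.resNorm w ρ b x ≤
            2 * (1 + M.couplingConst + d) *
              ((d + M.relRho ρ + M.outlierSlope w * ρ + η₁) / (M.outlierSlope w * ρ + η₂)) *
              M.convFactor β ρ ^ ((k : ℤ) - 2) * M.resNorm w ρ b x₀) ∧
    -- the same with an explicit remainder
    (∀ ρ : ℝ, 0 < ρ → ρ < β ^ 2 * StokesWG.lamMin M.mass →
      ∃ η : ℝ, |η| ≤ M.outlierSlope w * ρ ^ 2 / (β ^ 2 * StokesWG.lamMin M.mass + ρ) ∧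
        ∀ (b x₀ : M.Dof ⊕ M.Elem → ℝ) (k : ℕ) (x : M.Dof ⊕ M.Elem → ℝ),
          M.IsIterate w ρ b x₀ k x →
          M.resNorm w ρ b x ≤
            2 * (M.couplingConst + d * M.massRatio) *
              ((d + M.relRho ρ + M.outlierSlope w * ρ + η) / (M.outlierSlope w * ρ + η)) *
              M.convFactor β ρ ^ ((k : ℤ) - 2) * M.resNorm w ρ b x₀) ∧
    -- the number of iterations depends on `γ² N ρ` only logarithmically
    (∀ ρ : ℝ, 0 < ρ → ρ < β ^ 2 * StokesWG.lamMin M.mass →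
      ∀ ε : ℝ, 0 < ε →
        ∀ (b x₀ : M.Dof ⊕ M.Elem → ℝ) (k : ℕ) (x : M.Dof ⊕ M.Elem → ℝ),
          M.IsIterate w ρ b x₀ k x →
          2 + Real.log (4 * (d + 2) * (M.couplingConst + d * M.massRatio) /
              (M.outlierSlope w * ρ * ε)) / Real.log (1 / M.convFactor β ρ) ≤ (k : ℝ) →
          M.resNorm w ρ b x ≤ ε * M.resNorm w ρ b x₀) := by
  have hd1 : 1 ≤ d := by omega
  have h := M.isSaddle (by omega) hΩ hw hβ_pos hβ
  have hc := M.outlierSlope_pos hΩ hγ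
  have hE := M.lamMin_mass_pos hΩ
  have hG := M.couplingConst_add_pos hΩ hd1
  have hd0 : (1 : ℝ) ≤ d := by exact_mod_cast hd1
  set c := M.outlierSlope w with hc_def
  set G := M.couplingConst + d * M.massRatio with hG_def
  have hη : ∀ ρ : ℝ, 0 < ρ → |M.outlierLower w β ρ - c * ρ| ≤
      c * ρ ^ 2 / (β ^ 2 * StokesWG.lamMin M.mass + ρ) := by
    intro ρ hρ0
    have h1 := M.outlierSlope_mul_sub hΩ w hβ_pos hρ0
    rw [abs_sub_comm, h1, abs_of_nonneg (by positivity)]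
  refine ⟨?_, ?_, ?_⟩
  · -- small `ρ`: finite termination; the remaining `ρ` are bounded below
    set F := 1 + M.couplingConst + d with hF_def
    have hF : 1 ≤ F := by
      have : 0 ≤ M.couplingConst := Real.sqrt_nonneg _
      linarith
    have h00 : (0 : ℝ) ≤ M.relRho 0 := (zero_div _).ge
    set Q := M.convFactor β 0 ^ M.numElem with hQ_def
    have hQ : 0 < Q := pow_pos (M.convFactor_pos hd1 hβ_pos hβ_lt h00) _
    -- Chosen so that `2 F (d / (c ρ)) Q ≥ 1` exactly when `ρ ≤ ρ₀`; the left side bounds the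
    -- claimed factor from below for all `k ≤ N`.
    set ρ₀ := 2 * F * d * Q / c with hρ₀_def
    have hρ₀ : 0 < ρ₀ := by positivity
    -- The first term bounds `|l - c ρ| / ρ²`; the second pays for the enlarged numerator when `ρ >
    -- ρ₀`.
    refine ⟨c / (β ^ 2 * StokesWG.lamMin M.mass) + G * (d + 2) / ρ₀ ^ 2, fun ρ hρ0 hρ => ?_⟩
    have ht := M.relRho_pos hΩ hρ0
    have htβ := M.relRho_lt hΩ hρ
    have hl := M.outlierLower_pos hΩ hγ hβ_pos hρ0
    have hlc := M.outlierLower_le hΩ hγ hβ_pos hρ0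
    have hct := M.outlierSlope_mul_le hΩ h hρ0
    have hq0 := M.convFactor_pos hd1 hβ_pos hβ_lt ht.le
    have hq1 := M.convFactor_lt_one hd1 ht.le htβ
    have hη1 : |M.outlierLower w β ρ - c * ρ| ≤
        c / (β ^ 2 * StokesWG.lamMin M.mass) * ρ ^ 2 := by
      refine (hη ρ hρ0).trans ?_
      rw [div_mul_eq_mul_div]
      gcongr
      linarith
    have hη2 : |M.outlierLower w β ρ - c * ρ| ≤
        (c / (β ^ 2 * StokesWG.lamMin M.mass) + G * (d + 2) / ρ₀ ^ 2) * ρ ^ 2 := by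
      refine hη1.trans ?_
      gcongr
      exact le_add_of_nonneg_right (by positivity)
    set l := M.outlierLower w β ρ with hl_def
    rcases le_or_gt ρ ρ₀ with hsmall | hlarge
    · refine ⟨l - c * ρ, l - c * ρ, hη2, hη2, by linarith, fun b x₀ k x hx => ?_⟩
      have hr0 := M.resNorm_nonneg (w := w) (ρ := ρ) b x₀
      have hnum : d + M.relRho ρ + c * ρ + (l - c * ρ) = d + M.relRho ρ + l := by ring
      rw [hnum, add_sub_cancel]
      rcases le_or_gt (M.numElem + 1) k with hk | hk
      · rw [M.resNorm_eq_zero hd1 hΩ h hγ hβ_pos hβ_lt hρ0 hρ hx hk]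
        positivity
      · refine (M.resNorm_le_initial hx).trans (le_mul_of_one_le_left hr0 ?_)
        -- Before termination `k ≤ N`, so the power is at least the `N`-th power of the factor,
        -- which is at least that for `ρ = 0`.
        have h1 : Q ≤ M.convFactor β ρ ^ ((k : ℤ) - 2) := by
          calc Q ≤ M.convFactor β ρ ^ M.numElem :=
                pow_le_pow_left₀ (M.convFactor_pos hd1 hβ_pos hβ_lt h00).le
                  (M.convFactor_zero_le hd1 ht.le) _
            _ = M.convFactor β ρ ^ (M.numElem : ℤ) := (zpow_natCast _ _).symm
            _ ≤ _ := zpow_le_zpow_right_of_le_one₀ hq0 hq1.le (by omega)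
        have h2 : (d : ℝ) / (c * ρ) ≤ (d + M.relRho ρ + l) / l :=
          div_le_div₀ (by positivity) (by linarith) hl hlc
        have h3 : 1 ≤ 2 * F * ((d : ℝ) / (c * ρ)) * Q := by
          rw [hρ₀_def, le_div_iff₀ hc] at hsmall
          have h4 : 2 * F * ((d : ℝ) / (c * ρ)) * Q = 2 * F * d * Q / (c * ρ) := by ring
          rw [h4, one_le_div (by positivity)]
          linarith
        refine h3.trans ?_
        gcongr
    -- This remainder multiplies the numerator by `1 + G`, and `G ≤ F (1 + G)` then replaces the
    -- constant `G` by `F`.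
    · refine ⟨l - c * ρ + G * (d + M.relRho ρ + l), l - c * ρ, ?_, hη2, by linarith,
        fun b x₀ k x hx => ?_⟩
      · refine (abs_add_le _ _).trans ?_
        rw [add_mul (c / (β ^ 2 * StokesWG.lamMin M.mass)),
          abs_of_nonneg (a := G * (d + M.relRho ρ + l)) (by positivity)]
        refine add_le_add hη1 ?_
        have h1 : (1 : ℝ) ≤ ρ ^ 2 / ρ₀ ^ 2 := by
          rw [one_le_div (by positivity)]
          gcongr
        have h2 : d + M.relRho ρ + l ≤ d + 2 := by
          have : β ^ 2 < 1 := by nlinarith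
          linarith
        calc G * (d + M.relRho ρ + l) ≤ G * (d + 2) * 1 := by rw [mul_one]; gcongr
          _ ≤ G * (d + 2) * (ρ ^ 2 / ρ₀ ^ 2) := by gcongr
          _ = _ := by ring
      · have hr0 := M.resNorm_nonneg (w := w) (ρ := ρ) b x₀
        refine (M.resNorm_le hd1 hΩ h hγ hβ_pos hβ_lt hρ0 hρ hx).trans ?_
        rw [← hl_def, ← hG_def]
        have hnum : d + M.relRho ρ + c * ρ + (l - c * ρ + G * (d + M.relRho ρ + l)) =
            (1 + G) * (d + M.relRho ρ + l) := by ring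
        rw [hnum, add_sub_cancel]
        have h1 : 2 * G * ((d + M.relRho ρ + l) / l) ≤
            2 * F * ((1 + G) * (d + M.relRho ρ + l) / l) := by
          have h2 : 0 ≤ (d + M.relRho ρ + l) / l := by positivity
          have h3 : G ≤ F * (1 + G) := by nlinarith
          calc _ ≤ 2 * (F * (1 + G)) * ((d + M.relRho ρ + l) / l) := by gcongr
            _ = _ := by ring
        gcongr
  · intro ρ hρ0 hρ
    refine ⟨M.outlierLower w β ρ - c * ρ, hη ρ hρ0, fun b x₀ k x hx => ?_⟩
    have h1 := M.resNorm_le hd1 hΩ h hγ hβ_pos hβ_lt hρ0 hρ hx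
    have hnum : d + M.relRho ρ + c * ρ + (M.outlierLower w β ρ - c * ρ) =
        d + M.relRho ρ + M.outlierLower w β ρ := by ring
    rwa [hnum, add_sub_cancel]
  · intro ρ hρ0 hρ ε hε b x₀ k x hx hk
    have ht := M.relRho_pos hΩ hρ0
    have hq0 := M.convFactor_pos hd1 hβ_pos hβ_lt ht.le
    have hq1 := M.convFactor_lt_one hd1 ht.le (M.relRho_lt hΩ hρ)
    have hr0 := M.resNorm_nonneg (w := w) (ρ := ρ) b x₀
    set q := M.convFactor β ρ with hq_def
    set Y := 4 * (d + 2) * G / (c * ρ * ε) with hY_def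
    have hY : 0 < Y := by positivity
    have hlog : 0 < Real.log (1 / q) := Real.log_pos (by rw [one_lt_div hq0]; exact hq1)
    -- `Y` is `ε⁻¹` times the total prefactor `2 G · 2 (d + 2) / (c ρ)`, so this decay of the power
    -- is what the tolerance requires.
    have hqk : q ^ ((k : ℤ) - 2) ≤ Y⁻¹ := by
      rw [← Real.log_le_log_iff (zpow_pos hq0 _) (inv_pos.2 hY), Real.log_zpow, Real.log_inv]
      have h1 : Real.log Y / Real.log (1 / q) ≤ k - 2 := by linarith
      rw [div_le_iff₀ hlog, one_div, Real.log_inv] at h1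
      push_cast
      linarith
    have h1 := M.resNorm_le hd1 hΩ h hγ hβ_pos hβ_lt hρ0 hρ hx
    have h2 := M.div_outlierLower_le hΩ h hγ hβ_pos hβ_lt hρ0 hρ
    rw [← hG_def, ← hq_def] at h1
    refine h1.trans ?_
    calc _ ≤ 2 * G * (2 * (d + 2) / (c * ρ)) * Y⁻¹ * M.resNorm w ρ b x₀ := by gcongr
      _ = ε * M.resNorm w ρ b x₀ := by
        congr 1
        rw [hY_def]
        field_simp
        ring
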